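/- Let $\mathbb{D}$ be the open unit disk and $\mathbb{T}$ the unit circle in $\mathbb{C}$. Let $p\in\mathbb{C}[z,w]$ have degree $(n,m)$, that is, degree exactly $n$ in $z$ and exactly $m$ in $w$, and let $\tilde p(z,w)=z^nw^m\,\overline{p(1/\bar z,1/\bar w)}$ be its reflection, again a polynomial. Suppose that $p$ has no zeros on $\mathbb{T}\times\mathbb{D}$ and that $p$ and $\tilde p$ have no nonconstant common factor in $\mathbb{C}[z,w]$. Let $n_2$ be the number of zeros of $p(z,0)$ in $\mathbb{D}$, counted with multiplicity, and $n_1=n-n_2$. Then: 1. There exist vector polynomials $E\in\mathbb{C}^m[z,w]$, $A\in\mathbb{C}^{n_1}[z,w]$, $B\in\mathbb{C}^{n_2}[z,w]$ such that for all $(z,w)\in\mathbb{C}^2$ $$|p(z,w)|^2-|\tilde p(z,w)|^2=(1-|w|^2)\,|E(z,w)|^2+(1-|z|^2)\bigl(|A(z,w)|^2-|B(z,w)|^2\bigr),$$ where $|\cdot|$ is the Euclidean norm; the entries of $E$ have degree at most $(n,m-1)$, the entries of $A$ and $B$ have degree at most $(n-1,m)$ (a vector of length $0$ has no entries); and the $n$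 entries of $A$ and $B$ together are linearly independent over $\mathbb{C}$. 2. There exists a $(1+m+n)\times(1+m+n)$ unitary matrix $V=\begin{pmatrix}V_1&V_2\\V_3&V_4\end{pmatrix}$, in blocks with respect to $\mathbb{C}^{1}\oplus\mathbb{C}^{m+n}$, such that with the block diagonal matrices $\Delta(z,w)=\operatorname{diag}(wI_m,\,zI_{n_1},\,I_{n_2})$ and $\Gamma(z)=\operatorname{diag}(I_m,\,I_{n_1},\,zI_{n_2})$, for every $(z,w)\in\mathbb{C}^2$ with $p(z,w)\neq0$ the matrix $\Gamma(z)-V_4\Delta(z,w)$ is invertible and $$\frac{\tilde p(z,w)}{p(z,w)}=V_1+V_2\,\Delta(z,w)\,\bigl(\Gamma(z)-V_4\,\Delta(z,w)\bigr)^{-1}V_3 .$$ -/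

import Mathlib

open scoped ComplexConjugate

noncomputable section

namespace BiPoly

/-- The value `p(z,w)` of `p ∈ ℂ[z,w]`; variable `0` is `z` and variable `1` is `w`. -/
def val (p : MvPolynomial (Fin 2) ℂ) (z w : ℂ) : ℂ :=
  MvPolynomial.eval ![z, w] p

/-- The exponent of the monomial `z ^ i * w ^ j`. -/
def expo (i j : ℕ) : Fin 2 →₀ ℕ :=
  Finsupp.single 0 i + Finsupp.single 1 j

/-- `p` has degree at most `j` in `z` and at most `k` in `w`. -/
def DegreeAtMost (j k : ℕ) (p : MvPolynomial (Fin 2) ℂ) : Prop :=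
  p.degreeOf 0 ≤ j ∧ p.degreeOf 1 ≤ k

/-- `p` has degree exactly `j` in `z` and exactly `k` in `w`. -/
def HasDegree (j k : ℕ) (p : MvPolynomial (Fin 2) ℂ) : Prop :=
  p.degreeOf 0 = j ∧ p.degreeOf 1 = k

/-- The reflection of `p` at the degree `(n, m)`. For `p` of degree at most `(n, m)` it is the
polynomial `z ^ n * w ^ m * conj (p (1 / conj z, 1 / conj w))`: the coefficient at `z ^ i * w ^ j`
is the conjugate of the coefficient of `p` at `z ^ (n - i) * w ^ (m - j)`. -/
def reflect (n m : ℕ) (p : MvPolynomial (Fin 2) ℂ) : MvPolynomial (Fin 2) ℂ :=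
  ∑ i ∈ Finset.range (n + 1), ∑ j ∈ Finset.range (m + 1),
    MvPolynomial.monomial (expo i j) (conj (p.coeff (expo (n - i) (m - j))))

/-- The one-variable polynomial `p(z, 0)`. -/
def atZero (p : MvPolynomial (Fin 2) ℂ) : Polynomial ℂ :=
  MvPolynomial.aeval ![Polynomial.X, 0] p

open Classical in
/-- The number of zeros of a nonzero `q ∈ ℂ[z]` in the open unit disk, with multiplicity. -/
def zerosInDisk (q : Polynomial ℂ) : ℕ :=
  q.roots.countP (fun a => ‖a‖ < 1)

/-- The diagonal matrix with blocks `w I`, `z I`, `I` of sizes `m`, `n₁`, `n₂`. -/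
def Delta (m n₁ n₂ : ℕ) (z w : ℂ) :
    Matrix (Fin m ⊕ Fin n₁ ⊕ Fin n₂) (Fin m ⊕ Fin n₁ ⊕ Fin n₂) ℂ :=
  Matrix.diagonal (Sum.elim (fun _ => w) (Sum.elim (fun _ => z) (fun _ => 1)))

/-- The diagonal matrix with blocks `I`, `I`, `z I` of sizes `m`, `n₁`, `n₂`. -/
def Gamma (m n₁ n₂ : ℕ) (z : ℂ) :
    Matrix (Fin m ⊕ Fin n₁ ⊕ Fin n₂) (Fin m ⊕ Fin n₁ ⊕ Fin n₂) ℂ :=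
  Matrix.diagonal (Sum.elim (fun _ => 1) (Sum.elim (fun _ => 1) (fun _ => z)))

end BiPoly

end

/-! ### Fourier analysis on the circle: analytic functions and division by polynomials -/

noncomputable section

namespace BiPoly

open Polynomial MeasureTheory

/-! Write `p = ∑ p_b(z) w^b` and let `p~` be the reflection. Suppose first that `p` has no zeros on
the circle times the closed disk. For `|z| = 1`, dividing `p(z,w) p(z,ω)^* - p~(z,w) p~(z,ω)^*` by
`1 - w ω^*` gives a kernel whose coefficients form the Schur-Cohn matrix `T(z)`, which is positive
definite (`posDef_schurMat`). Its entries are trigonometric polynomials of degree at most `n`, so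
the matrix Fejér-Riesz theorem (`exists_spectral_factor`) gives `T = E E^*` on the circle, with `E`
polynomial of degree at most `n` and `E⁻¹` analytic. Let `P` have the columns `p` and `E` moved down
by one row, and `Q` the columns `p~` and `E` not moved. Then `P P^* = Q Q^*` on the circle
(`schurMat_gram`), so `P(z) P(ζ)^* - Q(z) Q(ζ)^*` is divisible by `1 - z ζ^*`. The coefficients of
the quotient form a Hermitian matrix, the Bezoutian; writing it as `k₁` positive squares `A` minus
`k₂` squares `B`, all linearly independent, yields the sums of squares identity.

The numbers of squares are bounded by inertia. The Bezoutian form at `c` is `‖x‖² - ‖y‖²`, where `x`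
and `y` are the analytic parts of `P^* c` and `Q^* c`. It is nonnegative as soon as `P x - Q y = P
g` with `g` analytic (`form_nonneg_of_mulVec_eq`). The first row of `P` is `(p_0, 0, …, 0)` and `E`
is outer, so only the zeros of `p_0` in the disk obstruct such a `g`: `n₂` linear conditions, hence
`k₂ ≤ n₂`. The last row of `Q` carries the reflection of `p_0`, and the same argument gives `k₁ ≤
n₁`. A general `p` is the limit of `p(z, r w)` as `r → 1`; the factors `E` stay bounded, and the
numbers of positive and negative squares cannot jump up in the limit (`exists_factor`).

The polarized identity says that two families of vectors have the same Gram matrix, so a unitary `V`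
maps one to the other. Let `D` be the determinant of `Γ - V₄ Δ`, a polynomial of degree at most `(k₁
+ k₂, m)`. It is nonzero because the entries of `A` and `B` are linearly independent
(`det_pencil_ne_zero`), and Cramer's rule gives `p ∣ D p~` (`dvd_det_pencil_mul`). Coprimality turns
this into `p ∣ D`, and comparing degrees forces `k₁ + k₂ = n` and `D = const * p`. The exact sizes
`n₁`, `n₂` and the invertibility off the zeros of `p` thus have the same source
(`exists_realization`). -/

/-- Continuous complex functions on the unit circle, parametrized by `ℝ / ℤ`. -/
abbrev CircleFun : Type := C(UnitAddCircle, ℂ)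

/-- The coordinate function `z` of the unit circle. -/
def circleVar : CircleFun := fourier 1

/-- The restriction of a polynomial to the unit circle. -/
def onCircle : ℂ[X] →ₐ[ℂ] CircleFun := aeval circleVar

lemma norm_circleVar_apply (t : UnitAddCircle) : ‖circleVar t‖ = 1 := by
  simp [circleVar, Circle.norm_coe]

lemma onCircle_apply (q : ℂ[X]) (t : UnitAddCircle) :
    onCircle q t = q.eval (circleVar t) := by
  simp [onCircle]

/-- The `k`-th Fourier coefficient, as a linear functional. -/
def coef (k : ℤ) : CircleFun →ₗ[ℂ] ℂ where
  toFun f := fourierCoeff f k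
  map_add' f g := by
    have := fourierCoeff.add (T := 1) (f := f) (g := g)
      (f.continuous.integrable_of_hasCompactSupport (HasCompactSupport.of_compactSpace _))
      (g.continuous.integrable_of_hasCompactSupport (HasCompactSupport.of_compactSpace _))
    exact congrFun this k
  map_smul' a f := fourierCoeff.const_smul (T := 1) f a k

lemma coef_def (k : ℤ) (f : CircleFun) :
    coef k f = ∫ t, fourier (-k) t * f t ∂AddCircle.haarAddCircle := rfl

lemma norm_coef_le (k : ℤ) (f : CircleFun) : ‖coef k f‖ ≤ ‖f‖ := by
  rw [coef_def]
  refine (norm_integral_le_of_norm_le_const (C := ‖f‖)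
    (Filter.Eventually.of_forall fun t => ?_)).trans ?_
  · rw [norm_mul, fourier_apply, Circle.norm_coe, one_mul]
    exact f.norm_coe_le_norm t
  · simp

/-- If all coefficients vanish, the Fourier series is summable and converges uniformly to `f`, so
`f` is the zero sum. -/
lemma eq_zero_of_coef {f : CircleFun} (h : ∀ k, coef k f = 0) : f = 0 := by
  have h0 : fourierCoeff f = 0 := funext h
  have := hasSum_fourier_series_of_summable (f := f) (by rw [h0]; exact summable_zero)
  have hz : (fun i => fourierCoeff f i • (fourier i : CircleFun)) = fun _ => 0 := by
    ext i t
    simp [h0]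
  rw [hz] at this
  exact this.unique hasSum_zero

lemma coef_star (k : ℤ) (f : CircleFun) : coef k (star f) = conj (coef (-k) f) := by
  rw [coef_def, coef_def, ← integral_conj]
  congr 1
  ext t
  simp

lemma coef_circleVar_mul (k : ℤ) (f : CircleFun) : coef k (circleVar * f) = coef (k - 1) f := by
  rw [coef_def, coef_def]
  congr 1
  ext t
  rw [show -(k - 1) = -k + 1 by ring, fourier_add]
  simp [circleVar, mul_assoc]

lemma coef_circleVar_pow_mul (k : ℤ) (j : ℕ) (f : CircleFun) :
    coef k (circleVar ^ j * f) = coef (k - j) f := by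
  induction j generalizing k with
  | zero => simp
  | succ j ih =>
    rw [pow_succ', mul_assoc, coef_circleVar_mul, ih]
    congr 2
    push_cast
    ring

lemma star_circleVar_mul : star circleVar * circleVar = 1 := by
  ext t
  have := norm_circleVar_apply t
  simp [Complex.conj_mul', this]

lemma coef_star_circleVar_pow_mul (k : ℤ) (j : ℕ) (f : CircleFun) :
    coef k (star circleVar ^ j * f) = coef (k + j) f := by
  have h := coef_circleVar_pow_mul (k + j) j (star circleVar ^ j * f)
  rw [← mul_assoc, ← mul_pow, mul_comm circleVar, star_circleVar_mul, one_pow, one_mul] at h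
  rw [h]
  congr 2
  ring

lemma coef_one (k : ℤ) : coef k (1 : CircleFun) = if k = 0 then 1 else 0 := by
  have h := congrFun (fourierCoeff_fourier (T := 1) 0) k
  have h1 : (fourier 0 : CircleFun) = 1 := by ext t; simp
  rw [h1] at h
  change fourierCoeff (1 : CircleFun) k = _
  rw [h, Pi.single_apply]

lemma onCircle_eq_sum {N : ℕ} {q : ℂ[X]} (hq : q.natDegree < N) :
    onCircle q = ∑ j ∈ Finset.range N, q.coeff j • circleVar ^ j :=
  aeval_eq_sum_range' hq circleVar

lemma coef_onCircle_mul {N : ℕ} {q : ℂ[X]} (hq : q.natDegree < N) (k : ℤ) (f : CircleFun) :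
    coef k (onCircle q * f) = ∑ j ∈ Finset.range N, q.coeff j * coef (k - j) f := by
  rw [onCircle_eq_sum hq, Finset.sum_mul, map_sum]
  refine Finset.sum_congr rfl fun j _ => ?_
  rw [smul_mul_assoc, map_smul, coef_circleVar_pow_mul, smul_eq_mul]

lemma coef_star_onCircle_mul {N : ℕ} {q : ℂ[X]} (hq : q.natDegree < N) (k : ℤ) (f : CircleFun) :
    coef k (star (onCircle q) * f) = ∑ j ∈ Finset.range N, conj (q.coeff j) * coef (k + j) f := by
  rw [onCircle_eq_sum hq, star_sum, Finset.sum_mul, map_sum]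
  refine Finset.sum_congr rfl fun j _ => ?_
  rw [star_smul, star_pow, smul_mul_assoc, map_smul, coef_star_circleVar_pow_mul, smul_eq_mul]
  rfl

lemma coef_onCircle_natCast (q : ℂ[X]) (k : ℕ) : coef k (onCircle q) = q.coeff k := by
  have h := coef_onCircle_mul (N := max (q.natDegree + 1) (k + 1)) (q := q) (by omega) k 1
  rw [mul_one] at h
  rw [h, Finset.sum_eq_single k]
  · simp [coef_one]
  · intro j _ hj
    rw [coef_one, if_neg (by omega), mul_zero]
  · intro hk
    simp at hk

lemma coef_onCircle_neg (q : ℂ[X]) {k : ℤ} (hk : k < 0) : coef k (onCircle q) = 0 := by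
  have h := coef_onCircle_mul (Nat.lt_succ_self q.natDegree) k 1
  rw [mul_one] at h
  rw [h]
  refine Finset.sum_eq_zero fun j _ => ?_
  rw [coef_one, if_neg (by omega), mul_zero]

lemma onCircle_injective : Function.Injective onCircle := by
  intro p q h
  ext k
  rw [← coef_onCircle_natCast, h, coef_onCircle_natCast]

/-- A continuous function whose Fourier coefficients are supported in `[0, n]` is a polynomial. -/
lemma exists_onCircle_eq {f : CircleFun} {n : ℕ} (h : ∀ k : ℤ, k < 0 ∨ n < k → coef k f = 0) :
    ∃ q : ℂ[X], q.natDegree ≤ n ∧ onCircle q = f := by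
  let q : ℂ[X] := ∑ i ∈ Finset.range (n + 1), C (coef i f) * X ^ i
  have hq : ∀ k, q.coeff k = if k ≤ n then coef k f else 0 := by
    intro k
    simp only [q, finsetSum_coeff, coeff_C_mul, coeff_X_pow, mul_ite, mul_one, mul_zero,
      Finset.sum_ite_eq, Finset.mem_range, Nat.lt_succ_iff]
  refine ⟨q, ?_, ?_⟩
  · rw [natDegree_le_iff_coeff_eq_zero]
    intro N hN
    rw [hq, if_neg (by omega)]
  · rw [← sub_eq_zero]
    refine eq_zero_of_coef fun k => ?_
    rw [map_sub, sub_eq_zero]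
    rcases lt_or_ge k 0 with hk | hk
    · rw [coef_onCircle_neg q hk, h k (Or.inl hk)]
    · lift k to ℕ using hk
      rw [coef_onCircle_natCast, hq]
      split_ifs with hkn
      · rfl
      · rw [h k (Or.inr (by omega))]

lemma integrable_circleFun (f : CircleFun) : Integrable f AddCircle.haarAddCircle :=
  f.continuous.integrable_of_hasCompactSupport (HasCompactSupport.of_compactSpace _)

lemma re_coef_zero (f : CircleFun) :
    (coef 0 f).re = ∫ t, (f t).re ∂AddCircle.haarAddCircle := by
  have h : coef 0 f = ∫ t, f t ∂AddCircle.haarAddCircle := by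
    rw [coef_def]; congr 1; ext t; simp
  rw [h]
  exact (integral_re (integrable_circleFun f)).symm

lemma re_coef_zero_nonneg {f : CircleFun} (h : ∀ t, 0 ≤ (f t).re) : 0 ≤ (coef 0 f).re := by
  rw [re_coef_zero]
  exact integral_nonneg h

/-- A nonnegative function of zero mean vanishes almost everywhere; by continuity, and because Haar
measure charges every open set, it vanishes everywhere. -/
lemma eq_zero_of_re_coef_zero {f : CircleFun} (h : ∀ t, 0 ≤ (f t).re) (h0 : (coef 0 f).re = 0)
    (t : UnitAddCircle) : (f t).re = 0 := by
  have hc : Continuous fun t => (f t).re := Complex.continuous_re.comp f.continuous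
  rw [re_coef_zero, integral_eq_zero_iff_of_nonneg h (integrable_circleFun f).re] at h0
  exact congrFun ((hc.ae_eq_iff_eq _ continuous_const).1 h0) t

/-- The functions with no negative frequencies. -/
def IsAnalyticFun (f : CircleFun) : Prop := ∀ k : ℤ, k < 0 → coef k f = 0

/-- The functions with no positive frequencies. -/
def IsCoanalyticFun (f : CircleFun) : Prop := ∀ k : ℤ, 0 < k → coef k f = 0

lemma isAnalyticFun_onCircle (q : ℂ[X]) : IsAnalyticFun (onCircle q) :=
  fun _ hk => coef_onCircle_neg q hk

lemma IsAnalyticFun.sub {f g : CircleFun} (hf : IsAnalyticFun f) (hg : IsAnalyticFun g) :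
    IsAnalyticFun (f - g) := fun k hk => by rw [map_sub, hf k hk, hg k hk, sub_zero]

lemma IsAnalyticFun.smul {f : CircleFun} (hf : IsAnalyticFun f) (a : ℂ) :
    IsAnalyticFun (a • f) := fun k hk => by rw [map_smul, hf k hk, smul_zero]

lemma IsCoanalyticFun.add {f g : CircleFun} (hf : IsCoanalyticFun f) (hg : IsCoanalyticFun g) :
    IsCoanalyticFun (f + g) := fun k hk => by rw [map_add, hf k hk, hg k hk, add_zero]

lemma IsCoanalyticFun.smul {f : CircleFun} (hf : IsCoanalyticFun f) (a : ℂ) :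
    IsCoanalyticFun (a • f) := fun k hk => by rw [map_smul, hf k hk, smul_zero]

lemma isAnalyticFun_sum {ι : Type*} (s : Finset ι) {f : ι → CircleFun}
    (h : ∀ i ∈ s, IsAnalyticFun (f i)) : IsAnalyticFun (∑ i ∈ s, f i) := fun k hk => by
  rw [map_sum]
  exact Finset.sum_eq_zero fun i hi => h i hi k hk

lemma IsAnalyticFun.onCircle_mul {f : CircleFun} (hf : IsAnalyticFun f) (q : ℂ[X]) :
    IsAnalyticFun (onCircle q * f) := fun k hk => by
  rw [coef_onCircle_mul (Nat.lt_succ_self _)]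
  exact Finset.sum_eq_zero fun j _ => by rw [hf _ (by omega), mul_zero]

lemma coef_linear_mul (a : ℂ) (k : ℤ) (f : CircleFun) :
    coef k (onCircle (X - C a) * f) = coef (k - 1) f - a * coef k f := by
  have h : onCircle (X - C a) * f = circleVar * f - a • f := by
    ext t
    simp [onCircle_apply, sub_mul]
  rw [h, map_sub, coef_circleVar_mul, map_smul, smul_eq_mul]

lemma isUnit_onCircle {q : ℂ[X]} (hq : ∀ z : ℂ, ‖z‖ = 1 → q.eval z ≠ 0) :
    IsUnit (onCircle q) := by
  rw [ContinuousMap.isUnit_iff_forall_ne_zero]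
  intro t
  rw [onCircle_apply]
  exact hq _ (norm_circleVar_apply t)

/-- A bounded sequence with `u (j + 1) = a * u j`, `1 < ‖a‖`, vanishes. -/
lemma eq_zero_of_geometric {a : ℂ} (ha : 1 < ‖a‖) {u : ℕ → ℂ} {M : ℝ} (hM : ∀ j, ‖u j‖ ≤ M)
    (hu : ∀ j, u (j + 1) = a * u j) (j : ℕ) : u j = 0 := by
  by_contra h
  have hpow : ∀ i, ‖u (j + i)‖ = ‖a‖ ^ i * ‖u j‖ := by
    intro i
    induction i with
    | zero => simp
    | succ i ih => rw [← add_assoc, hu, norm_mul, ih]; ring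
  obtain ⟨i, hi⟩ := pow_unbounded_of_one_lt (M / ‖u j‖) ha
  have h1 := hM (j + i)
  rw [hpow] at h1
  rw [div_lt_iff₀ (norm_pos_iff.2 h)] at hi
  linarith

lemma coef_nonpos_eq_zero {a : ℂ} (ha : 1 < ‖a‖) {f : CircleFun} {k₀ : ℤ}
    (h : ∀ k ≤ k₀, coef (k - 1) f = a * coef k f) {k : ℤ} (hk : k ≤ k₀) : coef k f = 0 := by
  have := eq_zero_of_geometric ha (u := fun j : ℕ => coef (k₀ - j) f) (M := ‖f‖)
    (fun j => norm_coef_le _ _) (fun j => by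
      have := h (k₀ - j) (by omega)
      rw [← this]
      congr 2
      push_cast; ring) (k₀ - k).toNat
  simpa [Int.toNat_of_nonneg (sub_nonneg.2 hk)] using this

/-- Read upwards, the recursion multiplies by `a⁻¹`, of modulus greater than one, while Fourier
coefficients are bounded. The case `a = 0` needs no growth argument. -/
lemma coef_nonneg_eq_zero {a : ℂ} (ha : ‖a‖ < 1) {f : CircleFun} {k₀ : ℤ}
    (h : ∀ k > k₀, coef (k - 1) f = a * coef k f) {k : ℤ} (hk : k₀ ≤ k) : coef k f = 0 := by
  rcases eq_or_ne a 0 with rfl | ha0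
  · have := h (k + 1) (by omega)
    simpa using this
  have ha' : 1 < ‖a⁻¹‖ := by
    rw [norm_inv]
    exact (one_lt_inv₀ (norm_pos_iff.2 ha0)).2 ha
  have := eq_zero_of_geometric ha' (u := fun j : ℕ => coef (k₀ + j) f) (M := ‖f‖)
    (fun j => norm_coef_le _ _) (fun j => by
      have := h (k₀ + (j + 1 : ℕ)) (by push_cast; omega)
      rw [eq_inv_mul_iff_mul_eq₀ ha0, ← this]
      congr 2
      push_cast; ring) (k - k₀).toNat
  simpa [Int.toNat_of_nonneg (sub_nonneg.2 hk)] using this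

lemma IsAnalyticFun.of_linear_mul {a : ℂ} (ha : 1 < ‖a‖) {f : CircleFun}
    (h : IsAnalyticFun (onCircle (X - C a) * f)) : IsAnalyticFun f := by
  intro k hk
  refine coef_nonpos_eq_zero ha (k₀ := -1) (fun k hk => ?_) (by omega)
  have := h k (by omega)
  rwa [coef_linear_mul, sub_eq_zero] at this

/-- Division by a polynomial without zeros in the closed disk preserves analyticity. -/
lemma IsAnalyticFun.of_onCircle_mul {q : ℂ[X]} (hq : ∀ z : ℂ, ‖z‖ ≤ 1 → q.eval z ≠ 0)
    {f : CircleFun} (h : IsAnalyticFun (onCircle q * f)) : IsAnalyticFun f := by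
  induction hd : q.natDegree generalizing q with
  | zero =>
    rw [natDegree_eq_zero] at hd
    obtain ⟨c, rfl⟩ := hd
    have hc : c ≠ 0 := by simpa using hq 0 (by simp)
    have h' := h.smul c⁻¹
    convert h' using 1
    ext t
    simp [onCircle_apply, hc]
  | succ d ih =>
    have hdeg : q.degree ≠ 0 := fun h0 => by
      have := natDegree_eq_zero_iff_degree_le_zero.2 h0.le
      omega
    obtain ⟨a, ha⟩ := IsAlgClosed.exists_root q hdeg
    obtain ⟨r, rfl⟩ := dvd_iff_isRoot.2 ha
    have ha1 : 1 < ‖a‖ := by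
      by_contra hle
      exact hq a (not_lt.1 hle) ha
    have hr0 : r ≠ 0 := by rintro rfl; simp at hd
    refine ih (q := r) (fun z hz h0 => hq z hz (by simp [h0])) ?_ ?_
    · refine IsAnalyticFun.of_linear_mul ha1 ?_
      rwa [map_mul, mul_assoc] at h
    · rw [natDegree_mul (X_sub_C_ne_zero a) hr0, natDegree_X_sub_C] at hd
      omega

/-- The functions that are the sum of an analytic and a coanalytic continuous function. -/
def Splits (f : CircleFun) : Prop :=
  ∃ u v : CircleFun, IsCoanalyticFun u ∧ IsAnalyticFun v ∧ f = u + v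

/-- The analytic part of a continuous function need not be continuous, so splitting has to be
proved. With `ι = 1 / (z - a)`, the products `ι u` and `ι v` are again coanalytic and analytic,
except that the one on the wrong side of `ι` picks up a multiple of `ι`; moving that multiple to the
other summand repairs this. -/
lemma Splits.of_linear_mul {a : ℂ} (ha : ‖a‖ ≠ 1) {f : CircleFun}
    (h : Splits (onCircle (X - C a) * f)) : Splits f := by
  have hunit : IsUnit (onCircle (X - C a)) := isUnit_onCircle fun z hz h0 => by
    rw [eval_sub, eval_X, eval_C, sub_eq_zero] at h0
    exact ha (h0 ▸ hz)
  obtain ⟨e, he⟩ := hunit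
  obtain ⟨u, v, hu, hv, huv⟩ := h
  have hinv : ∀ g, onCircle (X - C a) * (↑e⁻¹ * g) = g := fun g => by
    rw [← he, ← mul_assoc, Units.mul_inv, one_mul]
  have hf : f = ↑e⁻¹ * u + ↑e⁻¹ * v := by
    rw [← mul_add, ← huv, ← he, ← mul_assoc, Units.inv_mul, one_mul]
  set ι : CircleFun := ↑e⁻¹ with hι
  have hrec : ∀ g k, coef (k - 1) (ι * g) - a * coef k (ι * g) = coef k g := fun g k => by
    rw [← coef_linear_mul, hinv]
  have hrec1 : ∀ k, coef (k - 1) ι - a * coef k ι = if k = 0 then 1 else 0 := fun k => by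
    rw [← coef_one, ← hrec 1 k, mul_one]
  rcases lt_or_gt_of_ne ha with ha1 | ha1
  · have hιc : ∀ k : ℤ, 0 ≤ k → coef k ι = 0 := fun k hk =>
      coef_nonneg_eq_zero ha1 (k₀ := 0) (fun k hk => by
        have := hrec1 k
        rwa [if_neg (by omega), sub_eq_zero] at this) hk
    have hι1 : coef (-1) ι = 1 := by
      have := hrec1 0
      rwa [if_pos rfl, hιc 0 le_rfl, mul_zero, sub_zero, zero_sub] at this
    -- Since `ι` has coefficient `1` at `-1`, this choice of `γ` kills the coefficient of `ι v - γ
    -- ι` at `-1`; the recursion then kills all lower ones.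
    set γ := coef (-1) (ι * v)
    have hstep : ∀ k : ℤ, k < 0 → coef (k - 1) (ι * v - γ • ι) = a * coef k (ι * v - γ • ι) := by
      intro k hk
      have h1 := hrec v k
      rw [hv k hk] at h1
      have h2 := hrec1 k
      rw [if_neg (by omega)] at h2
      simp only [map_sub, map_smul, smul_eq_mul]
      linear_combination h1 - γ * h2
    refine ⟨ι * u + γ • ι, ι * v - γ • ι, ?_, ?_, ?_⟩
    · refine IsCoanalyticFun.add ?_ (IsCoanalyticFun.smul (fun k hk => hιc k hk.le) _)
      intro k hk
      refine coef_nonneg_eq_zero ha1 (k₀ := 0) (fun k hk => ?_) hk.le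
      have := hrec u k
      rwa [hu k hk, sub_eq_zero] at this
    · have hneg : ∀ j : ℕ, coef (-1 - j) (ι * v - γ • ι) = 0 := by
        intro j
        induction j with
        | zero => simp [γ, hι1]
        | succ j ih =>
          have := hstep (-1 - j) (by omega)
          rw [ih, mul_zero] at this
          rw [← this]
          congr 2
          push_cast; ring
      intro k hk
      have := hneg (-1 - k).toNat
      rwa [Int.toNat_of_nonneg (by omega), sub_sub_cancel] at this
    · rw [hf]; ring
  · have hιa : ∀ k : ℤ, k ≤ -1 → coef k ι = 0 := fun k hk =>
      coef_nonpos_eq_zero ha1 (k₀ := -1) (fun k hk => by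
        have := hrec1 k
        rwa [if_neg (by omega), sub_eq_zero] at this) hk
    have ha0 : a ≠ 0 := by rintro rfl; simp at ha1; linarith
    have hι0 : a * coef 0 ι = -1 := by
      have := hrec1 0
      rw [if_pos rfl, hιa _ (by norm_num)] at this
      linear_combination -this
    -- As `a * coef 0 ι = -1`, adding `γ a ι` kills the constant coefficient of `ι u`, and the
    -- recursion kills the positive ones.
    set γ := coef 0 (ι * u)
    have hstep : ∀ k : ℤ, 0 < k →
        coef (k - 1) (ι * u + (γ * a) • ι) = a * coef k (ι * u + (γ * a) • ι) := by
      intro k hk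
      have h1 := hrec u k
      rw [hu k hk] at h1
      have h2 := hrec1 k
      rw [if_neg (by omega)] at h2
      simp only [map_add, map_smul, smul_eq_mul]
      linear_combination h1 + γ * a * h2
    refine ⟨ι * u + (γ * a) • ι, ι * v - (γ * a) • ι, ?_, ?_, ?_⟩
    · have hpos : ∀ j : ℕ, coef j (ι * u + (γ * a) • ι) = 0 := by
        intro j
        induction j with
        | zero =>
          simp only [map_add, map_smul, smul_eq_mul, Nat.cast_zero]
          linear_combination γ * hι0
        | succ j ih =>
          have := hstep (j + 1 : ℕ) (by omega)
          rw [show ((j + 1 : ℕ) : ℤ) - 1 = j by push_cast; ring, ih] at this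
          exact (mul_eq_zero.1 this.symm).resolve_left ha0
      intro k hk
      have := hpos k.toNat
      rwa [Int.toNat_of_nonneg hk.le] at this
    · refine IsAnalyticFun.sub ?_ (IsAnalyticFun.smul (fun k hk => hιa k (by omega)) _)
      intro k hk
      refine coef_nonpos_eq_zero ha1 (k₀ := -1) (fun k hk => ?_) (by omega)
      have := hrec v k
      rwa [hv k (by omega), sub_eq_zero] at this
    · rw [hf]; ring

lemma Splits.of_onCircle_mul {q : ℂ[X]} (hq : ∀ z : ℂ, ‖z‖ = 1 → q.eval z ≠ 0)
    {f : CircleFun} (h : Splits (onCircle q * f)) : Splits f := by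
  induction hd : q.natDegree generalizing q with
  | zero =>
    rw [natDegree_eq_zero] at hd
    obtain ⟨c, rfl⟩ := hd
    have hc : c ≠ 0 := by simpa using hq 1 (by simp)
    obtain ⟨u, v, hu, hv, huv⟩ := h
    refine ⟨c⁻¹ • u, c⁻¹ • v, hu.smul _, hv.smul _, ?_⟩
    ext t
    have := DFunLike.congr_fun huv t
    simp only [ContinuousMap.mul_apply, onCircle_apply, eval_C, ContinuousMap.add_apply] at this
    simp [← mul_add, ← this, hc]
  | succ d ih =>
    have hdeg : q.degree ≠ 0 := fun h0 => by
      have := natDegree_eq_zero_iff_degree_le_zero.2 h0.le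
      omega
    obtain ⟨a, ha⟩ := IsAlgClosed.exists_root q hdeg
    obtain ⟨r, rfl⟩ := dvd_iff_isRoot.2 ha
    have ha1 : ‖a‖ ≠ 1 := fun h1 => hq a h1 ha
    have hr0 : r ≠ 0 := by rintro rfl; simp at hd
    refine ih (q := r) (fun z hz h0 => hq z hz (by simp [h0])) ?_ ?_
    · refine Splits.of_linear_mul ha1 ?_
      rwa [map_mul, mul_assoc] at h
    · rw [natDegree_mul (X_sub_C_ne_zero a) hr0, natDegree_X_sub_C] at hd
      omega

end BiPoly

end

/-! ### The Schur-Cohn matrix and its positivity -/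

noncomputable section

namespace BiPoly

open Polynomial
open scoped ComplexOrder

section DiagSum

variable {M : Type*} [AddCommGroup M]

/-- The coefficients of the quotient of the kernel `∑ D a b x ^ a y ^ b` by `1 - x y`. -/
def diagSum (D : ℕ → ℕ → M) (a b : ℕ) : M :=
  ∑ k ∈ Finset.range (min a b + 1), D (a - k) (b - k)

lemma diagSum_zero_left (D : ℕ → ℕ → M) (b : ℕ) : diagSum D 0 b = D 0 b := by
  simp [diagSum]

lemma diagSum_zero_right (D : ℕ → ℕ → M) (a : ℕ) : diagSum D a 0 = D a 0 := by
  simp [diagSum]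

lemma diagSum_succ (D : ℕ → ℕ → M) (a b : ℕ) :
    diagSum D (a + 1) (b + 1) = diagSum D a b + D (a + 1) (b + 1) := by
  rw [diagSum, show min (a + 1) (b + 1) + 1 = (min a b + 1) + 1 by omega, Finset.sum_range_succ']
  simp [diagSum]

lemma diagSum_unique {D S : ℕ → ℕ → M} (h0 : ∀ b, S 0 b = D 0 b) (h0' : ∀ a, S a 0 = D a 0)
    (h : ∀ a b, S (a + 1) (b + 1) = S a b + D (a + 1) (b + 1)) (a b : ℕ) :
    diagSum D a b = S a b := by
  induction a generalizing b with
  | zero => rw [diagSum_zero_left, h0]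
  | succ a ih =>
    cases b with
    | zero => rw [diagSum_zero_right, h0']
    | succ b => rw [diagSum_succ, ih, h]

lemma diagSum_add_left (D : ℕ → ℕ → M) (e b : ℕ) :
    diagSum D (b + e) b = ∑ i ∈ Finset.range (b + 1), D (i + e) i := by
  rw [diagSum, min_eq_right (by omega), ← Finset.sum_range_reflect]
  refine Finset.sum_congr rfl fun i hi => ?_
  rw [Finset.mem_range] at hi
  congr 1 <;> omega

lemma diagSum_add_right (D : ℕ → ℕ → M) (e a : ℕ) :
    diagSum D a (a + e) = ∑ i ∈ Finset.range (a + 1), D i (i + e) := by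
  rw [diagSum, min_eq_left (by omega), ← Finset.sum_range_reflect]
  refine Finset.sum_congr rfl fun i hi => ?_
  rw [Finset.mem_range] at hi
  congr 1 <;> omega

/-- The quotient has no coefficients beyond those of the kernel, as soon as the kernel vanishes
for `x y = 1`. -/
lemma diagSum_eq_zero {D : ℕ → ℕ → M} {N : ℕ} (hD : ∀ a b, N < a ∨ N < b → D a b = 0)
    (hl : ∀ e, ∑ i ∈ Finset.range (N + 1), D (i + e) i = 0)
    (hr : ∀ e, ∑ i ∈ Finset.range (N + 1), D i (i + e) = 0) {a b : ℕ} (hab : N ≤ a ∨ N ≤ b) :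
    diagSum D a b = 0 := by
  rcases le_total b a with h | h
  · obtain ⟨e, rfl⟩ := Nat.exists_eq_add_of_le h
    rw [diagSum_add_left]
    rcases le_total b N with hbN | hbN
    · rw [← hl e]
      refine Finset.sum_subset (Finset.range_mono (by omega)) fun i _ hi => ?_
      rw [Finset.mem_range] at hi
      exact hD _ _ (by omega)
    · rw [← hl e]
      refine (Finset.sum_subset (Finset.range_mono (by omega)) fun i _ hi => ?_).symm
      rw [Finset.mem_range] at hi
      exact hD _ _ (by omega)
  · obtain ⟨e, rfl⟩ := Nat.exists_eq_add_of_le h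
    rw [diagSum_add_right]
    rcases le_total a N with hbN | hbN
    · rw [← hr e]
      refine Finset.sum_subset (Finset.range_mono (by omega)) fun i _ hi => ?_
      rw [Finset.mem_range] at hi
      exact hD _ _ (by omega)
    · rw [← hr e]
      refine (Finset.sum_subset (Finset.range_mono (by omega)) fun i _ hi => ?_).symm
      rw [Finset.mem_range] at hi
      exact hD _ _ (by omega)

end DiagSum

section SchurKernel

variable {R : Type*} [CommRing R] [StarRing R]

/-- The reversed conjugated sequence of coefficients. -/
def revStar (m : ℕ) (p : ℕ → R) (b : ℕ) : R := if b ≤ m then star (p (m - b)) else 0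

/-- The coefficients of `p(x) p(y)^* - q(x) q(y)^*`, where `q` is the reflection of `p`. -/
def schurKernel (m : ℕ) (p : ℕ → R) (b c : ℕ) : R :=
  p b * star (p c) - revStar m p b * star (revStar m p c)

lemma star_schurKernel (m : ℕ) (p : ℕ → R) (b c : ℕ) :
    star (schurKernel m p b c) = schurKernel m p c b := by
  simp [schurKernel, mul_comm]

/-- A polynomial and its reflection have the same modulus on the circle. In coefficients, the
substitution `i ↦ m - e - i` exchanges the two sums. -/
lemma sum_schurKernel_eq_zero {m : ℕ} {p : ℕ → R} (hp : ∀ b, m < b → p b = 0) (e : ℕ) :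
    ∑ i ∈ Finset.range (m + 1), schurKernel m p i (i + e) = 0 := by
  simp only [schurKernel, Finset.sum_sub_distrib, sub_eq_zero]
  rcases le_or_gt e m with he | he
  · have h1 : ∀ f : ℕ → R, (∀ i, m < i + e → f i = 0) →
        ∑ i ∈ Finset.range (m + 1), f i = ∑ i ∈ Finset.range (m - e + 1), f i := by
      intro f hf
      refine (Finset.sum_subset (Finset.range_mono (by omega)) fun i _ hi => ?_).symm
      rw [Finset.mem_range] at hi
      exact hf i (by omega)
    rw [h1 _ fun i hi => by rw [hp _ hi, star_zero, mul_zero],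
      h1 _ fun i hi => by rw [revStar, revStar, if_neg (not_le.2 hi), star_zero, mul_zero],
      ← Finset.sum_range_reflect]
    refine Finset.sum_congr rfl fun i hi => ?_
    rw [Finset.mem_range] at hi
    rw [revStar, revStar, if_pos (by omega), if_pos (by omega), star_star, mul_comm,
      show m - e + 1 - 1 - i + e = m - i by omega, show m - e + 1 - 1 - i = m - (i + e) by omega]
  · rw [Finset.sum_eq_zero, Finset.sum_eq_zero]
    · intro i _
      simp only [revStar]
      rw [if_neg (by omega : ¬ i + e ≤ m), star_zero, mul_zero]
    · intro i _
      rw [hp (i + e) (by omega), star_zero, mul_zero]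

lemma diagSum_schurKernel_eq_zero {m : ℕ} {p : ℕ → R} (hp : ∀ b, m < b → p b = 0) {b c : ℕ}
    (h : m ≤ b ∨ m ≤ c) : diagSum (schurKernel m p) b c = 0 := by
  refine diagSum_eq_zero (fun b c h => ?_) (fun e => ?_) (sum_schurKernel_eq_zero hp) h
  · rcases h with h | h
    · rw [schurKernel, hp _ h, revStar, if_neg (not_le.2 h), zero_mul, zero_mul, sub_zero]
    · rw [schurKernel, hp _ h, revStar, revStar, if_neg (not_le.2 h), star_zero, mul_zero, mul_zero,
        sub_zero]
  · rw [← star_zero R, ← sum_schurKernel_eq_zero hp e, star_sum]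
    simp only [star_schurKernel]

end SchurKernel

/-- The reflection `z ^ N * conj (q (1 / conj z))` of a polynomial of degree at most `N`. -/
def conjReflect (N : ℕ) (q : ℂ[X]) : ℂ[X] := (q.reflect N).map (starRingEnd ℂ)

lemma coeff_conjReflect {N : ℕ} {q : ℂ[X]} (hq : q.natDegree ≤ N) (b : ℕ) :
    (conjReflect N q).coeff b = if b ≤ N then conj (q.coeff (N - b)) else 0 := by
  rw [conjReflect, coeff_map, coeff_reflect]
  split_ifs with h
  · rw [revAt_le h]
  · rw [revAt_eq_self_of_lt (not_le.1 h), coeff_eq_zero_of_natDegree_lt (by omega), map_zero]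

lemma natDegree_conjReflect_le {N : ℕ} {q : ℂ[X]} (hq : q.natDegree ≤ N) :
    (conjReflect N q).natDegree ≤ N := by
  rw [natDegree_le_iff_coeff_eq_zero]
  intro b hb
  rw [coeff_conjReflect hq, if_neg (by omega)]

lemma conjReflect_mul {M N : ℕ} {p q : ℂ[X]} (hp : p.natDegree ≤ M) (hq : q.natDegree ≤ N) :
    conjReflect (M + N) (p * q) = conjReflect M p * conjReflect N q := by
  rw [conjReflect, reflect_mul _ _ hp hq, Polynomial.map_mul]
  rfl

lemma conjReflect_linear (β : ℂ) : conjReflect 1 (1 - C β * X) = X - C (conj β) := by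
  have h1 : (Polynomial.reflect 1 (1 : ℂ[X])) = X := by
    simp
  have h2 : (Polynomial.reflect 1 (X : ℂ[X])) = 1 := by
    simp
  rw [conjReflect, reflect_sub, reflect_C_mul, h1, h2]
  simp

/-- The conjugate polynomial in a second variable. -/
def conjVar : ℂ[X] →+* ℂ[X][X] := (mapRingHom C).comp (mapRingHom (starRingEnd ℂ))

lemma coeff_conjVar (u : ℂ[X]) (b : ℕ) : (conjVar u).coeff b = C (conj (u.coeff b)) := by
  simp [conjVar]

lemma conjVar_X : conjVar X = X := by simp [conjVar]

lemma conjVar_C (a : ℂ) : conjVar (C a) = C (C (conj a)) := by simp [conjVar]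

/-- A polynomial without zeros in the closed disk is constant or has a factor `1 - β z` with
`‖β‖ < 1`; in either case a factor of this form splits off at the price of one degree. -/
lemma exists_linear_factor {q : ℂ[X]} {m : ℕ} (hdeg : q.natDegree ≤ m + 1)
    (hq : ∀ z : ℂ, ‖z‖ ≤ 1 → q.eval z ≠ 0) :
    ∃ (β : ℂ) (r : ℂ[X]), ‖β‖ < 1 ∧ r.natDegree ≤ m ∧ q = (1 - C β * X) * r ∧
      ∀ z : ℂ, ‖z‖ ≤ 1 → r.eval z ≠ 0 := by
  by_cases h0 : q.natDegree = 0
  · exact ⟨0, q, by simp, by omega, by simp, hq⟩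
  have hd : q.degree ≠ 0 := fun h => h0 (natDegree_eq_zero_iff_degree_le_zero.2 h.le)
  obtain ⟨a, ha⟩ := IsAlgClosed.exists_root q hd
  obtain ⟨r, rfl⟩ := dvd_iff_isRoot.2 ha
  have ha1 : 1 < ‖a‖ := by
    by_contra hle
    exact hq a (not_lt.1 hle) ha
  have ha0 : a ≠ 0 := by rintro rfl; simp at ha1; linarith
  have hr0 : r ≠ 0 := by rintro rfl; simp at h0
  rw [natDegree_mul (X_sub_C_ne_zero a) hr0, natDegree_X_sub_C] at hdeg
  refine ⟨a⁻¹, C (-a) * r, ?_, ?_, ?_, ?_⟩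
  · rw [norm_inv]
    exact inv_lt_one_of_one_lt₀ ha1
  · exact (natDegree_C_mul_le _ _).trans (by omega)
  · have : C a⁻¹ * C a = (1 : ℂ[X]) := by rw [← C_mul, inv_mul_cancel₀ ha0, C_1]
    rw [C_neg]
    linear_combination (-X * r) * this
  · intro z hz h
    refine hq z hz ?_
    rw [eval_mul, eval_C] at h
    rw [eval_mul, (mul_eq_zero.1 h).resolve_left (neg_ne_zero.2 ha0), mul_zero]

/-- The Christoffel-Darboux type sum of squares for a polynomial without zeros in the closed
disk. -/
lemma exists_sum_squares {m : ℕ} {q : ℂ[X]} (hdeg : q.natDegree ≤ m)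
    (hq : ∀ z : ℂ, ‖z‖ ≤ 1 → q.eval z ≠ 0) :
    ∃ v : Fin m → ℂ[X],
      (1 - C X * X) * ∑ i, C (v i) * conjVar (v i) =
        C q * conjVar q - C (conjReflect m q) * conjVar (conjReflect m q) ∧
      ∀ b < m, (X : ℂ[X]) ^ b ∈ Submodule.span ℂ (Set.range v) := by
  induction m generalizing q with
  | zero =>
    obtain ⟨c, rfl⟩ := natDegree_eq_zero.1 (Nat.le_zero.1 hdeg)
    refine ⟨Fin.elim0, ?_, by simp⟩
    have h : conjReflect 0 (C c) = C (conj c) := by simp [conjReflect]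
    rw [h, conjVar_C, conjVar_C, Complex.conj_conj, mul_comm (C (C c)), sub_self,
      Finset.univ_eq_empty, Finset.sum_empty, mul_zero]
  | succ m ih =>
    obtain ⟨β, r, hβ, hr, rfl, hrz⟩ := exists_linear_factor hdeg hq
    obtain ⟨v, hv, hspan⟩ := ih hr hrz
    set s : ℝ := Real.sqrt (1 - ‖β‖ ^ 2)
    have hpos : 0 < 1 - ‖β‖ ^ 2 := by nlinarith [norm_nonneg β]
    have hs : (s : ℂ) * s = 1 - β * conj β := by
      rw [Complex.mul_conj', ← Complex.ofReal_mul, Real.mul_self_sqrt hpos.le]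
      push_cast
      rfl
    have hs0 : (s : ℂ) ≠ 0 := by
      rw [Complex.ofReal_ne_zero]
      exact (Real.sqrt_pos.2 hpos).ne'
    have hrefl : conjReflect (m + 1) ((1 - C β * X) * r) =
        (X - C (conj β)) * conjReflect m r := by
      rw [add_comm m 1, conjReflect_mul _ hr, conjReflect_linear]
      refine (natDegree_sub_le _ _).trans (max_le (by simp) ?_)
      exact (natDegree_C_mul_le _ _).trans natDegree_X_le
    -- The reflection of `(1 - β X) r` is `(X - β^*) r~`, and `(1 - β x)(1 - β^* y) - (x - β^*)(y -
    -- β) = (1 - |β|²)(1 - x y)`. So the squares for `r` are multiplied by `1 - β X`, and one new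
    -- square `s r~` with `s² = 1 - |β|²` appears.
    refine ⟨Fin.cons (C (s : ℂ) * conjReflect m r) fun i => (1 - C β * X) * v i, ?_, ?_⟩
    · rw [Fin.sum_univ_succ, hrefl]
      simp only [Fin.cons_zero, Fin.cons_succ, map_mul, map_sub, map_one, conjVar_X, conjVar_C,
        Complex.conj_conj, Complex.conj_ofReal]
      have hsum : ∑ i, (1 - C (C β) * C X) * C (v i) * ((1 - C (C (conj β)) * X) * conjVar (v i)) =
          (1 - C (C β) * C X) * (1 - C (C (conj β)) * X) * ∑ i, C (v i) * conjVar (v i) := by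
        rw [Finset.mul_sum]
        exact Finset.sum_congr rfl fun i _ => by ring
      have hs' : (C (C (s : ℂ)) * C (C (s : ℂ)) : ℂ[X][X]) = 1 - C (C β) * C (C (conj β)) := by
        rw [← C_mul, ← C_mul, hs]
        simp
      rw [hsum]
      linear_combination (1 - C (C β) * C X) * (1 - C (C (conj β)) * X) * hv +
        (1 - C X * X) * C (conjReflect m r) * conjVar (conjReflect m r) * hs'
    · set W := Submodule.span ℂ (Set.range
        (Fin.cons (C (s : ℂ) * conjReflect m r) fun i => (1 - C β * X) * v i :
          Fin (m + 1) → ℂ[X])) with hW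
      have hmul : ∀ b < m, (1 - C β * X) * X ^ b ∈ W := by
        intro b hb
        have h1 := Submodule.mem_map_of_mem (f := LinearMap.mulLeft ℂ (1 - C β * X)) (hspan b hb)
        rw [Submodule.map_span, LinearMap.mulLeft_apply] at h1
        refine Submodule.span_mono ?_ h1
        rintro _ ⟨_, ⟨i, rfl⟩, rfl⟩
        exact ⟨i.succ, by simp⟩
      -- Modulo `W` one has `X ^ b = β X ^ (b + 1)` for `b < m`, so every lower power is a multiple
      -- of `X ^ m`.
      have hback : ∀ k ≤ m, (X : ℂ[X]) ^ (m - k) - β ^ k • X ^ m ∈ W := by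
        intro k
        induction k with
        | zero => intro _; simp
        | succ k ihk =>
          intro hk
          have h1 := W.add_mem (hmul (m - (k + 1)) (by omega)) (W.smul_mem β (ihk (by omega)))
          convert h1 using 1
          rw [show m - k = m - (k + 1) + 1 by omega]
          simp only [smul_eq_C_mul, C_pow]
          ring
      have hrW : conjReflect m r ∈ W := by
        have h1 : C (s : ℂ) * conjReflect m r ∈ W := Submodule.subset_span ⟨0, by simp⟩
        have h2 := W.smul_mem (s : ℂ)⁻¹ h1
        rwa [smul_eq_C_mul, ← mul_assoc, ← C_mul, inv_mul_cancel₀ hs0, C_1, one_mul] at h2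
      -- Modulo `W` the element `r~ ∈ W` becomes `conj (r (conj β)) X ^ m`, and this scalar is
      -- nonzero because `β` lies in the disk.
      have hXm : (X : ℂ[X]) ^ m ∈ W := by
        have h1 : conjReflect m r -
            ∑ k ∈ Finset.range (m + 1), conj (r.coeff k) • ((X : ℂ[X]) ^ (m - k) - β ^ k • X ^ m)
            = conj (r.eval (conj β)) • X ^ m := by
          have h2 : conjReflect m r =
              ∑ k ∈ Finset.range (m + 1), conj (r.coeff k) • (X : ℂ[X]) ^ (m - k) := by
            rw [as_sum_range_C_mul_X_pow' (conjReflect m r)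
              (Nat.lt_succ_of_le (natDegree_conjReflect_le hr)), ← Finset.sum_range_reflect]
            refine Finset.sum_congr rfl fun k hk => ?_
            rw [Finset.mem_range] at hk
            rw [coeff_conjReflect hr, if_pos (by omega), smul_eq_C_mul,
              show m + 1 - 1 - k = m - k by omega, show m - (m - k) = k by omega]
          rw [h2, ← Finset.sum_sub_distrib, eval_eq_sum_range' (Nat.lt_succ_of_le hr), map_sum,
            Finset.sum_smul]
          refine Finset.sum_congr rfl fun k _ => ?_
          rw [smul_sub, sub_sub_cancel, smul_smul]
          simp
        have h3 : conj (r.eval (conj β)) • (X : ℂ[X]) ^ m ∈ W := by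
          rw [← h1]
          refine W.sub_mem hrW (W.sum_mem fun k hk => W.smul_mem _ (hback k ?_))
          rw [Finset.mem_range] at hk
          omega
        have hne : conj (r.eval (conj β)) ≠ 0 := by
          rw [Ne, map_eq_zero]
          exact hrz _ (by simpa using hβ.le)
        have h4 := W.smul_mem (conj (r.eval (conj β)))⁻¹ h3
        rwa [smul_smul, inv_mul_cancel₀ hne, one_smul] at h4
      intro b hb
      have h1 := W.add_mem (hback (m - b) (by omega)) (W.smul_mem (β ^ (m - b)) hXm)
      rwa [sub_add_cancel, show m - (m - b) = b by omega] at h1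

/-- The Schur-Cohn matrix of a polynomial without zeros in the closed disk is positive
definite. -/
lemma posDef_schurKernel {m : ℕ} {q : ℂ[X]} (hdeg : q.natDegree ≤ m)
    (hq : ∀ z : ℂ, ‖z‖ ≤ 1 → q.eval z ≠ 0) :
    (Matrix.of fun i j : Fin m => diagSum (schurKernel m q.coeff) i j).PosDef := by
  obtain ⟨v, hv, hspan⟩ := exists_sum_squares hdeg hq
  have hT : ∀ a b, diagSum (schurKernel m q.coeff) a b =
      ∑ i, (v i).coeff a * conj ((v i).coeff b) := by
    have hrev : ∀ b, revStar m q.coeff b = (conjReflect m q).coeff b := by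
      intro b
      rw [coeff_conjReflect hdeg]
      rfl
    have hS : ∀ a b, ((∑ i, C (v i) * conjVar (v i) : ℂ[X][X]).coeff b).coeff a =
        ∑ i, (v i).coeff a * conj ((v i).coeff b) := by
      intro a b
      simp only [finsetSum_coeff, coeff_C_mul, coeff_conjVar, coeff_mul_C]
    have hK : ∀ a b, ((C q * conjVar q - C (conjReflect m q) * conjVar (conjReflect m q) :
        ℂ[X][X]).coeff b).coeff a = schurKernel m q.coeff a b := by
      intro a b
      simp only [coeff_sub, coeff_C_mul, coeff_conjVar, coeff_mul_C, schurKernel, hrev]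
      rfl
    refine diagSum_unique (fun b => ?_) (fun a => ?_) (fun a b => ?_)
    · rw [← hS, ← hK, ← hv, sub_mul, one_mul, coeff_sub, coeff_sub, mul_assoc, coeff_C_mul]
      simp
    · rw [← hS, ← hK, ← hv, sub_mul, one_mul, coeff_sub, coeff_sub, mul_assoc, coeff_C_mul]
      simp
    · rw [← hS, ← hS, ← hK, ← hv, sub_mul, one_mul, coeff_sub, coeff_sub, mul_assoc, coeff_C_mul,
        coeff_X_mul, coeff_X_mul]
      ring
  have hV : (Matrix.of fun i j : Fin m => diagSum (schurKernel m q.coeff) i j) =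
      (Matrix.of fun (b : Fin m) i => (v i).coeff b) *
        (Matrix.of fun (b : Fin m) i => (v i).coeff b).conjTranspose := by
    ext a b
    simp [hT, Matrix.mul_apply]
  rw [hV]
  refine Matrix.PosDef.mul_conjTranspose_self _ ?_
  rw [← Matrix.coe_vecMulLinear, ← LinearMap.ker_eq_bot, LinearMap.ker_eq_bot']
  intro u hu
  -- A vector in the left kernel of the coefficient matrix is a functional killing all `v i`, hence
  -- all `X ^ b` with `b < m`.
  let ev : ℂ[X] →ₗ[ℂ] ℂ := ∑ b : Fin m, u b • lcoeff ℂ b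
  have hker : Submodule.span ℂ (Set.range v) ≤ LinearMap.ker ev := by
    rw [Submodule.span_le]
    rintro _ ⟨i, rfl⟩
    simpa [ev, Matrix.vecMul, dotProduct] using congrFun hu i
  ext b
  have := hker (hspan b b.2)
  simpa [ev, coeff_X_pow, Fin.val_inj, eq_comm] using this

end BiPoly

end

/-! ### The matrix Fejér-Riesz theorem with an outer factor -/

noncomputable section

namespace BiPoly

open Polynomial Matrix
open scoped ComplexOrder MatrixOrder

/-- Evaluation of functions on the circle. -/
abbrev evalCircle (t : UnitAddCircle) : CircleFun →⋆ₐ[ℂ] ℂ := ContinuousMap.evalStarAlgHom ℂ ℂ t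

lemma evalCircle_apply (t : UnitAddCircle) (f : CircleFun) : evalCircle t f = f t := rfl

lemma exists_circleVar_eq {z : ℂ} (hz : ‖z‖ = 1) : ∃ t, circleVar t = z := by
  obtain ⟨t, ht⟩ := (AddCircle.homeomorphCircle (T := 1) one_ne_zero).surjective
    ⟨z, mem_sphere_zero_iff_norm.2 hz⟩
  refine ⟨t, ?_⟩
  rw [AddCircle.homeomorphCircle_apply] at ht
  rw [circleVar, fourier_one, ht]

variable {ι κ : Type*}

lemma map_evalCircle_injective {A B : Matrix ι κ CircleFun}
    (h : ∀ t, A.map (evalCircle t) = B.map (evalCircle t)) : A = B := by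
  ext i j t
  exact congrFun (congrFun (h t) i) j

lemma map_evalCircle_mul [Fintype ι] (t : UnitAddCircle) (A : Matrix ι ι CircleFun)
    (B : Matrix ι κ CircleFun) :
    (A * B).map (evalCircle t) = A.map (evalCircle t) * B.map (evalCircle t) :=
  Matrix.map_mul

lemma map_evalCircle_conjTranspose (t : UnitAddCircle) (A : Matrix ι κ CircleFun) :
    Aᴴ.map (evalCircle t) = (A.map (evalCircle t))ᴴ := by
  ext i j
  simp [map_star]

lemma evalCircle_dotProduct_mulVec [Fintype ι] (t : UnitAddCircle) (A : Matrix ι ι CircleFun)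
    (φ : ι → CircleFun) :
    (star φ ⬝ᵥ A *ᵥ φ) t = star (fun i => φ i t) ⬝ᵥ A.map (evalCircle t) *ᵥ fun i => φ i t := by
  change evalCircle t _ = _
  simp [dotProduct, mulVec, map_sum, map_mul, map_star]

/-- The entries of `T` are trigonometric polynomials of degree at most `n`. -/
def IsTrigMatrix (n : ℕ) (T : Matrix ι ι CircleFun) : Prop :=
  ∀ i j (k : ℤ), (n : ℤ) < |k| → coef k (T i j) = 0

lemma IsTrigMatrix.exists_poly {n : ℕ} {T : Matrix ι ι CircleFun} (h : IsTrigMatrix n T) :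
    ∃ τ : Matrix ι ι ℂ[X], (∀ i j, (τ i j).natDegree ≤ 2 * n) ∧
      ∀ i j, onCircle (τ i j) = circleVar ^ n * T i j := by
  have h1 : ∀ i j, ∃ q : ℂ[X], q.natDegree ≤ 2 * n ∧ onCircle q = circleVar ^ n * T i j := by
    intro i j
    refine exists_onCircle_eq fun k hk => ?_
    rw [coef_circleVar_pow_mul]
    refine h i j _ ?_
    rcases hk with hk | hk
    · rw [abs_of_neg (by omega)]; omega
    · rw [abs_of_pos (by omega)]; push_cast at hk; omega
  choose τ h2 h3 using h1
  exact ⟨τ, h2, h3⟩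

lemma conjTranspose_of_posDef {T : Matrix ι ι CircleFun}
    (hT : ∀ t, (T.map (evalCircle t)).PosDef) : Tᴴ = T :=
  map_evalCircle_injective fun t => by rw [map_evalCircle_conjTranspose, (hT t).1]

variable [Fintype ι]

/-- The constant coefficient is the mean of the pointwise form `φ^* T φ`, which is positive wherever
`φ` is nonzero. -/
lemma eq_zero_of_coef_form {T : Matrix ι ι CircleFun} (hT : ∀ t, (T.map (evalCircle t)).PosDef)
    {φ : ι → CircleFun} (h : coef 0 (star φ ⬝ᵥ T *ᵥ φ) = 0) :
    φ = 0 := by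
  have hnn : ∀ t, 0 ≤ ((star φ ⬝ᵥ T *ᵥ φ) t).re := fun t => by
    rw [evalCircle_dotProduct_mulVec]
    exact (Complex.nonneg_iff.1 ((hT t).posSemidef.dotProduct_mulVec_nonneg _)).1
  ext i t
  by_contra hne
  have hne' : (fun i => φ i t) ≠ 0 := fun h0 => hne (congrFun h0 i)
  have hpos := (Complex.pos_iff.1 ((hT t).dotProduct_mulVec_pos hne')).1
  rw [← evalCircle_dotProduct_mulVec, eq_zero_of_re_coef_zero hnn (by rw [h]; rfl) t] at hpos
  exact lt_irrefl _ hpos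

/-- Prescribing the first Fourier coefficients of `T φ` determines a polynomial vector `φ`. -/
lemma exists_poly_mulVec {T : Matrix ι ι CircleFun}
    (hT : ∀ t, (T.map (evalCircle t)).PosDef) (n : ℕ) (r : ι → Fin (n + 1) → ℂ) :
    ∃ q : ι → ℂ[X], (∀ i, (q i).natDegree ≤ n) ∧
      ∀ i (k : Fin (n + 1)), coef (k : ℕ) ((T *ᵥ fun j => onCircle (q j)) i) = r i k := by
  let P : (Fin (n + 1) → ℂ) →ₗ[ℂ] ℂ[X] :=
    (degreeLT ℂ (n + 1)).subtype ∘ₗ (degreeLTEquiv ℂ (n + 1)).symm.toLinearMap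
  have hP : ∀ y, (P y).natDegree ≤ n := fun y => by
    have h := ((degreeLTEquiv ℂ (n + 1)).symm y).2
    rw [mem_degreeLT] at h
    exact natDegree_le_iff_coeff_eq_zero.2 fun N hN =>
      coeff_eq_zero_of_degree_lt (h.trans_le (by exact_mod_cast hN))
  have hPinj : ∀ y, P y = 0 → y = 0 := fun y hy => by
    have h : (degreeLTEquiv ℂ (n + 1)).symm y = 0 := Subtype.ext hy
    simpa using h
  let Λ : (ι → Fin (n + 1) → ℂ) →ₗ[ℂ] (ι → Fin (n + 1) → ℂ) :=
    { toFun := fun y i k => coef (k : ℕ) ((T *ᵥ fun j => onCircle (P (y j))) i)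
      map_add' := fun y y' => by
        ext i k
        simp only [Pi.add_apply, map_add]
        rw [← map_add, ← Pi.add_apply, ← Matrix.mulVec_add]
        rfl
      map_smul' := fun a y => by
        ext i k
        simp only [Pi.smul_apply, map_smul, RingHom.id_apply]
        rw [← map_smul]
        congr 1
        ext t
        simp [mulVec, dotProduct, Finset.mul_sum] }
  -- It suffices to treat zero data: `φ` has frequencies in `[0, n]`, where `T φ` then has none, so
  -- `φ^* T φ` has mean zero.
  have hinj : Function.Injective Λ := by
    rw [← LinearMap.ker_eq_bot, LinearMap.ker_eq_bot']
    intro y hy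
    have hφ : (fun j => onCircle (P (y j))) = 0 := by
      refine eq_zero_of_coef_form hT ?_
      rw [dotProduct, map_sum]
      refine Finset.sum_eq_zero fun i _ => ?_
      rw [Pi.star_apply, coef_star_onCircle_mul (Nat.lt_succ_of_le (hP (y i)))]
      refine Finset.sum_eq_zero fun k hk => ?_
      have := congrFun (congrFun hy i) ⟨k, Finset.mem_range.1 hk⟩
      change coef (k : ℕ) _ = 0 at this
      rw [zero_add, this, mul_zero]
    ext i k
    have h1 : P (y i) = 0 := onCircle_injective (by rw [map_zero]; exact congrFun hφ i)
    rw [hPinj _ h1]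
    rfl
  obtain ⟨y, hy⟩ := (LinearMap.injective_iff_surjective.1 hinj) r
  exact ⟨fun j => P (y j), fun j => hP _, fun i k => congrFun (congrFun hy i) k⟩

variable [DecidableEq ι]

section PosDef

variable {T : Matrix ι ι CircleFun} (hT : ∀ t, (T.map (evalCircle t)).PosDef)
include hT

lemma isUnit_det_of_posDef : IsUnit T.det := by
  rw [ContinuousMap.isUnit_iff_forall_ne_zero]
  intro t h
  have h1 : (T.map (evalCircle t)).det = T.det t := by
    have := (RingHom.map_det (evalCircle t : CircleFun →+* ℂ) T).symm
    exact this
  exact (hT t).det_pos.ne' (h1.trans h)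

lemma posDef_map_inv (t : UnitAddCircle) : (T⁻¹.map (evalCircle t)).PosDef := by
  have h : T⁻¹.map (evalCircle t) * T.map (evalCircle t) = 1 := by
    rw [← map_evalCircle_mul, nonsing_inv_mul _ (isUnit_det_of_posDef hT)]
    exact Matrix.map_one _ (map_zero _) (map_one _)
  rw [← Matrix.inv_eq_left_inv h]
  exact (hT t).inv

end PosDef

/-- The coefficient of the product at `k` only sees the coefficients of `g` in `[k - n, k + n]`; the
frequency bookkeeping of the Bernstein-Szegő argument rests on this. -/
lemma coef_trig_mul {n : ℕ} {f : CircleFun} {τ : ℂ[X]} (hτ : τ.natDegree ≤ 2 * n)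
    (hf : onCircle τ = circleVar ^ n * f) (k : ℤ) (g : CircleFun) :
    coef k (f * g) = ∑ s ∈ Finset.range (2 * n + 1), τ.coeff s * coef (k + n - s) g := by
  rw [← coef_onCircle_mul (Nat.lt_succ_of_le hτ), hf, mul_assoc, coef_circleVar_pow_mul,
    add_sub_cancel_right]

/-- The inverse of a positive definite trigonometric matrix maps polynomial vectors to functions
that split. -/
lemma splits_inv_mulVec {n : ℕ} {T : Matrix ι ι CircleFun}
    (hT : ∀ t, (T.map (evalCircle t)).PosDef) (htrig : IsTrigMatrix n T) (q : ι → ℂ[X]) (i : ι) :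
    Splits ((T⁻¹ *ᵥ fun j => onCircle (q j)) i) := by
  obtain ⟨τ, -, hτ⟩ := htrig.exists_poly
  have hτT : τ.map onCircle = diagonal (fun _ => circleVar ^ n) * T := by
    ext i j : 2
    simp [hτ, diagonal_mul]
  have hunit := isUnit_det_of_posDef hT
  have hdet : onCircle τ.det = (circleVar ^ n) ^ Fintype.card ι * T.det := by
    have h := RingHom.map_det (onCircle : ℂ[X] →+* CircleFun) τ
    change onCircle τ.det = (τ.map onCircle).det at h
    rw [h, hτT, det_mul, det_diagonal, Finset.prod_const, Finset.card_univ]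
  refine Splits.of_onCircle_mul (q := τ.det) (fun z hz => ?_) ?_
  · obtain ⟨t, rfl⟩ := exists_circleVar_eq hz
    rw [← onCircle_apply, hdet, ContinuousMap.mul_apply]
    refine mul_ne_zero ?_ ((ContinuousMap.isUnit_iff_forall_ne_zero _).1 hunit t)
    have h1 : circleVar t ≠ 0 := fun h => by
      have := norm_circleVar_apply t
      rw [h, norm_zero] at this
      exact zero_ne_one this
    simpa using fun h => absurd h h1
  · have h1 : (τ.adjugate.map onCircle) * (τ.map onCircle) = diagonal fun _ => onCircle τ.det := by
      rw [← Matrix.map_mul, Matrix.adjugate_mul]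
      ext i j : 2
      by_cases hij : i = j <;> simp [hij]
    have hadj : (diagonal fun _ => onCircle τ.det) * T⁻¹ =
        (τ.adjugate.map onCircle) * diagonal (fun _ => circleVar ^ n) := by
      rw [← h1, hτT, mul_assoc, mul_assoc, mul_nonsing_inv _ hunit, mul_one]
    -- By the adjugate formula, `det τ` times `T⁻¹ q` is a polynomial, so it splits with coanalytic
    -- part zero.
    refine ⟨0, onCircle ((τ.adjugate *ᵥ fun j => X ^ n * q j) i), fun k _ => map_zero _,
      isAnalyticFun_onCircle _, ?_⟩
    have h2 : onCircle τ.det * (T⁻¹ *ᵥ fun j => onCircle (q j)) i =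
        (((diagonal fun _ => onCircle τ.det) * T⁻¹) *ᵥ fun j => onCircle (q j)) i := by
      rw [← Matrix.mulVec_mulVec, mulVec_diagonal]
    have hX : onCircle X = circleVar := aeval_X _
    rw [h2, hadj, ← Matrix.mulVec_mulVec, zero_add]
    simp [mulVec, dotProduct, map_sum, hX, diagonal_apply]

/-- The matrix Bernstein-Szegő argument: if the Fourier coefficients of `T⁻¹ q` vanish at
`1, …, n`, then they vanish at all positive frequencies. -/
lemma isCoanalyticFun_inv_mulVec {n : ℕ} {T : Matrix ι ι CircleFun}
    (hT : ∀ t, (T.map (evalCircle t)).PosDef) (htrig : IsTrigMatrix n T) {q : ι → ℂ[X]}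
    (hq : ∀ i, (q i).natDegree ≤ n)
    (hcoef : ∀ i (k : ℕ), 0 < k → k ≤ n → coef k ((T⁻¹ *ᵥ fun j => onCircle (q j)) i) = 0)
    (i : ι) : IsCoanalyticFun ((T⁻¹ *ᵥ fun j => onCircle (q j)) i) := by
  have hunit := isUnit_det_of_posDef hT
  set g := T⁻¹ *ᵥ fun j => onCircle (q j) with hg
  choose u v hu hv huv using fun i => splits_inv_mulVec hT htrig q i
  rw [← hg] at huv
  have hcc : ∀ c : ℂ, ∀ k : ℤ, k ≠ 0 → coef k (c • (1 : CircleFun)) = 0 := fun c k hk => by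
    rw [map_smul, coef_one, if_neg hk, smul_zero]
  -- The constant coefficient of `v i` is moved to the coanalytic part, so that `gp` only has
  -- frequencies beyond `n`.
  set gp : ι → CircleFun := fun i => v i - coef 0 (v i) • (1 : CircleFun) with hgp
  set gm : ι → CircleFun := fun i => u i + coef 0 (v i) • (1 : CircleFun) with hgm
  have hsum : g = gm + gp := by
    ext1 i
    rw [huv, Pi.add_apply]
    simp only [hgp, hgm]
    abel
  have hgm0 : ∀ i (k : ℤ), 0 < k → coef k (gm i) = 0 := fun i k hk => by
    simp only [hgm]
    rw [map_add, hu i k hk, hcc _ _ hk.ne', add_zero]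
  have hgp0 : ∀ i (k : ℤ), k ≤ n → coef k (gp i) = 0 := fun i k hk => by
    rcases lt_trichotomy k 0 with h | h | h
    · simp only [hgp]
      rw [map_sub, hv i k h, hcc _ _ h.ne, sub_zero]
    · simp only [hgp]
      rw [h, map_sub, map_smul, coef_one, if_pos rfl, smul_eq_mul, mul_one, sub_self]
    · have h1 : coef k (g i) = 0 := by
        lift k to ℕ using h.le
        exact hcoef i k (by omega) (by omega)
      rw [hsum, Pi.add_apply, map_add, hgm0 i k h, zero_add] at h1
      exact h1
  obtain ⟨τ, hτd, hτ⟩ := htrig.exists_poly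
  have hTg : T *ᵥ g = fun j => onCircle (q j) := by
    rw [hg, Matrix.mulVec_mulVec, mul_nonsing_inv _ hunit, Matrix.one_mulVec]
  set φ := T *ᵥ gp with hφ
  have hφ1 : ∀ i (k : ℤ), k ≤ 0 → coef k (φ i) = 0 := fun i k hk => by
    rw [hφ, mulVec, dotProduct, map_sum]
    refine Finset.sum_eq_zero fun l _ => ?_
    rw [coef_trig_mul (hτd i l) (hτ i l)]
    exact Finset.sum_eq_zero fun s _ => by rw [hgp0 _ _ (by omega), mul_zero]
  have hφ2 : ∀ i (k : ℤ), n < k → coef k (φ i) = 0 := fun i k hk => by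
    have h1 : φ = (fun j => onCircle (q j)) - T *ᵥ gm := by
      rw [← hTg, hsum, Matrix.mulVec_add, add_sub_cancel_left]
    have h2 : coef k ((T *ᵥ gm) i) = 0 := by
      rw [mulVec, dotProduct, map_sum]
      refine Finset.sum_eq_zero fun l _ => ?_
      rw [coef_trig_mul (hτd i l) (hτ i l)]
      refine Finset.sum_eq_zero fun s hs => ?_
      rw [Finset.mem_range] at hs
      rw [hgm0 _ _ (by omega), mul_zero]
    rw [h1, Pi.sub_apply, map_sub, h2, sub_zero]
    lift k to ℕ using (by omega)
    rw [coef_onCircle_natCast]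
    exact coeff_eq_zero_of_natDegree_lt ((hq i).trans_lt (by omega))
  choose r hr hrφ using fun i => exists_onCircle_eq (f := φ i) (n := n)
    fun k hk => hk.elim (fun h => hφ1 i k h.le) (hφ2 i k)
  have hCφ : T⁻¹ *ᵥ φ = gp := by
    rw [hφ, Matrix.mulVec_mulVec, nonsing_inv_mul _ hunit, Matrix.one_mulVec]
  -- `φ = T gp` has only positive frequencies, and `φ = q - T gm` has none beyond `n`. So `φ` lives
  -- in `[1, n]`, while `T⁻¹ φ = gp` lives beyond `n`: they are orthogonal, and positivity of `T⁻¹`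
  -- gives `φ = 0`.
  have hφ0 : φ = 0 := by
    refine eq_zero_of_coef_form (posDef_map_inv hT) ?_
    rw [hCφ, dotProduct, map_sum]
    refine Finset.sum_eq_zero fun i _ => ?_
    rw [Pi.star_apply, ← hrφ, coef_star_onCircle_mul (Nat.lt_succ_of_le (hr i))]
    refine Finset.sum_eq_zero fun s hs => ?_
    rw [Finset.mem_range] at hs
    rw [hgp0 _ _ (by omega), mul_zero]
  rw [hφ0, Matrix.mulVec_zero] at hCφ
  intro k hk
  rw [hsum, ← hCφ, add_zero, hgm0 i k hk]

/-- The matrix Fejér-Riesz theorem with an outer factor, for positive definite trigonometric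
matrices. -/
theorem exists_spectral_factor {n : ℕ} {T : Matrix ι ι CircleFun}
    (hT : ∀ t, (T.map (evalCircle t)).PosDef) (htrig : IsTrigMatrix n T) :
    ∃ (E : Matrix ι ι ℂ[X]) (F : Matrix ι ι CircleFun), (∀ i j, (E i j).natDegree ≤ n) ∧
      E.map onCircle * (E.map onCircle)ᴴ = T ∧ F * E.map onCircle = 1 ∧
      ∀ i j, IsAnalyticFun (F i j) := by
  have hunit := isUnit_det_of_posDef hT
  have hC := posDef_map_inv hT
  -- The columns of `Y` are chosen so that `T⁻¹ Y` has the identity as coefficient at `0` and zero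
  -- at `1, …, n`.
  choose Y' hY'd hY' using fun j => exists_poly_mulVec hC n
    fun i k => if k = 0 ∧ i = j then 1 else 0
  set Y : Matrix ι ι ℂ[X] := fun i j => Y' j i with hY
  set Yc := Y.map onCircle with hYc
  set G := T⁻¹ * Yc with hG
  have hGcol : ∀ i j, G i j = (T⁻¹ *ᵥ fun l => onCircle (Y' j l)) i := fun i j => rfl
  have hG0 : ∀ i j (k : ℕ), k ≤ n → coef k (G i j) = if k = 0 ∧ i = j then 1 else 0 := by
    intro i j k hk
    have := hY' j i ⟨k, Nat.lt_succ_of_le hk⟩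
    rw [hGcol, this]
    simp [Fin.ext_iff]
  have hGc : ∀ i j, IsCoanalyticFun (G i j) := fun i j => by
    rw [hGcol]
    refine isCoanalyticFun_inv_mulVec hT htrig (hY'd j) (fun i k hk hkn => ?_) i
    rw [← hGcol, hG0 i j k hkn, if_neg (by omega)]
  set M := Ycᴴ * G with hM
  have hMherm : Mᴴ = M := by
    rw [hM, hG, conjTranspose_mul, conjTranspose_mul, conjTranspose_conjTranspose,
      conjTranspose_of_posDef hC, mul_assoc]
  have hMpos : ∀ i j, IsCoanalyticFun (M i j) := fun i j k hk => by
    rw [hM, mul_apply, map_sum]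
    refine Finset.sum_eq_zero fun l _ => ?_
    rw [conjTranspose_apply, hYc, map_apply, coef_star_onCircle_mul (Nat.lt_succ_self _)]
    exact Finset.sum_eq_zero fun s _ => by rw [hGc _ _ _ (by omega), mul_zero]
  set S : Matrix ι ι ℂ := fun i j => coef 0 (M i j) with hS
  -- `M = Y^* T⁻¹ Y` is coanalytic and Hermitian, hence constant.
  have hMS : M = S.map (algebraMap ℂ CircleFun) := by
    ext1 i j
    rw [← sub_eq_zero]
    refine eq_zero_of_coef fun k => ?_
    have hc : algebraMap ℂ CircleFun (S i j) = S i j • (1 : CircleFun) := by ext t; simp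
    rw [map_apply, hc, map_sub, map_smul, coef_one]
    rcases lt_trichotomy k 0 with h | h | h
    · rw [if_neg h.ne, smul_zero, sub_zero, ← hMherm, conjTranspose_apply, coef_star,
        hMpos _ _ _ (neg_pos.2 h), map_zero]
    · rw [if_pos h, h, smul_eq_mul, mul_one, sub_eq_zero]
    · rw [if_neg h.ne', smul_zero, sub_zero, hMpos _ _ _ h]
  have hMeval : ∀ t, M.map (evalCircle t) = S := fun t => by
    rw [hMS]
    ext i j
    simp
  have hSeval : ∀ t, S = (Yc.map (evalCircle t))ᴴ * T⁻¹.map (evalCircle t) *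
      Yc.map (evalCircle t) := fun t => by
    rw [← hMeval t, hM, hG, map_evalCircle_mul, map_evalCircle_mul, map_evalCircle_conjTranspose,
      mul_assoc]
  have hSpos : S.PosDef := by
    refine PosDef.of_dotProduct_mulVec_pos ?_ fun x hx => ?_
    · rw [hSeval 0]
      exact ((hC 0).posSemidef.conjTranspose_mul_mul_same _).1
    -- If `Y x` vanished identically, so would `T⁻¹ Y x`, whose constant coefficient is `x`.
    · have hex : ∃ t, Yc.map (evalCircle t) *ᵥ x ≠ 0 := by
        by_contra! hall
        refine hx ?_
        have h1 : Yc *ᵥ (fun i => algebraMap ℂ CircleFun (x i)) = 0 := by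
          ext i t
          have := congrFun (hall t) i
          simpa [mulVec, dotProduct] using this
        have h2 : G *ᵥ (fun i => algebraMap ℂ CircleFun (x i)) = 0 := by
          rw [hG, ← Matrix.mulVec_mulVec, h1, Matrix.mulVec_zero]
        ext i
        have h3 := congrArg (coef 0) (congrFun h2 i)
        have h4 : ∀ j, coef 0 (G i j * algebraMap ℂ CircleFun (x j)) = coef 0 (G i j) * x j := by
          intro j
          have : G i j * algebraMap ℂ CircleFun (x j) = x j • G i j := by
            ext t; simp [mul_comm]
          rw [this, map_smul, smul_eq_mul, mul_comm]
        have h5 : ∀ j, coef 0 (G i j) = if i = j then 1 else 0 := fun j => by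
          have := hG0 i j 0 (Nat.zero_le _)
          simpa using this
        rw [mulVec, dotProduct, map_sum] at h3
        simpa [h4, h5] using h3
      obtain ⟨t, ht⟩ := hex
      have := (hC t).dotProduct_mulVec_pos ht
      rw [hSeval t, ← Matrix.mulVec_mulVec, ← Matrix.mulVec_mulVec, dotProduct_mulVec,
        vecMul_conjTranspose, star_star]
      exact this
  obtain ⟨D, hD⟩ := CStarAlgebra.nonneg_iff_eq_star_mul_self.1 hSpos.inv.posSemidef.nonneg
  have hSunit : IsUnit S.det := (isUnit_iff_isUnit_det _).1 hSpos.isUnit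
  rw [star_eq_conjTranspose] at hD
  set c : ℂ →+* CircleFun := algebraMap ℂ CircleFun with hc
  have hcstar : (D.map c)ᴴ = Dᴴ.map c := by
    ext i j t
    simp [c]
  have hBS : (Dᴴ.map c) * (D.map c * M) = 1 := by
    rw [hMS, ← mul_assoc, ← Matrix.map_mul, ← hD, ← Matrix.map_mul, nonsing_inv_mul _ hSunit]
    exact Matrix.map_one _ (map_zero _) (map_one _)
  have hYinv : Yc * (Dᴴ.map c * (D.map c * (Ycᴴ * T⁻¹))) = 1 := by
    rw [mul_eq_one_comm, ← hBS, hM, hG]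
    simp only [mul_assoc]
  have hEc : (Y * Dᴴ.map C).map onCircle = Yc * Dᴴ.map c := by
    rw [Matrix.map_mul]
    congr 1
    ext i j : 2
    simp [c, onCircle]
  -- With `S⁻¹ = D^* D` the factor is `E = Y D^*`: then `E E^* = Y S⁻¹ Y^* = T`. Its inverse is
  -- `(T⁻¹ E)^*`, analytic because `T⁻¹ Y` is coanalytic.
  refine ⟨Y * Dᴴ.map C, (T⁻¹ * (Yc * Dᴴ.map c))ᴴ, fun i j => ?_, ?_, ?_, fun i j k hk => ?_⟩
  · rw [mul_apply]
    refine natDegree_sum_le_of_forall_le _ _ fun l _ => ?_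
    rw [map_apply]
    exact (natDegree_mul_C_le _ _).trans (hY'd l i)
  · rw [hEc, conjTranspose_mul, ← hcstar, conjTranspose_conjTranspose, hcstar]
    have h1 : Yc * Dᴴ.map c * (D.map c * Ycᴴ) * T⁻¹ = 1 := by
      rw [← hYinv]
      simp only [mul_assoc]
    calc Yc * Dᴴ.map c * (D.map c * Ycᴴ) =
        Yc * Dᴴ.map c * (D.map c * Ycᴴ) * (T⁻¹ * T) := by
          rw [nonsing_inv_mul _ hunit, mul_one]
      _ = T := by rw [← mul_assoc, h1, one_mul]
  · rw [hEc, conjTranspose_mul, conjTranspose_mul, ← hcstar, conjTranspose_conjTranspose, hcstar,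
      conjTranspose_of_posDef hC]
    have h1 := mul_eq_one_comm.1 hBS
    rw [← h1, hM, hG]
    simp only [mul_assoc]
  · rw [conjTranspose_apply, coef_star, ← mul_assoc, ← hG, mul_apply, map_sum, map_eq_zero]
    refine Finset.sum_eq_zero fun l _ => ?_
    have : G j l * Dᴴ.map c l i = Dᴴ l i • G j l := by
      ext t
      simp [c, mul_comm]
    rw [this, map_smul, hGc _ _ _ (neg_pos.2 hk), smul_zero]

end BiPoly

end

/-! ### Reflections, and the two matrix polynomials with equal Gram matrices on the circle -/

noncomputable section

namespace BiPoly

open Polynomial Matrix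
open scoped ComplexOrder

section Reflection

lemma eval_conjReflect {N : ℕ} {q : ℂ[X]} (hq : q.natDegree ≤ N) {z : ℂ} (hz : z ≠ 0) :
    (conjReflect N q).eval z = z ^ N * conj (q.eval (conj z)⁻¹) := by
  rw [eval_eq_sum_range' (Nat.lt_succ_of_le (natDegree_conjReflect_le hq)),
    eval_eq_sum_range' (Nat.lt_succ_of_le hq), map_sum, Finset.mul_sum, ← Finset.sum_range_reflect]
  refine Finset.sum_congr rfl fun b hb => ?_
  rw [Finset.mem_range] at hb
  rw [coeff_conjReflect hq, if_pos (by omega), show N + 1 - 1 - b = N - b by omega,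
    show N - (N - b) = b by omega, map_mul, map_pow, map_inv₀, Complex.conj_conj,
    pow_sub₀ z hz (by omega), inv_pow]
  ring

lemma onCircle_conjReflect {N : ℕ} {q : ℂ[X]} (hq : q.natDegree ≤ N) :
    onCircle (conjReflect N q) = circleVar ^ N * star (onCircle q) := by
  ext t
  have h1 := norm_circleVar_apply t
  have h0 : circleVar t ≠ 0 := fun h => by
    rw [h, norm_zero] at h1
    exact zero_ne_one h1
  have h2 : (conj (circleVar t))⁻¹ = circleVar t := by
    rw [Complex.inv_def, Complex.conj_conj, Complex.normSq_conj, Complex.normSq_eq_norm_sq, h1]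
    simp
  rw [onCircle_apply, eval_conjReflect hq h0, h2, ContinuousMap.mul_apply, ContinuousMap.star_apply,
    onCircle_apply]
  rfl

/-- Reflection sends nonzero zeros `z` to `1 / conj z`. The degree must be exactly `N`: the value at
`0` is the conjugate of the leading coefficient. -/
lemma eval_conjReflect_ne_zero {N : ℕ} {q : ℂ[X]} (hq : q.natDegree = N) (hq0 : q ≠ 0)
    (hz : ∀ z : ℂ, q.eval z = 0 → ‖z‖ < 1) {z : ℂ} (hz1 : ‖z‖ ≤ 1) :
    (conjReflect N q).eval z ≠ 0 := by
  rcases eq_or_ne z 0 with rfl | h0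
  · rw [← coeff_zero_eq_eval_zero, coeff_conjReflect hq.le, if_pos (Nat.zero_le _), Nat.sub_zero,
      ← hq, Ne, map_eq_zero]
    exact leadingCoeff_ne_zero.2 hq0
  · rw [eval_conjReflect hq.le h0]
    refine mul_ne_zero (pow_ne_zero _ h0) fun h => ?_
    rw [map_eq_zero] at h
    have := hz _ h
    rw [norm_inv, RCLike.norm_conj] at this
    exact absurd this (not_lt.2 (one_le_inv_iff₀.2 ⟨norm_pos_iff.2 h0, hz1⟩))

lemma conjReflect_ne_zero {N : ℕ} {q : ℂ[X]} (hq : q.natDegree ≤ N) (hq0 : q ≠ 0) :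
    conjReflect N q ≠ 0 := by
  intro h
  refine hq0 (ext fun b => ?_)
  rcases le_or_gt b N with hb | hb
  · have := coeff_conjReflect hq (N - b)
    rw [h, coeff_zero, if_pos (by omega), show N - (N - b) = b by omega, eq_comm,
      map_eq_zero] at this
    rw [this, coeff_zero]
  · rw [coeff_eq_zero_of_natDegree_lt (by omega), coeff_zero]

/-- The splitting of a polynomial according to its zeros inside and outside of the disk. -/
lemma exists_disk_factorization {q : ℂ[X]} (hq : ∀ z : ℂ, ‖z‖ = 1 → q.eval z ≠ 0) :
    ∃ a b : ℂ[X], q = a * b ∧ a.natDegree = zerosInDisk q ∧ a ≠ 0 ∧ b ≠ 0 ∧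
      (∀ z : ℂ, a.eval z = 0 → ‖z‖ < 1) ∧ ∀ z : ℂ, ‖z‖ ≤ 1 → b.eval z ≠ 0 := by
  classical
  have hq0 : q ≠ 0 := by
    rintro rfl
    exact hq 1 (by simp) (by simp)
  have hprod : ∀ s : Multiset ℂ, (s.map fun a => X - C a).prod ≠ 0 := fun s =>
    (monic_multiset_prod_of_monic _ _ fun a _ => monic_X_sub_C a).ne_zero
  have heval : ∀ (s : Multiset ℂ) (z : ℂ), (s.map fun a => X - C a).prod.eval z = 0 → z ∈ s := by
    intro s z h
    have h1 : z ∈ (s.map fun a => X - C a).prod.roots := (mem_roots (hprod s)).2 h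
    rwa [roots_multiset_prod_X_sub_C] at h1
  refine ⟨((q.roots.filter fun a => ‖a‖ < 1).map fun a => X - C a).prod,
    C q.leadingCoeff * ((q.roots.filter fun a => ¬ ‖a‖ < 1).map fun a => X - C a).prod, ?_, ?_,
    hprod _, mul_ne_zero (C_ne_zero.2 (leadingCoeff_ne_zero.2 hq0)) (hprod _), ?_, ?_⟩
  · rw [mul_left_comm, ← Multiset.prod_add, ← Multiset.map_add, Multiset.filter_add_not]
    exact (IsAlgClosed.splits q).eq_prod_roots
  · rw [natDegree_multiset_prod_X_sub_C_eq_card, zerosInDisk, Multiset.countP_eq_card_filter]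
  · intro z hz
    exact (Multiset.mem_filter.1 (heval _ z hz)).2
  · intro z hz h
    rw [eval_mul, eval_C, mul_eq_zero, or_iff_right (leadingCoeff_ne_zero.2 hq0)] at h
    obtain ⟨h1, h2⟩ := Multiset.mem_filter.1 (heval _ z h)
    exact hq z (le_antisymm hz (not_lt.1 h2)) ((mem_roots hq0).1 h1)

/-- Divisibility by a polynomial of degree at most `k` amounts to `k` linear conditions. -/
lemma exists_remainder_map {k : ℕ} {q : ℂ[X]} (hq0 : q ≠ 0) (hq : q.natDegree ≤ k) :
    ∃ L : ℂ[X] →ₗ[ℂ] (Fin k → ℂ), ∀ f, L f = 0 → q ∣ f := by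
  have hmon : (q * C q.leadingCoeff⁻¹).Monic := monic_mul_leadingCoeff_inv hq0
  refine ⟨LinearMap.pi (fun i => lcoeff ℂ i) ∘ₗ modByMonicHom (q * C q.leadingCoeff⁻¹),
    fun f hf => ?_⟩
  -- The conditions are the `k` coefficients of the remainder modulo the monic normalization of `q`.
  refine dvd_trans ⟨_, rfl⟩ ((modByMonic_eq_zero_iff_dvd hmon).1 (ext fun i => ?_))
  rw [coeff_zero]
  by_cases hi : i < k
  · exact congrFun hf ⟨i, hi⟩
  · refine coeff_eq_zero_of_degree_lt ((degree_modByMonic_lt f hmon).trans_le ?_)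
    rw [degree_mul_leadingCoeff_inv _ hq0]
    exact degree_le_natDegree.trans (by exact_mod_cast hq.trans (not_lt.1 hi))

end Reflection

section Gram

variable {m : ℕ}

/-- The matrix with first column `p` and with the matrix `E`, moved down by one row, in the other
columns. -/
def lowerMat {R : Type*} [Zero R] (p : ℕ → R) (E : Matrix (Fin m) (Fin m) R) :
    Matrix (Fin (m + 1)) (Fin (m + 1)) R :=
  fun b => Fin.cons (p b) fun j => Fin.cases 0 (fun c => E c j) b

/-- The matrix with first column `p` and with the matrix `E` in the upper rows of the other
columns. -/
def upperMat {R : Type*} [Zero R] (p : ℕ → R) (E : Matrix (Fin m) (Fin m) R) :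
    Matrix (Fin (m + 1)) (Fin (m + 1)) R :=
  fun b => Fin.cons (p b) fun j => Fin.lastCases 0 (fun c => E c j) b

section Entries

variable {R : Type*} [Zero R] (p : ℕ → R) (E : Matrix (Fin m) (Fin m) R)

@[simp] lemma lowerMat_zero (b : Fin (m + 1)) : lowerMat p E b 0 = p b := rfl

@[simp] lemma lowerMat_zero_succ (j : Fin m) : lowerMat p E 0 j.succ = 0 := rfl

@[simp] lemma lowerMat_succ_succ (b j : Fin m) : lowerMat p E b.succ j.succ = E b j := rfl

@[simp] lemma upperMat_zero (b : Fin (m + 1)) : upperMat p E b 0 = p b := rfl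

@[simp] lemma upperMat_last_succ (j : Fin m) : upperMat p E (Fin.last m) j.succ = 0 := by
  simp [upperMat]

@[simp] lemma upperMat_castSucc_succ (b j : Fin m) :
    upperMat p E b.castSucc j.succ = E b j := by
  simp [upperMat]

end Entries

/-- The coefficients of `w ^ b` in the reflection of `∑ p b w ^ b`. -/
def reflectSeq (n m : ℕ) (p : ℕ → ℂ[X]) (b : ℕ) : ℂ[X] :=
  if b ≤ m then conjReflect n (p (m - b)) else 0

/-- The two sequences differ on the circle by the factor `z ^ n`, which has modulus one. -/
lemma onCircle_reflectSeq_mul_star {n : ℕ} {p : ℕ → ℂ[X]} (hp : ∀ b, (p b).natDegree ≤ n)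
    (b c : ℕ) : onCircle (reflectSeq n m p b) * star (onCircle (reflectSeq n m p c)) =
      revStar m (fun b => onCircle (p b)) b * star (revStar m (fun b => onCircle (p b)) c) := by
  simp only [reflectSeq, revStar]
  split_ifs with hb hc
  · have h : circleVar ^ n * star circleVar ^ n = 1 := by
      rw [← mul_pow, mul_comm, star_circleVar_mul, one_pow]
    rw [onCircle_conjReflect (hp _), onCircle_conjReflect (hp _), star_mul, star_pow, star_star]
    linear_combination (star (onCircle (p (m - b))) * onCircle (p (m - c))) * h
  all_goals simp

/-- The Schur-Cohn matrix of `∑ p b w ^ b` with entries on the unit circle. -/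
def schurMat (m : ℕ) (p : ℕ → ℂ[X]) : Matrix (Fin m) (Fin m) CircleFun :=
  fun i j => diagSum (schurKernel m fun b => onCircle (p b)) i j

/-- With `S` the Schur-Cohn coefficients, the entries of the two sides are `p_b p_c^* + S (b-1)
(c-1)` and `q_b q_c^* + S b c`. They agree by the recursion defining `S` as the quotient of `p_b
p_c^* - q_b q_c^*` by `1 - x y`. The zero last row of the moved columns is correct because `S`
vanishes at index `m`. -/
lemma schurMat_gram {n : ℕ} {p : ℕ → ℂ[X]} (hp : ∀ b, (p b).natDegree ≤ n)
    (hpm : ∀ b, m < b → p b = 0) {E : Matrix (Fin m) (Fin m) ℂ[X]}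
    (hE : E.map onCircle * (E.map onCircle)ᴴ = schurMat m p) :
    (lowerMat p E).map onCircle * ((lowerMat p E).map onCircle)ᴴ =
      (upperMat (reflectSeq n m p) E).map onCircle *
        ((upperMat (reflectSeq n m p) E).map onCircle)ᴴ := by
  set D := schurKernel m fun b => onCircle (p b) with hD
  have hE' : ∀ i j, ∑ k, onCircle (E i k) * star (onCircle (E j k)) = diagSum D i j := by
    intro i j
    have := congrFun (congrFun hE i) j
    rwa [mul_apply] at this
  have hvan : ∀ {b c : ℕ}, m ≤ b ∨ m ≤ c → diagSum D b c = 0 := fun h =>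
    diagSum_schurKernel_eq_zero (fun b hb => by rw [hpm b hb, map_zero]) h
  have hU : ∀ b c : Fin (m + 1), ((upperMat (reflectSeq n m p) E).map onCircle *
      ((upperMat (reflectSeq n m p) E).map onCircle)ᴴ) b c =
      revStar m (fun b => onCircle (p b)) b * star (revStar m (fun b => onCircle (p b)) c) +
        diagSum D b c := by
    intro b c
    rw [mul_apply, Fin.sum_univ_succ, ← onCircle_reflectSeq_mul_star hp]
    congr 1
    refine Fin.lastCases ?_ (fun b => ?_) b
    · rw [hvan (Or.inl (by simp))]
      simp
    · refine Fin.lastCases ?_ (fun c => ?_) c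
      · rw [hvan (Or.inr (by simp))]
        simp
      · simpa using hE' b c
  ext1 b c
  rw [hU, mul_apply, Fin.sum_univ_succ]
  refine Fin.cases ?_ (fun b => ?_) b
  · rw [Fin.val_zero, diagSum_zero_left, hD, schurKernel]
    simp
  · refine Fin.cases ?_ (fun c => ?_) c
    · rw [Fin.val_zero, diagSum_zero_right, hD, schurKernel]
      simp
    · rw [Fin.val_succ, Fin.val_succ, diagSum_succ, hD, schurKernel, ← hD, ← hE']
      simp only [map_apply, conjTranspose_apply, lowerMat_zero, lowerMat_succ_succ, Fin.val_succ]
      ring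

lemma coef_mul_star_eq_zero {n : ℕ} {a b : ℂ[X]} (ha : a.natDegree ≤ n) (hb : b.natDegree ≤ n)
    {k : ℤ} (hk : (n : ℤ) < |k|) : coef k (onCircle a * star (onCircle b)) = 0 := by
  rw [coef_onCircle_mul (Nat.lt_succ_of_le ha)]
  refine Finset.sum_eq_zero fun j hj => ?_
  rw [Finset.mem_range] at hj
  rw [coef_star]
  rcases lt_abs.1 hk with h | h
  · rw [coef_onCircle_neg _ (by omega), map_zero, mul_zero]
  · obtain ⟨l, hl⟩ := Int.eq_ofNat_of_zero_le (show 0 ≤ -(k - j) by omega)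
    rw [hl, coef_onCircle_natCast, coeff_eq_zero_of_natDegree_lt (p := b) (by omega), map_zero,
      mul_zero]

lemma isTrigMatrix_schurMat {n : ℕ} {p : ℕ → ℂ[X]} (hp : ∀ b, (p b).natDegree ≤ n) :
    IsTrigMatrix n (schurMat m p) := by
  intro i j k hk
  rw [schurMat, diagSum, map_sum]
  refine Finset.sum_eq_zero fun l _ => ?_
  have hrev : ∀ b c, coef k (revStar m (fun b => onCircle (p b)) b *
      star (revStar m (fun b => onCircle (p b)) c)) = 0 := by
    intro b c
    simp only [revStar]
    split_ifs
    · rw [star_star, mul_comm]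
      exact coef_mul_star_eq_zero (hp _) (hp _) hk
    all_goals simp
  rw [schurKernel, map_sub, hrev, coef_mul_star_eq_zero (hp _) (hp _) hk, sub_zero]

lemma posDef_schurMat {p : ℕ → ℂ[X]} (hpm : ∀ b, m < b → p b = 0)
    (hz : ∀ z w : ℂ, ‖z‖ = 1 → ‖w‖ ≤ 1 → ∑ b ∈ Finset.range (m + 1), (p b).eval z * w ^ b ≠ 0)
    (t : UnitAddCircle) : ((schurMat m p).map (evalCircle t)).PosDef := by
  set q : ℂ[X] := ∑ b ∈ Finset.range (m + 1), C ((p b).eval (circleVar t)) * X ^ b with hq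
  have hcoeff : ∀ b, q.coeff b = evalCircle t (onCircle (p b)) := by
    intro b
    rw [evalCircle_apply, onCircle_apply]
    simp only [hq, finsetSum_coeff, coeff_C_mul, coeff_X_pow, mul_ite, mul_one, mul_zero,
      Finset.sum_ite_eq, Finset.mem_range, Nat.lt_succ_iff]
    split_ifs with h
    · rfl
    · rw [hpm b (not_le.1 h), eval_zero]
  have hdeg : q.natDegree ≤ m := by
    rw [natDegree_le_iff_coeff_eq_zero]
    intro b hb
    rw [hcoeff, hpm b hb, map_zero, map_zero]
  have hqz : ∀ w : ℂ, ‖w‖ ≤ 1 → q.eval w ≠ 0 := by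
    intro w hw
    have := hz _ w (norm_circleVar_apply t) hw
    simpa [hq, eval_finsetSum] using this
  have h := posDef_schurKernel hdeg hqz
  convert h using 1
  ext i j
  have hrev : ∀ b, revStar m q.coeff b = evalCircle t (revStar m (fun b => onCircle (p b)) b) := by
    intro b
    simp only [revStar, hcoeff]
    split_ifs
    · rw [map_star]
    · rw [map_zero]
  simp only [map_apply, schurMat, of_apply, diagSum, map_sum]
  refine Finset.sum_congr rfl fun k _ => ?_
  simp only [schurKernel, hrev, hcoeff, map_sub, map_mul, map_star]

end Gram

end BiPoly

end

/-! ### The Bezoutian as a difference of Toeplitz forms, and its inertia -/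

noncomputable section

namespace BiPoly

open Polynomial Matrix
open scoped ComplexOrder

variable {ρ : Type*}

/-- The polynomial vector with coefficients `c`. -/
def polyVec {n : ℕ} (c : Fin n × ρ → ℂ) (b : ρ) : ℂ[X] := ∑ a : Fin n, C (c (a, b)) * X ^ (a : ℕ)

lemma coeff_polyVec {n : ℕ} (c : Fin n × ρ → ℂ) (b : ρ) (x : ℕ) :
    (polyVec c b).coeff x = if h : x < n then c (⟨x, h⟩, b) else 0 := by
  simp only [polyVec, finsetSum_coeff, coeff_C_mul, coeff_X_pow, mul_ite, mul_one, mul_zero]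
  split_ifs with h
  · rw [Finset.sum_eq_single ⟨x, h⟩]
    · simp
    · intro a _ ha
      rw [if_neg fun hx => ha (Fin.ext hx.symm)]
    · simp
  · exact Finset.sum_eq_zero fun a _ => if_neg (by omega)

variable [Fintype ρ]

/-- The coefficients of the kernel `P(z) P(ζ)^* - Q(z) Q(ζ)^*`. -/
def kernelCoef (P Q : Matrix ρ ρ ℂ[X]) (b c : ρ) (x y : ℕ) : ℂ :=
  ∑ i, (P b i).coeff x * conj ((P c i).coeff y) - ∑ i, (Q b i).coeff x * conj ((Q c i).coeff y)

/-- The coefficients of the quotient of the kernel `P(z) P(ζ)^* - Q(z) Q(ζ)^*` by `1 - z ζ^*`. -/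
def bezoutian (n : ℕ) (P Q : Matrix ρ ρ ℂ[X]) : Matrix (Fin n × ρ) (Fin n × ρ) ℂ :=
  fun α β => diagSum (kernelCoef P Q α.2 β.2) α.1 β.1

lemma conj_kernelCoef (P Q : Matrix ρ ρ ℂ[X]) (b c : ρ) (x y : ℕ) :
    conj (kernelCoef P Q b c x y) = kernelCoef P Q c b y x := by
  simp [kernelCoef, mul_comm]

lemma isHermitian_bezoutian (n : ℕ) (P Q : Matrix ρ ρ ℂ[X]) : (bezoutian n P Q).IsHermitian := by
  ext α β
  simp only [bezoutian, conjTranspose_apply, diagSum, star_sum]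
  rw [min_comm]
  exact Finset.sum_congr rfl fun k _ => conj_kernelCoef _ _ _ _ _ _

lemma coef_mul_star {n : ℕ} {b : ℂ[X]} (hb : b.natDegree ≤ n) (a : ℂ[X]) (e : ℕ) :
    coef e (onCircle a * star (onCircle b)) =
      ∑ i ∈ Finset.range (n + 1), a.coeff (i + e) * conj (b.coeff i) := by
  rw [mul_comm, coef_star_onCircle_mul (Nat.lt_succ_of_le hb)]
  refine Finset.sum_congr rfl fun i _ => ?_
  rw [← Nat.cast_add, coef_onCircle_natCast, mul_comm, add_comm]

/-- The sums of the kernel along diagonals are the Fourier coefficients of `P P^* - Q Q^*` on the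
circle, so the division by `1 - z ζ^*` is exact. -/
lemma diagSum_kernelCoef_eq_zero {n : ℕ} {P Q : Matrix ρ ρ ℂ[X]}
    (hP : ∀ b i, (P b i).natDegree ≤ n) (hQ : ∀ b i, (Q b i).natDegree ≤ n)
    (hPQ : P.map onCircle * (P.map onCircle)ᴴ = Q.map onCircle * (Q.map onCircle)ᴴ)
    (b c : ρ) {x y : ℕ} (hxy : n ≤ x ∨ n ≤ y) : diagSum (kernelCoef P Q b c) x y = 0 := by
  have hl : ∀ (b c : ρ) (e : ℕ),
      ∑ i ∈ Finset.range (n + 1), kernelCoef P Q b c (i + e) i = 0 := by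
    intro b c e
    have h := congrArg (coef e) (congrFun (congrFun hPQ b) c)
    simp only [mul_apply, map_apply, conjTranspose_apply, map_sum] at h
    simp only [coef_mul_star (hP _ _), coef_mul_star (hQ _ _)] at h
    simp only [kernelCoef, Finset.sum_sub_distrib]
    rw [sub_eq_zero, Finset.sum_comm, h, Finset.sum_comm]
  have hzero : ∀ {q : ℂ[X]}, q.natDegree ≤ n → ∀ {x : ℕ}, n < x → q.coeff x = 0 :=
    fun hq x hx => coeff_eq_zero_of_natDegree_lt (hq.trans_lt hx)
  refine diagSum_eq_zero (fun x y h => ?_) (hl b c) (fun e => ?_) hxy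
  · rw [kernelCoef]
    rcases h with h | h
    · simp [hzero (hP _ _) h, hzero (hQ _ _) h]
    · simp [hzero (hP _ _) h, hzero (hQ _ _) h]
  · rw [← map_zero (starRingEnd ℂ), ← hl c b e, map_sum]
    exact Finset.sum_congr rfl fun i _ => (conj_kernelCoef _ _ _ _ _ _).symm

/-- The analytic part of `conj q * z ^ a` on the circle. -/
def toeplitzPoly (q : ℂ[X]) (a : ℕ) : ℂ[X] :=
  ∑ k ∈ Finset.range (a + 1), C (conj (q.coeff (a - k))) * X ^ k

lemma coeff_mul_toeplitzPoly (r q : ℂ[X]) (a x : ℕ) :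
    (r * toeplitzPoly q a).coeff x =
      ∑ k ∈ Finset.range (min x a + 1), r.coeff (x - k) * conj (q.coeff (a - k)) := by
  rw [toeplitzPoly, Finset.mul_sum, finsetSum_coeff]
  have h : ∀ k, (r * (C (conj (q.coeff (a - k))) * X ^ k)).coeff x =
      if k ≤ x then r.coeff (x - k) * conj (q.coeff (a - k)) else 0 := by
    intro k
    rw [← mul_assoc, coeff_mul_X_pow', coeff_mul_C]
  simp only [h]
  rw [← Finset.sum_filter]
  refine Finset.sum_congr ?_ fun _ _ => rfl
  ext k
  simp only [Finset.mem_filter, Finset.mem_range]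
  omega

/-- Against an analytic `u`, replacing `conj q * z ^ a` by its analytic part does not change the
inner product. -/
lemma coef_star_toeplitzPoly_mul (q : ℂ[X]) (a : ℕ) {u : CircleFun} (hu : IsAnalyticFun u) :
    coef 0 (star (onCircle (toeplitzPoly q a)) * u) = coef a (onCircle q * u) := by
  have h1 : onCircle (toeplitzPoly q a) =
      ∑ k ∈ Finset.range (a + 1), onCircle (C (conj (q.coeff (a - k))) * X ^ k) := map_sum _ _ _
  have h2 : ∀ k, coef 0 (star (onCircle (C (conj (q.coeff (a - k))) * X ^ k)) * u) =
      q.coeff (a - k) * coef k u := by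
    intro k
    rw [coef_star_onCircle_mul (N := k + 1) (Nat.lt_succ_of_le (natDegree_C_mul_X_pow_le _ _)),
      Finset.sum_eq_single k]
    · simp
    · intro j _ hj
      simp [coeff_X_pow, hj]
    · simp
  rw [h1, star_sum, Finset.sum_mul, map_sum,
    coef_onCircle_mul (N := max (q.natDegree + 1) (a + 1)) (by omega),
    ← Finset.sum_subset (Finset.range_mono (le_max_right (q.natDegree + 1) (a + 1))),
    ← Finset.sum_range_reflect]
  · refine Finset.sum_congr rfl fun k hk => ?_
    rw [Finset.mem_range] at hk
    rw [h2, show a - (a + 1 - 1 - k) = k by omega]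
    congr 3
    omega
  · intro j _ hj
    rw [Finset.mem_range] at hj
    rw [hu _ (by omega), mul_zero]

section Inertia

variable {n : ℕ}

/-- The analytic part of `P^* c` on the circle, for the polynomial vector with coefficients `c`. -/
def toeplitzVec (P : Matrix ρ ρ ℂ[X]) (c : Fin n × ρ → ℂ) (i : ρ) : ℂ[X] :=
  ∑ β : Fin n × ρ, C (c β) * toeplitzPoly (P β.2 i) β.1

/-- The inner product of two vectors of functions on the circle. -/
def circleInner (u v : ρ → CircleFun) : ℂ := coef 0 (star u ⬝ᵥ v)

lemma conj_circleInner (u v : ρ → CircleFun) : conj (circleInner u v) = circleInner v u := by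
  have h : star (star u ⬝ᵥ v) = star v ⬝ᵥ u := by simp [dotProduct, mul_comm]
  have h0 := coef_star 0 (star u ⬝ᵥ v)
  rw [h, neg_zero] at h0
  exact h0.symm

lemma circleInner_add (u v : ρ → CircleFun) : circleInner (u + v) (u + v) =
    circleInner u u + circleInner u v + circleInner v u + circleInner v v := by
  simp only [circleInner, star_add, add_dotProduct, dotProduct_add, map_add]
  ring

lemma circleInner_sub (u v : ρ → CircleFun) : circleInner (u - v) (u - v) =
    circleInner u u - circleInner u v - circleInner v u + circleInner v v := by
  simp only [circleInner, star_sub, sub_dotProduct, dotProduct_sub, map_sub]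
  ring

lemma re_circleInner_self_nonneg (u : ρ → CircleFun) : 0 ≤ (circleInner u u).re := by
  refine re_coef_zero_nonneg fun t => ?_
  have h : (star u ⬝ᵥ u) t = ∑ i, ((‖u i t‖ ^ 2 : ℝ) : ℂ) := by
    change evalCircle t _ = _
    simp only [dotProduct, map_sum, map_mul, Pi.star_apply, map_star, evalCircle_apply]
    refine Finset.sum_congr rfl fun i _ => ?_
    rw [Complex.ofReal_pow, ← Complex.conj_mul']
    rfl
  rw [h, ← Complex.ofReal_sum, Complex.ofReal_re]
  positivity

/-- `toeplitzVec P` is the adjoint of the map taking an analytic `u` to the first `n` coefficients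
of `P u`. -/
lemma circleInner_toeplitzVec (P : Matrix ρ ρ ℂ[X]) (c : Fin n × ρ → ℂ) {u : ρ → CircleFun}
    (hu : ∀ i, IsAnalyticFun (u i)) :
    circleInner (fun i => onCircle (toeplitzVec P c i)) u =
      ∑ β : Fin n × ρ, conj (c β) * coef (β.1 : ℕ) ((P.map onCircle *ᵥ u) β.2) := by
  have h1 : ∀ i, coef 0 (star (onCircle (toeplitzVec P c i)) * u i) =
      ∑ β : Fin n × ρ, conj (c β) * coef (β.1 : ℕ) (onCircle (P β.2 i) * u i) := by
    intro i
    rw [toeplitzVec, map_sum, star_sum, Finset.sum_mul, map_sum]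
    refine Finset.sum_congr rfl fun β _ => ?_
    have h : star (onCircle (C (c β) * toeplitzPoly (P β.2 i) β.1)) * u i =
        conj (c β) • (star (onCircle (toeplitzPoly (P β.2 i) β.1)) * u i) := by
      ext t
      simp [onCircle_apply, mul_assoc]
    rw [← coef_star_toeplitzPoly_mul _ _ (hu i), h, map_smul, smul_eq_mul]
  rw [circleInner, dotProduct, map_sum]
  simp only [Pi.star_apply, h1]
  rw [Finset.sum_comm]
  refine Finset.sum_congr rfl fun β _ => ?_
  rw [mulVec, dotProduct, map_sum, Finset.mul_sum]
  rfl

/-- The truncated sums in `P *ᵥ toeplitzVec P c` are the diagonal sums defining the Bezoutian, which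
is thus a difference of two Toeplitz products. The vanishing hypothesis disposes of the coefficients
from degree `n` on. -/
lemma mulVec_toeplitzVec_sub {P Q : Matrix ρ ρ ℂ[X]}
    (hvan : ∀ (b c : ρ) (x y : ℕ), n ≤ x ∨ n ≤ y → diagSum (kernelCoef P Q b c) x y = 0)
    (c : Fin n × ρ → ℂ) :
    P *ᵥ toeplitzVec P c - Q *ᵥ toeplitzVec Q c = polyVec (bezoutian n P Q *ᵥ c) := by
  have h1 : ∀ (R : Matrix ρ ρ ℂ[X]) (b : ρ) (x : ℕ), ((R *ᵥ toeplitzVec R c) b).coeff x =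
      ∑ β : Fin n × ρ, c β * ∑ k ∈ Finset.range (min x β.1 + 1),
        ∑ i, (R b i).coeff (x - k) * conj ((R β.2 i).coeff (β.1 - k)) := by
    intro R b x
    have h : ∀ (i : ρ) (β : Fin n × ρ), (R b i * (C (c β) * toeplitzPoly (R β.2 i) β.1)).coeff x =
        c β * ∑ k ∈ Finset.range (min x β.1 + 1),
          (R b i).coeff (x - k) * conj ((R β.2 i).coeff (β.1 - k)) := by
      intro i β
      rw [mul_left_comm, coeff_C_mul, coeff_mul_toeplitzPoly]
    simp only [mulVec, dotProduct, toeplitzVec, Finset.mul_sum, finsetSum_coeff, h]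
    rw [Finset.sum_comm]
    refine Finset.sum_congr rfl fun β _ => ?_
    rw [Finset.sum_comm]
  ext b x
  rw [Pi.sub_apply, coeff_sub, h1, h1, ← Finset.sum_sub_distrib, coeff_polyVec]
  have h2 : ∀ β : Fin n × ρ, c β * ∑ k ∈ Finset.range (min x β.1 + 1),
        ∑ i, (P b i).coeff (x - k) * conj ((P β.2 i).coeff (β.1 - k)) -
      c β * ∑ k ∈ Finset.range (min x β.1 + 1),
        ∑ i, (Q b i).coeff (x - k) * conj ((Q β.2 i).coeff (β.1 - k)) =
      diagSum (kernelCoef P Q b β.2) x β.1 * c β := by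
    intro β
    rw [← mul_sub, ← Finset.sum_sub_distrib, mul_comm]
    rfl
  simp only [h2]
  split_ifs with h
  · rfl
  · exact Finset.sum_eq_zero fun β _ => by rw [hvan _ _ _ _ (Or.inl (not_lt.1 h)), zero_mul]

variable {P Q : Matrix ρ ρ ℂ[X]}

lemma form_eq_circleInner_sub
    (hvan : ∀ (b c : ρ) (x y : ℕ), n ≤ x ∨ n ≤ y → diagSum (kernelCoef P Q b c) x y = 0)
    (c : Fin n × ρ → ℂ) :
    star c ⬝ᵥ bezoutian n P Q *ᵥ c =
      circleInner (fun i => onCircle (toeplitzVec P c i)) (fun i => onCircle (toeplitzVec P c i)) -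
      circleInner (fun i => onCircle (toeplitzVec Q c i))
        (fun i => onCircle (toeplitzVec Q c i)) := by
  rw [circleInner_toeplitzVec _ _ fun i => isAnalyticFun_onCircle _,
    circleInner_toeplitzVec _ _ fun i => isAnalyticFun_onCircle _, ← Finset.sum_sub_distrib]
  refine Finset.sum_congr rfl fun β _ => ?_
  have h1 : ∀ R : Matrix ρ ρ ℂ[X], (R.map onCircle *ᵥ fun i => onCircle (toeplitzVec R c i)) β.2 =
      onCircle ((R *ᵥ toeplitzVec R c) β.2) := by
    intro R
    simp [mulVec, dotProduct]
  rw [← mul_sub, h1, h1, ← map_sub, ← map_sub, ← Pi.sub_apply, mulVec_toeplitzVec_sub hvan,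
    coef_onCircle_natCast, coeff_polyVec, dif_pos β.1.2]
  rfl

lemma mulVec_onCircle_sub
    (hvan : ∀ (b c : ρ) (x y : ℕ), n ≤ x ∨ n ≤ y → diagSum (kernelCoef P Q b c) x y = 0)
    (c : Fin n × ρ → ℂ) :
    (P.map onCircle *ᵥ fun i => onCircle (toeplitzVec P c i)) -
      (Q.map onCircle *ᵥ fun i => onCircle (toeplitzVec Q c i)) =
      fun b => onCircle (polyVec (bezoutian n P Q *ᵥ c) b) := by
  rw [← mulVec_toeplitzVec_sub hvan]
  ext1 b
  simp [mulVec, dotProduct]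

lemma sum_conj_mul_coef_polyVec (c d : Fin n × ρ → ℂ) :
    ∑ β : Fin n × ρ, conj (c β) * coef (β.1 : ℕ) (onCircle (polyVec d β.2)) = star c ⬝ᵥ d := by
  refine Finset.sum_congr rfl fun β _ => ?_
  rw [coef_onCircle_natCast, coeff_polyVec, dif_pos β.1.2]
  rfl

variable [DecidableEq ρ]

/-- `x = P⁻¹ Q y`, and `P⁻¹ Q` is unitary on the circle because `P P^* = Q Q^*`. -/
lemma circleInner_eq_of_mulVec_eq {P Q R : Matrix ρ ρ CircleFun} (hR : R * P = 1)
    (hPQ : P * Pᴴ = Q * Qᴴ) {x y : ρ → CircleFun} (hxy : P *ᵥ x = Q *ᵥ y) :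
    circleInner x x = circleInner y y := by
  have hx : x = (R * Q) *ᵥ y := by
    rw [← Matrix.mulVec_mulVec, ← hxy, Matrix.mulVec_mulVec, hR, Matrix.one_mulVec]
  have hPR : Pᴴ * Rᴴ = 1 := by
    have h := congrArg conjTranspose hR
    rwa [conjTranspose_mul, conjTranspose_one] at h
  have hU : (R * Q) * (R * Q)ᴴ = 1 := by
    calc (R * Q) * (R * Q)ᴴ = R * (Q * Qᴴ) * Rᴴ := by
          rw [conjTranspose_mul]; simp only [mul_assoc]
      _ = (R * P) * (Pᴴ * Rᴴ) := by rw [← hPQ]; simp only [mul_assoc]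
      _ = 1 := by rw [hR, hPR, one_mul]
  rw [circleInner, circleInner, hx, star_mulVec, ← dotProduct_mulVec, Matrix.mulVec_mulVec,
    mul_eq_one_comm.1 hU, Matrix.one_mulVec]

variable {R : Matrix ρ ρ CircleFun}

/-- Let `s` be the value of the form and `x`, `y` the Toeplitz vectors, so `s = ‖x‖² - ‖y‖²` and `P
x - Q y = P g`. Then `P (x - g) = Q y` gives `‖x - g‖ = ‖y‖`, and `⟨x, g⟩ = s` because `g` is
analytic. Expanding the norm leaves `conj s = ‖g‖²`. -/
lemma form_nonneg_of_mulVec_eq (hR : R * P.map onCircle = 1)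
    (hPQ : P.map onCircle * (P.map onCircle)ᴴ = Q.map onCircle * (Q.map onCircle)ᴴ)
    (hvan : ∀ (b c : ρ) (x y : ℕ), n ≤ x ∨ n ≤ y → diagSum (kernelCoef P Q b c) x y = 0)
    {c : Fin n × ρ → ℂ} {g : ρ → CircleFun} (hg : ∀ i, IsAnalyticFun (g i))
    (hPg : P.map onCircle *ᵥ g = fun b => onCircle (polyVec (bezoutian n P Q *ᵥ c) b)) :
    0 ≤ (star c ⬝ᵥ bezoutian n P Q *ᵥ c).re := by
  have h1 := form_eq_circleInner_sub hvan c
  have h2 := mulVec_onCircle_sub hvan c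
  have h3 := circleInner_toeplitzVec P c hg
  rw [hPg, sum_conj_mul_coef_polyVec] at h3
  set x := fun i => onCircle (toeplitzVec P c i)
  set y := fun i => onCircle (toeplitzVec Q c i)
  have h4 := circleInner_eq_of_mulVec_eq hR hPQ (x := x - g) (y := y) (by
    rw [Matrix.mulVec_sub, hPg, ← h2, sub_sub_cancel])
  rw [circleInner_sub, ← conj_circleInner x g, h3] at h4
  have h5 : conj (star c ⬝ᵥ bezoutian n P Q *ᵥ c) = circleInner g g := by
    linear_combination -h4 - h1
  rw [← Complex.conj_re, h5]
  exact re_circleInner_self_nonneg g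

/-- Here `P x = Q (g + y)`, so `‖g + y‖ = ‖x‖`, and `⟨y, g⟩` is the form; expanding shows that the
form is `-‖g‖²` up to conjugation. -/
lemma form_nonpos_of_mulVec_eq (hR : R * Q.map onCircle = 1)
    (hPQ : P.map onCircle * (P.map onCircle)ᴴ = Q.map onCircle * (Q.map onCircle)ᴴ)
    (hvan : ∀ (b c : ρ) (x y : ℕ), n ≤ x ∨ n ≤ y → diagSum (kernelCoef P Q b c) x y = 0)
    {c : Fin n × ρ → ℂ} {g : ρ → CircleFun} (hg : ∀ i, IsAnalyticFun (g i))
    (hQg : Q.map onCircle *ᵥ g = fun b => onCircle (polyVec (bezoutian n P Q *ᵥ c) b)) :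
    (star c ⬝ᵥ bezoutian n P Q *ᵥ c).re ≤ 0 := by
  have h1 := form_eq_circleInner_sub hvan c
  have h2 := mulVec_onCircle_sub hvan c
  have h3 := circleInner_toeplitzVec Q c hg
  rw [hQg, sum_conj_mul_coef_polyVec] at h3
  set x := fun i => onCircle (toeplitzVec P c i)
  set y := fun i => onCircle (toeplitzVec Q c i)
  have h4 := circleInner_eq_of_mulVec_eq hR hPQ.symm (x := g + y) (y := x) (by
    rw [Matrix.mulVec_add, hQg, ← h2, sub_add_cancel])
  rw [circleInner_add, ← conj_circleInner y g, h3] at h4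
  have h5 : conj (star c ⬝ᵥ bezoutian n P Q *ᵥ c) = -circleInner g g := by
    linear_combination h4 - h1
  rw [← Complex.conj_re, h5, Complex.neg_re]
  exact neg_nonpos.2 (re_circleInner_self_nonneg g)

end Inertia

end BiPoly

end

/-! ### Numbers of squares of a Hermitian form and their stability -/

noncomputable section

namespace BiPoly

open Matrix

variable {ι κ : Type*} [Fintype ι] [Fintype κ]

lemma norm_form_le (A : Matrix ι ι ℂ) (v : ι → ℂ) :
    ‖star v ⬝ᵥ A *ᵥ v‖ ≤ (∑ i, ∑ j, ‖A i j‖) * ∑ k, ‖v k‖ ^ 2 := by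
  have h1 : ∀ i, ‖v i‖ ^ 2 ≤ ∑ k, ‖v k‖ ^ 2 := fun i =>
    Finset.single_le_sum (f := fun k => ‖v k‖ ^ 2) (fun _ _ => sq_nonneg _) (Finset.mem_univ i)
  have h2 : ∀ i j, ‖v i‖ * ‖v j‖ ≤ ∑ k, ‖v k‖ ^ 2 := fun i j => by
    nlinarith [h1 i, h1 j, sq_nonneg (‖v i‖ - ‖v j‖)]
  rw [dotProduct, Finset.sum_mul]
  refine (norm_sum_le _ _).trans (Finset.sum_le_sum fun i _ => ?_)
  rw [norm_mul, Pi.star_apply, norm_star, mulVec, dotProduct, Finset.sum_mul]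
  refine (mul_le_mul_of_nonneg_left (norm_sum_le _ _) (norm_nonneg _)).trans ?_
  rw [Finset.mul_sum]
  refine Finset.sum_le_sum fun j _ => ?_
  rw [norm_mul]
  calc ‖v i‖ * (‖A i j‖ * ‖v j‖) = ‖A i j‖ * (‖v i‖ * ‖v j‖) := by ring
    _ ≤ _ := mul_le_mul_of_nonneg_left (h2 i j) (norm_nonneg _)

/-- If `H` is negative on the span of an orthonormal family of eigenvectors, then a matrix close
to `H` cannot be nonnegative on a subspace of small codimension. -/
lemma exists_card_le_of_neg [DecidableEq κ] {H : Matrix ι ι ℂ} {u : κ → ι → ℂ} {μ : κ → ℝ}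
    (hu : ∀ i j, star (u i) ⬝ᵥ u j = if i = j then 1 else 0)
    (hH : ∀ i, H *ᵥ u i = (μ i : ℂ) • u i) (hμ : ∀ i, μ i < 0) :
    ∃ ε > 0, ∀ H' : Matrix ι ι ℂ, (∑ i, ∑ j, ‖H' i j - H i j‖) < ε →
      ∀ (k : ℕ) (L : (ι → ℂ) →ₗ[ℂ] (Fin k → ℂ)),
        (∀ c, L c = 0 → 0 ≤ (star c ⬝ᵥ H' *ᵥ c).re) → Fintype.card κ ≤ k := by
  rcases isEmpty_or_nonempty κ with hκ | hκ
  · exact ⟨1, one_pos, fun _ _ k _ _ => by simp⟩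
  obtain ⟨i₀, -, hi₀⟩ := Finset.exists_max_image Finset.univ μ Finset.univ_nonempty
  -- On the span of the `u i` the form of `H` is at most `μ i₀ ‖·‖²` with `μ i₀` the largest
  -- eigenvalue used, so a perturbation smaller than `-μ i₀` leaves it negative there.
  refine ⟨-μ i₀, neg_pos.2 (hμ i₀), fun H' hH' k L hL => ?_⟩
  by_contra hk
  rw [not_le] at hk
  let V : (κ → ℂ) →ₗ[ℂ] (ι → ℂ) := Fintype.linearCombination ℂ u
  -- Fewer than `card κ` conditions leave a nonzero vector of the span, on which the form of `H'` is
  -- both nonnegative and negative.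
  obtain ⟨x, hx, hx0⟩ : ∃ x ∈ LinearMap.ker (L ∘ₗ V), x ≠ 0 := by
    rw [← Submodule.ne_bot_iff]
    refine LinearMap.ker_ne_bot_of_finrank_lt ?_
    simpa using hk
  have hV : V x = ∑ i, x i • u i := Fintype.linearCombination_apply _ _ _
  have hortho : ∀ y : κ → ℂ, star (V x) ⬝ᵥ (∑ i, y i • u i) = ∑ i, conj (x i) * y i := by
    intro y
    simp only [hV, star_sum, sum_dotProduct, dotProduct_sum, star_smul, smul_dotProduct,
      dotProduct_smul, hu, smul_eq_mul, mul_ite, mul_one, mul_zero, Finset.sum_ite_eq',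
      Finset.mem_univ, if_true]
    exact Finset.sum_congr rfl fun i _ => mul_comm _ _
  have hnorm : ∑ k, ‖V x k‖ ^ 2 = ∑ i, ‖x i‖ ^ 2 := by
    have h := hortho x
    rw [← hV] at h
    have h1 : ∀ {σ : Type _} [Fintype σ] (y : σ → ℂ),
        ∑ i, conj (y i) * y i = ((∑ i, ‖y i‖ ^ 2 : ℝ) : ℂ) := by
      intro σ _ y
      push_cast
      exact Finset.sum_congr rfl fun i _ => Complex.conj_mul' _
    rw [h1] at h
    have h2 : star (V x) ⬝ᵥ V x = ((∑ i, ‖V x i‖ ^ 2 : ℝ) : ℂ) := by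
      push_cast
      exact Finset.sum_congr rfl fun i _ => Complex.conj_mul' _
    rw [h2] at h
    exact_mod_cast h
  have hform : (star (V x) ⬝ᵥ H *ᵥ V x).re ≤ μ i₀ * ∑ i, ‖x i‖ ^ 2 := by
    have h1 : H *ᵥ V x = ∑ i, (x i * μ i) • u i := by
      rw [hV, Matrix.mulVec_sum]
      refine Finset.sum_congr rfl fun i _ => ?_
      rw [Matrix.mulVec_smul, hH, smul_smul]
    rw [h1, hortho, Complex.re_sum, Finset.mul_sum]
    refine Finset.sum_le_sum fun i _ => ?_
    rw [← mul_assoc, Complex.conj_mul', ← Complex.ofReal_pow, ← Complex.ofReal_mul,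
      Complex.ofReal_re, mul_comm]
    exact mul_le_mul_of_nonneg_right (hi₀ i (Finset.mem_univ i)) (sq_nonneg _)
  have hpos : 0 < ∑ i, ‖x i‖ ^ 2 := by
    obtain ⟨i, hi⟩ := Function.ne_iff.1 hx0
    exact Finset.sum_pos' (fun _ _ => sq_nonneg _)
      ⟨i, Finset.mem_univ i, pow_pos (norm_pos_iff.2 hi) 2⟩
  have hdiff : (star (V x) ⬝ᵥ H' *ᵥ V x).re - (star (V x) ⬝ᵥ H *ᵥ V x).re ≤
      (∑ i, ∑ j, ‖H' i j - H i j‖) * ∑ i, ‖x i‖ ^ 2 := by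
    rw [← hnorm, ← Complex.sub_re, ← dotProduct_sub, ← Matrix.sub_mulVec]
    exact (Complex.re_le_norm _).trans (norm_form_le _ _)
  have h0 := hL (V x) hx
  nlinarith

/-- Decomposition of a Hermitian form into squares, with numbers of squares that are bounded by
the inertia of the nearby forms. -/
theorem exists_signature [DecidableEq ι] {H : Matrix ι ι ℂ} (hH : H.IsHermitian) :
    ∃ (k₁ k₂ : ℕ) (A : Fin k₁ → ι → ℂ) (B : Fin k₂ → ι → ℂ),
      LinearIndependent ℂ (Sum.elim A B) ∧
      (∀ i j, H i j = ∑ l, A l i * conj (A l j) - ∑ l, B l i * conj (B l j)) ∧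
      ∃ ε > 0, ∀ H' : Matrix ι ι ℂ, (∑ i, ∑ j, ‖H' i j - H i j‖) < ε →
        ∀ k : ℕ,
          (∀ L : (ι → ℂ) →ₗ[ℂ] (Fin k → ℂ),
            (∀ c, L c = 0 → 0 ≤ (star c ⬝ᵥ H' *ᵥ c).re) → k₂ ≤ k) ∧
          (∀ L : (ι → ℂ) →ₗ[ℂ] (Fin k → ℂ),
            (∀ c, L c = 0 → (star c ⬝ᵥ H' *ᵥ c).re ≤ 0) → k₁ ≤ k) := by
  set μ := hH.eigenvalues with hμ
  set u : ι → ι → ℂ := fun i => hH.eigenvectorBasis i with hu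
  have hortho : ∀ i j, star (u i) ⬝ᵥ u j = if i = j then 1 else 0 := by
    intro i j
    have h := orthonormal_iff_ite.1 hH.eigenvectorBasis.orthonormal i j
    rw [EuclideanSpace.inner_eq_star_dotProduct, dotProduct_comm] at h
    exact h
  have heig : ∀ i, H *ᵥ u i = (μ i : ℂ) • u i := fun i => by
    rw [hu, hμ]
    simpa using hH.mulVec_eigenvectorBasis i
  have hli : LinearIndependent ℂ u := by
    have h := hH.eigenvectorBasis.toBasis.linearIndependent
    have h2 := h.map' (WithLp.linearEquiv 2 ℂ (ι → ℂ)).toLinearMap (LinearEquiv.ker _)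
    have h3 : (WithLp.linearEquiv 2 ℂ (ι → ℂ)).toLinearMap ∘ hH.eigenvectorBasis.toBasis = u := by
      ext i j
      simp [hu]
    rwa [h3] at h2
  have hsum : ∀ i j, H i j = ∑ l, (μ l : ℂ) * (u l i * conj (u l j)) := by
    set U : Matrix ι ι ℂ := fun i l => u l i with hU
    have h1 : Uᴴ * U = 1 := by
      ext i j
      rw [mul_apply, one_apply, ← hortho]
      rfl
    have h2 : ∀ i l, (H * U) i l = (μ l : ℂ) * u l i := by
      intro i l
      exact congrFun (heig l) i
    have h3 : H = (H * U) * Uᴴ := by rw [mul_assoc, mul_eq_one_comm.1 h1, mul_one]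
    intro i j
    rw [h3, mul_apply]
    exact Finset.sum_congr rfl fun l _ => by rw [h2, conjTranspose_apply, ← mul_assoc]; rfl
  let e₁ : {i // 0 < μ i} ≃ Fin (Fintype.card {i // 0 < μ i}) := Fintype.equivFin _
  let e₂ : {i // μ i < 0} ≃ Fin (Fintype.card {i // μ i < 0}) := Fintype.equivFin _
  refine ⟨_, _, fun l => ((Real.sqrt (μ (e₁.symm l)) : ℝ) : ℂ) • u (e₁.symm l),
    fun l => ((Real.sqrt (-μ (e₂.symm l)) : ℝ) : ℂ) • u (e₂.symm l), ?_, ?_, ?_⟩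
  · set e : Fin _ ⊕ Fin _ → ι := Sum.elim (fun l => (e₁.symm l : ι)) fun l => (e₂.symm l : ι)
      with he
    have he_inj : Function.Injective e := by
      refine Function.Injective.sumElim (Subtype.val_injective.comp e₁.symm.injective)
        (Subtype.val_injective.comp e₂.symm.injective) fun a b hab => ?_
      have h1 := (e₁.symm a).2
      have h2 := (e₂.symm b).2
      rw [hab] at h1
      exact lt_asymm h1 h2
    let w : Fin _ ⊕ Fin _ → ℂˣ := Sum.elim
      (fun l => Units.mk0 ((Real.sqrt (μ (e₁.symm l)) : ℝ) : ℂ)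
        (Complex.ofReal_ne_zero.2 (Real.sqrt_pos.2 (e₁.symm l).2).ne'))
      (fun l => Units.mk0 ((Real.sqrt (-μ (e₂.symm l)) : ℝ) : ℂ)
        (Complex.ofReal_ne_zero.2 (Real.sqrt_pos.2 (neg_pos.2 (e₂.symm l).2)).ne'))
    convert (hli.comp e he_inj).units_smul w using 1
    ext1 l
    rcases l with l | l <;> rfl
  · intro i j
    have hsq : ∀ (r : ℝ) (x y : ℂ), 0 ≤ r →
        (Real.sqrt r : ℂ) * x * conj ((Real.sqrt r : ℂ) * y) = (r : ℂ) * (x * conj y) := by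
      intro r x y hr
      rw [map_mul, Complex.conj_ofReal]
      have : (Real.sqrt r : ℂ) * Real.sqrt r = r := by
        rw [← Complex.ofReal_mul, Real.mul_self_sqrt hr]
      linear_combination x * conj y * this
    have h1 : ∑ l : Fin _, ((Real.sqrt (μ (e₁.symm l)) : ℂ) • u (e₁.symm l)) i *
        conj (((Real.sqrt (μ (e₁.symm l)) : ℂ) • u (e₁.symm l)) j) =
        ∑ l, if 0 < μ l then (μ l : ℂ) * (u l i * conj (u l j)) else 0 := by
      rw [← Finset.sum_filter, ← Finset.sum_subtype_eq_sum_filter, Finset.subtype_univ,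
        ← e₁.symm.sum_comp]
      exact Finset.sum_congr rfl fun l _ => hsq _ _ _ (e₁.symm l).2.le
    have h2 : ∑ l : Fin _, ((Real.sqrt (-μ (e₂.symm l)) : ℂ) • u (e₂.symm l)) i *
        conj (((Real.sqrt (-μ (e₂.symm l)) : ℂ) • u (e₂.symm l)) j) =
        ∑ l, if μ l < 0 then (-μ l : ℝ) * (u l i * conj (u l j)) else 0 := by
      rw [← Finset.sum_filter, ← Finset.sum_subtype_eq_sum_filter, Finset.subtype_univ,
        ← e₂.symm.sum_comp]
      exact Finset.sum_congr rfl fun l _ => hsq _ _ _ (neg_nonneg.2 (e₂.symm l).2.le)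
    rw [h1, h2, hsum, ← Finset.sum_sub_distrib]
    refine Finset.sum_congr rfl fun l _ => ?_
    rcases lt_trichotomy (μ l) 0 with h | h | h
    · rw [if_neg h.not_gt, if_pos h]
      push_cast
      ring
    · simp [h]
    · rw [if_pos h, if_neg h.not_gt, sub_zero]
  · obtain ⟨ε₁, hε₁, h₁⟩ := exists_card_le_of_neg (H := -H)
      (u := fun i : {i // 0 < μ i} => u i) (μ := fun i => -μ i)
      (fun i j => by simp [hortho, Subtype.ext_iff])
      (fun i => by rw [Matrix.neg_mulVec, heig]; simp) (fun i => neg_neg_of_pos i.2)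
    obtain ⟨ε₂, hε₂, h₂⟩ := exists_card_le_of_neg (H := H)
      (u := fun i : {i // μ i < 0} => u i) (μ := fun i => μ i)
      (fun i j => by simp [hortho, Subtype.ext_iff]) (fun i => heig i) (fun i => i.2)
    refine ⟨min ε₁ ε₂, lt_min hε₁ hε₂, fun H' hH' k => ⟨fun L hL => ?_, fun L hL => ?_⟩⟩
    · exact h₂ H' (hH'.trans_le (min_le_right _ _)) k L hL
    · refine h₁ (-H') ?_ k L fun c hc => ?_
      · refine lt_of_eq_of_lt ?_ (hH'.trans_le (min_le_left _ _))
        simp only [Matrix.neg_apply, ← neg_sub', norm_neg]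
      · rw [Matrix.neg_mulVec, dotProduct_neg, Complex.neg_re]
        exact neg_nonneg.2 (hL c hc)

end BiPoly

end

/-! ### The spectral factor and the inertia bounds for strictly zero-free `p` -/

noncomputable section

namespace BiPoly

open Polynomial Matrix Filter Topology

variable {m n n₁ n₂ : ℕ}

/-- Solution of a linear system with one pivot row and an outer matrix `E` in the other rows. -/
lemma exists_pivot_solution {E : Matrix (Fin m) (Fin m) ℂ[X]} {F : Matrix (Fin m) (Fin m) CircleFun}
    (hFE : F * E.map onCircle = 1) (hF : ∀ i j, IsAnalyticFun (F i j)) {π : ℂ[X]}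
    (hπ : ∀ z : ℂ, ‖z‖ = 1 → π.eval z ≠ 0) (r : Fin m → ℂ[X]) (f₀ : CircleFun)
    (f : Fin m → CircleFun) :
    ∃ (g₀ : CircleFun) (g : Fin m → CircleFun), onCircle π * g₀ = f₀ ∧
      (∀ b, onCircle (r b) * g₀ + ∑ j, onCircle (E b j) * g j = f b) ∧
      ∀ (a o q : ℂ[X]) (s : Fin m → ℂ[X]), π = a * o → (∀ z : ℂ, ‖z‖ ≤ 1 → o.eval z ≠ 0) →
        f₀ = onCircle (a * q) → (∀ b, f b = onCircle (s b)) →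
        IsAnalyticFun g₀ ∧ ∀ j, IsAnalyticFun (g j) := by
  obtain ⟨u, hu⟩ := isUnit_onCircle hπ
  have h₀ : onCircle π * (↑u⁻¹ * f₀) = f₀ := by rw [← hu, Units.mul_inv_cancel_left]
  -- The pivot row gives `g₀ = f₀ / π`; the other unknowns are `F` applied to what remains of the
  -- right hand side.
  refine ⟨↑u⁻¹ * f₀, F *ᵥ fun b => f b - onCircle (r b) * (↑u⁻¹ * f₀), h₀, fun b => ?_, ?_⟩
  · have h1 : (E.map onCircle *ᵥ (F *ᵥ fun b => f b - onCircle (r b) * (↑u⁻¹ * f₀))) b =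
        f b - onCircle (r b) * (↑u⁻¹ * f₀) := by
      rw [Matrix.mulVec_mulVec, mul_eq_one_comm.1 hFE, Matrix.one_mulVec]
    change _ + (E.map onCircle *ᵥ (F *ᵥ fun b => f b - onCircle (r b) * (↑u⁻¹ * f₀))) b = _
    rw [h1, add_sub_cancel]
  · intro a o q s hao ho hf₀ hf
    have ha : IsUnit (onCircle a) := isUnit_onCircle fun z hz h => hπ z hz (by simp [hao, h])
    have hog : onCircle o * (↑u⁻¹ * f₀) = onCircle q := by
      refine ha.mul_left_cancel ?_
      rw [← mul_assoc, ← map_mul, ← hao, h₀, hf₀, map_mul]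
    refine ⟨IsAnalyticFun.of_onCircle_mul ho (by rw [hog]; exact isAnalyticFun_onCircle q),
      fun j => IsAnalyticFun.of_onCircle_mul ho ?_⟩
    rw [mulVec, dotProduct, Finset.mul_sum]
    refine isAnalyticFun_sum _ fun b _ => ?_
    -- Cancelling `a` gives `o g₀ = q`. After multiplication by `o` every term is a polynomial times
    -- an entry of `F`, hence analytic, and `o` can be divided out.
    have h2 : onCircle o * (F j b * (f b - onCircle (r b) * (↑u⁻¹ * f₀))) =
        onCircle (o * s b - r b * q) * F j b := by
      rw [map_sub, map_mul, map_mul, hf, ← hog]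
      ring
    rw [h2]
    exact (hF j b).onCircle_mul _

lemma coeff_reflectSeq {p : ℕ → ℂ[X]} (hp : ∀ b, (p b).natDegree ≤ n) (b x : ℕ) :
    (reflectSeq n m p b).coeff x =
      if b ≤ m then if x ≤ n then conj ((p (m - b)).coeff (n - x)) else 0 else 0 := by
  rw [reflectSeq]
  split_ifs with h1 h2
  · rw [coeff_conjReflect (hp _), if_pos h2]
  · rw [coeff_conjReflect (hp _), if_neg h2]
  · simp

lemma natDegree_reflectSeq_le {p : ℕ → ℂ[X]} (hp : ∀ b, (p b).natDegree ≤ n) (b : ℕ) :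
    (reflectSeq n m p b).natDegree ≤ n := by
  rw [natDegree_le_iff_coeff_eq_zero]
  intro x hx
  rw [coeff_reflectSeq hp, if_neg (by omega : ¬ x ≤ n), ite_self]

lemma natDegree_lowerMat_le {p : ℕ → ℂ[X]} (hp : ∀ b, (p b).natDegree ≤ n)
    {E : Matrix (Fin m) (Fin m) ℂ[X]} (hE : ∀ i j, (E i j).natDegree ≤ n) (b i : Fin (m + 1)) :
    (lowerMat p E b i).natDegree ≤ n := by
  refine Fin.cases ?_ (fun i => ?_) i
  · exact hp _
  · refine Fin.cases ?_ (fun b => ?_) b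
    · simp
    · exact hE _ _

lemma natDegree_upperMat_le {p : ℕ → ℂ[X]} (hp : ∀ b, (p b).natDegree ≤ n)
    {E : Matrix (Fin m) (Fin m) ℂ[X]} (hE : ∀ i j, (E i j).natDegree ≤ n) (b i : Fin (m + 1)) :
    (upperMat p E b i).natDegree ≤ n := by
  refine Fin.cases ?_ (fun i => ?_) i
  · exact hp _
  · refine Fin.lastCases ?_ (fun b => ?_) b
    · simp
    · simpa using hE _ _

/-- A diagonal entry of `E E^*` is a sum of terms `|p_k|² - |p_{m-k}|²`, so dropping the negative
parts bounds each row of `E` on the circle. The bound depends only on `p`, which is what the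
limiting argument needs. -/
lemma norm_coeff_le_of_gram {p : ℕ → ℂ[X]} {E : Matrix (Fin m) (Fin m) ℂ[X]}
    (hE : E.map onCircle * (E.map onCircle)ᴴ = schurMat m p) (b j : Fin m) (x : ℕ) :
    ‖(E b j).coeff x‖ ^ 2 ≤ ∑ k ∈ Finset.range (m + 1), ‖onCircle (p k)‖ ^ 2 := by
  set M := ∑ k ∈ Finset.range (m + 1), ‖onCircle (p k)‖ ^ 2 with hM
  have hM0 : 0 ≤ M := Finset.sum_nonneg fun _ _ => sq_nonneg _
  have h1 : ‖onCircle (E b j)‖ ≤ Real.sqrt M := by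
    rw [ContinuousMap.norm_le _ (Real.sqrt_nonneg _)]
    intro t
    refine Real.le_sqrt_of_sq_le ?_
    have h2 := congrArg (evalCircle t) (congrFun (congrFun hE b) b)
    rw [mul_apply, map_sum, schurMat, diagSum, map_sum] at h2
    have h3 : ∀ f : CircleFun, evalCircle t (f * star f) = ((‖f t‖ ^ 2 : ℝ) : ℂ) := by
      intro f
      rw [map_mul, map_star, Complex.ofReal_pow, ← Complex.mul_conj']
      rfl
    simp only [map_apply, conjTranspose_apply, schurKernel, map_sub, h3] at h2
    have h4 : ∑ i, ‖onCircle (E b i) t‖ ^ 2 =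
        ∑ k ∈ Finset.range (min (b : ℕ) b + 1), (‖onCircle (p (b - k)) t‖ ^ 2 -
          ‖revStar m (fun b => onCircle (p b)) (b - k) t‖ ^ 2) := by
      exact_mod_cast h2
    calc ‖onCircle (E b j) t‖ ^ 2 ≤ ∑ i, ‖onCircle (E b i) t‖ ^ 2 :=
          Finset.single_le_sum (f := fun i => ‖onCircle (E b i) t‖ ^ 2)
            (fun _ _ => sq_nonneg _) (Finset.mem_univ j)
      _ ≤ ∑ k ∈ Finset.range ((b : ℕ) + 1), ‖onCircle (p (b - k)) t‖ ^ 2 := by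
          rw [h4, min_self]
          exact Finset.sum_le_sum fun k _ => sub_le_self _ (sq_nonneg _)
      _ = ∑ k ∈ Finset.range ((b : ℕ) + 1), ‖onCircle (p k) t‖ ^ 2 := by
          rw [← Finset.sum_range_reflect]
          refine Finset.sum_congr rfl fun k hk => ?_
          rw [Finset.mem_range] at hk
          congr 5
          omega
      _ ≤ ∑ k ∈ Finset.range (m + 1), ‖onCircle (p k) t‖ ^ 2 :=
          Finset.sum_le_sum_of_subset_of_nonneg (Finset.range_mono (by omega))
            fun _ _ _ => sq_nonneg _
      _ ≤ M := Finset.sum_le_sum fun k _ =>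
          pow_le_pow_left₀ (norm_nonneg _) ((onCircle (p k)).norm_coe_le_norm t) 2
  have h2 : ‖(E b j).coeff x‖ ≤ Real.sqrt M := by
    rw [← coef_onCircle_natCast]
    exact (norm_coef_le _ _).trans h1
  calc ‖(E b j).coeff x‖ ^ 2 ≤ Real.sqrt M ^ 2 := pow_le_pow_left₀ (norm_nonneg _) h2 2
    _ = M := Real.sq_sqrt hM0

/-- The spectral factor of the Schur-Cohn matrix and the inertia of the Bezoutian, when `p` has no
zeros on the product of the circle and the closed disk. -/
theorem exists_factor_of_strict {p : ℕ → ℂ[X]} (hp : ∀ b, (p b).natDegree ≤ n)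
    (hpm : ∀ b, m < b → p b = 0)
    (hz : ∀ z w : ℂ, ‖z‖ = 1 → ‖w‖ ≤ 1 → ∑ b ∈ Finset.range (m + 1), (p b).eval z * w ^ b ≠ 0)
    (hn₂ : n₂ = zerosInDisk (p 0)) (hn : n₁ + n₂ = n) :
    ∃ E : Matrix (Fin m) (Fin m) ℂ[X], (∀ i j, (E i j).natDegree ≤ n) ∧
      (∀ i j x, ‖(E i j).coeff x‖ ^ 2 ≤ ∑ k ∈ Finset.range (m + 1), ‖onCircle (p k)‖ ^ 2) ∧
      (∀ b c x y, n ≤ x ∨ n ≤ y →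
        diagSum (kernelCoef (lowerMat p E) (upperMat (reflectSeq n m p) E) b c) x y = 0) ∧
      (∃ L : (Fin n × Fin (m + 1) → ℂ) →ₗ[ℂ] (Fin n₂ → ℂ), ∀ c, L c = 0 → 0 ≤ (star c ⬝ᵥ
        bezoutian n (lowerMat p E) (upperMat (reflectSeq n m p) E) *ᵥ c).re) ∧
      ∃ L : (Fin n × Fin (m + 1) → ℂ) →ₗ[ℂ] (Fin n₁ → ℂ), ∀ c, L c = 0 → (star c ⬝ᵥ
        bezoutian n (lowerMat p E) (upperMat (reflectSeq n m p) E) *ᵥ c).re ≤ 0 := by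
  obtain ⟨E, F, hE, hEE, hFE, hF⟩ :=
    exists_spectral_factor (posDef_schurMat hpm hz) (isTrigMatrix_schurMat (m := m) hp)
  set P := lowerMat p E with hP
  set Q := upperMat (reflectSeq n m p) E with hQ
  have hgram := schurMat_gram hp hpm hEE
  have hvan := diagSum_kernelCoef_eq_zero (natDegree_lowerMat_le hp hE)
    (natDegree_upperMat_le (natDegree_reflectSeq_le (m := m) hp) hE) hgram
  rw [← hP, ← hQ] at hgram hvan
  have hp0 : ∀ z : ℂ, ‖z‖ = 1 → (p 0).eval z ≠ 0 := fun z hz1 h => by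
    refine hz z 0 hz1 (by simp) ?_
    rw [Finset.sum_range_succ']
    simp [h]
  -- `a` collects the `n₂` zeros of `p_0` in the disk, `o` the remaining ones. The degree of `o` may
  -- be smaller than `n₁`, since `p_0` may have degree below `n`.
  obtain ⟨a, o, hao, ha, ha0, ho0, haz, hoz⟩ := exists_disk_factorization hp0
  rw [← hn₂] at ha
  have hod : o.natDegree ≤ n₁ := by
    have := hp 0
    rw [hao, natDegree_mul ha0 ho0, ha] at this
    omega
  have hrefl : reflectSeq n m p m = conjReflect n₁ o * conjReflect n₂ a := by
    rw [reflectSeq, if_pos le_rfl, Nat.sub_self, hao, ← hn, mul_comm, conjReflect_mul hod ha.le]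
  have hpm0 : ∀ z : ℂ, ‖z‖ = 1 → (reflectSeq n m p m).eval z ≠ 0 := fun z hz1 => by
    have hz0 : z ≠ 0 := by rintro rfl; simp at hz1
    rw [reflectSeq, if_pos le_rfl, Nat.sub_self, eval_conjReflect (hp 0) hz0]
    refine mul_ne_zero (pow_ne_zero _ hz0) ?_
    rw [Ne, map_eq_zero]
    exact hp0 _ (by simp [hz1])
  have solP := fun f : Fin (m + 1) → CircleFun => exists_pivot_solution hFE hF hp0
    (fun b : Fin m => p (b + 1)) (f 0) (fun b => f b.succ)
  have solQ := fun f : Fin (m + 1) → CircleFun => exists_pivot_solution hFE hF hpm0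
    (fun b : Fin m => reflectSeq n m p b) (f (Fin.last m)) (fun b => f b.castSucc)
  have mulP : ∀ (f : Fin (m + 1) → CircleFun) (g₀ : CircleFun) (g : Fin m → CircleFun),
      onCircle (p 0) * g₀ = f 0 →
      (∀ b : Fin m, onCircle (p (b + 1)) * g₀ + ∑ j, onCircle (E b j) * g j = f b.succ) →
      P.map onCircle *ᵥ (Fin.cons g₀ g : Fin (m + 1) → CircleFun) = f := by
    intro f g₀ g h0 h1
    ext1 b
    rw [mulVec, dotProduct, Fin.sum_univ_succ]
    refine Fin.cases ?_ (fun b => ?_) b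
    · simp [hP, h0]
    · simpa [hP] using h1 b
  have mulQ : ∀ (f : Fin (m + 1) → CircleFun) (g₀ : CircleFun) (g : Fin m → CircleFun),
      onCircle (reflectSeq n m p m) * g₀ = f (Fin.last m) →
      (∀ b : Fin m, onCircle (reflectSeq n m p b) * g₀ + ∑ j, onCircle (E b j) * g j =
        f b.castSucc) →
      Q.map onCircle *ᵥ (Fin.cons g₀ g : Fin (m + 1) → CircleFun) = f := by
    intro f g₀ g h0 h1
    ext1 b
    rw [mulVec, dotProduct, Fin.sum_univ_succ]
    refine Fin.lastCases ?_ (fun b => ?_) b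
    · simp [hQ, h0]
    · simpa [hQ] using h1 b
  obtain ⟨R, hR⟩ : ∃ R, P.map onCircle * R = 1 := by
    refine Matrix.mulVec_surjective_iff_exists_right_inverse.1 fun f => ?_
    obtain ⟨g₀, g, h0, h1, -⟩ := solP f
    exact ⟨_, mulP f g₀ g h0 h1⟩
  obtain ⟨R', hR'⟩ : ∃ R, Q.map onCircle * R = 1 := by
    refine Matrix.mulVec_surjective_iff_exists_right_inverse.1 fun f => ?_
    obtain ⟨g₀, g, h0, h1, -⟩ := solQ f
    exact ⟨_, mulQ f g₀ g h0 h1⟩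
  let pv : Fin (m + 1) → (Fin n × Fin (m + 1) → ℂ) →ₗ[ℂ] ℂ[X] := fun b =>
    { toFun := fun c => polyVec c b
      map_add' := fun c d => by
        simp [polyVec, add_mul, Finset.sum_add_distrib]
      map_smul' := fun s c => by
        simp [polyVec, Finset.smul_sum, smul_eq_C_mul, mul_assoc] }
  refine ⟨E, hE, norm_coeff_le_of_gram hEE, hvan, ?_, ?_⟩
  · obtain ⟨L, hL⟩ := exists_remainder_map ha0 ha.le
    -- The `n₂` conditions say that `a` divides the first row of the right hand side; the quotient
    -- of that row by `p_0 = a o` is then analytic.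
    refine ⟨L ∘ₗ pv 0 ∘ₗ (bezoutian n P Q).mulVecLin, fun c hc => ?_⟩
    obtain ⟨q, hq⟩ := hL _ hc
    obtain ⟨g₀, g, h0, h1, h2⟩ := solP fun b => onCircle (polyVec (bezoutian n P Q *ᵥ c) b)
    obtain ⟨h3, h4⟩ := h2 a o q (fun b => polyVec (bezoutian n P Q *ᵥ c) b.succ) hao hoz
      (congrArg onCircle hq) fun _ => rfl
    exact form_nonneg_of_mulVec_eq (mul_eq_one_comm.1 hR) hgram hvan
      (g := Fin.cons g₀ g) (Fin.cases h3 h4) (mulP _ _ _ h0 h1)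
  · obtain ⟨L, hL⟩ := exists_remainder_map (conjReflect_ne_zero hod ho0)
      (natDegree_conjReflect_le hod)
    -- In the last row of `Q` the pivot is the reflection of `o` times that of `a`. The latter is
    -- zero-free on the closed disk, so only divisibility by the former, of degree at most `n₁`, is
    -- imposed.
    refine ⟨L ∘ₗ pv (Fin.last m) ∘ₗ (bezoutian n P Q).mulVecLin, fun c hc => ?_⟩
    obtain ⟨q, hq⟩ := hL _ hc
    obtain ⟨g₀, g, h0, h1, h2⟩ := solQ fun b => onCircle (polyVec (bezoutian n P Q *ᵥ c) b)
    obtain ⟨h3, h4⟩ := h2 _ _ q (fun b => polyVec (bezoutian n P Q *ᵥ c) b.castSucc) hrefl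
      (fun z hz => eval_conjReflect_ne_zero ha ha0 haz hz) (congrArg onCircle hq) fun _ => rfl
    exact form_nonpos_of_mulVec_eq (mul_eq_one_comm.1 hR') hgram hvan
      (g := Fin.cons g₀ g) (Fin.cases h3 h4) (mulQ _ _ _ h0 h1)

end BiPoly

end

/-! ### Passage to the limit for zeros on the torus -/

noncomputable section

namespace BiPoly

open Polynomial Matrix Filter Topology

variable {m n n₁ n₂ : ℕ}

section Continuity

variable {ρ : Type*} [Fintype ρ] {P Q : Matrix ρ ρ ℂ[X]} {Pk Qk : ℕ → Matrix ρ ρ ℂ[X]}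

lemma tendsto_diagSum_kernelCoef
    (hP : ∀ b i x, Tendsto (fun k => (Pk k b i).coeff x) atTop (𝓝 ((P b i).coeff x)))
    (hQ : ∀ b i x, Tendsto (fun k => (Qk k b i).coeff x) atTop (𝓝 ((Q b i).coeff x)))
    (b c : ρ) (x y : ℕ) :
    Tendsto (fun k => diagSum (kernelCoef (Pk k) (Qk k) b c) x y) atTop
      (𝓝 (diagSum (kernelCoef P Q b c) x y)) := by
  refine tendsto_finsetSum _ fun l _ => Tendsto.sub ?_ ?_
  · exact tendsto_finsetSum _ fun i _ =>
      (hP b i _).mul ((Complex.continuous_conj.tendsto _).comp (hP c i _))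
  · exact tendsto_finsetSum _ fun i _ =>
      (hQ b i _).mul ((Complex.continuous_conj.tendsto _).comp (hQ c i _))

end Continuity

lemma tendsto_coeff_lowerMat {p : ℕ → ℂ[X]} {pk : ℕ → ℕ → ℂ[X]} {E : Matrix (Fin m) (Fin m) ℂ[X]}
    {Ek : ℕ → Matrix (Fin m) (Fin m) ℂ[X]}
    (hp : ∀ b x, Tendsto (fun k => (pk k b).coeff x) atTop (𝓝 ((p b).coeff x)))
    (hE : ∀ i j x, Tendsto (fun k => (Ek k i j).coeff x) atTop (𝓝 ((E i j).coeff x)))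
    (b i : Fin (m + 1)) (x : ℕ) :
    Tendsto (fun k => (lowerMat (pk k) (Ek k) b i).coeff x) atTop
      (𝓝 ((lowerMat p E b i).coeff x)) := by
  refine Fin.cases ?_ (fun i => ?_) i
  · exact hp _ _
  · refine Fin.cases ?_ (fun b => ?_) b
    · exact tendsto_const_nhds
    · exact hE _ _ _

lemma tendsto_coeff_upperMat {p : ℕ → ℂ[X]} {pk : ℕ → ℕ → ℂ[X]} {E : Matrix (Fin m) (Fin m) ℂ[X]}
    {Ek : ℕ → Matrix (Fin m) (Fin m) ℂ[X]}
    (hp : ∀ b x, Tendsto (fun k => (pk k b).coeff x) atTop (𝓝 ((p b).coeff x)))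
    (hE : ∀ i j x, Tendsto (fun k => (Ek k i j).coeff x) atTop (𝓝 ((E i j).coeff x)))
    (b i : Fin (m + 1)) (x : ℕ) :
    Tendsto (fun k => (upperMat (pk k) (Ek k) b i).coeff x) atTop
      (𝓝 ((upperMat p E b i).coeff x)) := by
  refine Fin.cases ?_ (fun i => ?_) i
  · exact hp _ _
  · refine Fin.lastCases ?_ (fun b => ?_) b
    · simp
    · simpa using hE _ _ _

/-- The spectral factor and the decomposition of the Bezoutian, when `p` has no zeros on the
product of the circle and the open disk. -/
theorem exists_factor {p : ℕ → ℂ[X]} (hp : ∀ b, (p b).natDegree ≤ n)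
    (hpm : ∀ b, m < b → p b = 0)
    (hz : ∀ z w : ℂ, ‖z‖ = 1 → ‖w‖ < 1 → ∑ b ∈ Finset.range (m + 1), (p b).eval z * w ^ b ≠ 0)
    (hn₂ : n₂ = zerosInDisk (p 0)) (hn : n₁ + n₂ = n) :
    ∃ E : Matrix (Fin m) (Fin m) ℂ[X], (∀ i j, (E i j).natDegree ≤ n) ∧
      (∀ b c x y, n ≤ x ∨ n ≤ y →
        diagSum (kernelCoef (lowerMat p E) (upperMat (reflectSeq n m p) E) b c) x y = 0) ∧
      ∃ k₁ ≤ n₁, ∃ k₂ ≤ n₂, ∃ (A : Fin k₁ → Fin n × Fin (m + 1) → ℂ)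
        (B : Fin k₂ → Fin n × Fin (m + 1) → ℂ), LinearIndependent ℂ (Sum.elim A B) ∧
        ∀ α β, bezoutian n (lowerMat p E) (upperMat (reflectSeq n m p) E) α β =
          ∑ l, A l α * conj (A l β) - ∑ l, B l α * conj (B l β) := by
  set r : ℕ → ℝ := fun k => 1 - 1 / ((k : ℝ) + 1) with hr
  have hr0 : ∀ k, 0 ≤ r k := fun k => by
    rw [hr, sub_nonneg, div_le_one (by positivity)]
    linarith [(Nat.cast_nonneg k : (0 : ℝ) ≤ k)]
  have hr1 : ∀ k, r k < 1 := fun k => sub_lt_self _ (by positivity)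
  have hrt : Tendsto r atTop (𝓝 1) := by
    have := (tendsto_one_div_add_atTop_nhds_zero_nat (𝕜 := ℝ)).const_sub 1
    rwa [sub_zero] at this
  -- The coefficients of `p(z, r w)` in powers of `w`; `p_0` is unchanged, and with it the number of
  -- its zeros in the disk.
  set pk : ℕ → ℕ → ℂ[X] := fun k b => C ((r k : ℂ) ^ b) * p b with hpk
  have hpkd : ∀ k b, (pk k b).natDegree ≤ n := fun k b => (natDegree_C_mul_le _ _).trans (hp b)
  have hpkm : ∀ k b, m < b → pk k b = 0 := fun k b hb => by simp [hpk, hpm b hb]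
  have hpkz : ∀ k (z w : ℂ), ‖z‖ = 1 → ‖w‖ ≤ 1 →
      ∑ b ∈ Finset.range (m + 1), (pk k b).eval z * w ^ b ≠ 0 := by
    intro k z w hz1 hw
    have h1 : ‖(r k : ℂ) * w‖ < 1 := by
      rw [norm_mul, Complex.norm_real, Real.norm_of_nonneg (hr0 k)]
      calc r k * ‖w‖ ≤ r k * 1 := mul_le_mul_of_nonneg_left hw (hr0 k)
        _ < 1 := by rw [mul_one]; exact hr1 k
    have h2 : ∑ b ∈ Finset.range (m + 1), (pk k b).eval z * w ^ b =
        ∑ b ∈ Finset.range (m + 1), (p b).eval z * ((r k : ℂ) * w) ^ b := by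
      refine Finset.sum_congr rfl fun b _ => ?_
      rw [hpk, eval_mul, eval_C, mul_pow]
      ring
    rw [h2]
    exact hz z _ hz1 h1
  have hpk0 : ∀ k, n₂ = zerosInDisk (pk k 0) := fun k => by simp [hpk, hn₂]
  have hpkc : ∀ b x, Tendsto (fun k => (pk k b).coeff x) atTop (𝓝 ((p b).coeff x)) := by
    intro b x
    have h1 : Tendsto (fun k => (r k : ℂ) ^ b * (p b).coeff x) atTop
        (𝓝 (((1 : ℝ) : ℂ) ^ b * (p b).coeff x)) :=
      (((Complex.continuous_ofReal.tendsto _).comp hrt).pow b).mul_const _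
    rw [Complex.ofReal_one, one_pow, one_mul] at h1
    exact h1.congr fun k => (coeff_C_mul _).symm
  have hrefl : ∀ b x, Tendsto (fun k => (reflectSeq n m (pk k) b).coeff x) atTop
      (𝓝 ((reflectSeq n m p b).coeff x)) := by
    intro b x
    simp only [coeff_reflectSeq hp, coeff_reflectSeq (hpkd _)]
    split_ifs
    · exact (Complex.continuous_conj.tendsto _).comp (hpkc _ _)
    · exact tendsto_const_nhds
    · exact tendsto_const_nhds
  choose Ek hEd hEb hEv hE₂ hE₁ using fun k =>
    exists_factor_of_strict (hpkd k) (hpkm k) (hpkz k) (hpk0 k) hn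
  set K := ∑ b ∈ Finset.range (m + 1), ‖onCircle (p b)‖ ^ 2 with hK
  have hEK : ∀ k i j x, ‖(Ek k i j).coeff x‖ ≤ Real.sqrt K := by
    intro k i j x
    refine Real.le_sqrt_of_sq_le ((hEb k i j x).trans (Finset.sum_le_sum fun b _ => ?_))
    refine pow_le_pow_left₀ (norm_nonneg _) ?_ 2
    rw [ContinuousMap.norm_le _ (norm_nonneg _)]
    intro t
    have h1 : onCircle (pk k b) t = (r k : ℂ) ^ b * onCircle (p b) t := by
      simp [onCircle_apply, hpk]
    rw [h1, norm_mul, norm_pow, Complex.norm_real, Real.norm_of_nonneg (hr0 k)]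
    calc r k ^ b * ‖onCircle (p b) t‖ ≤ 1 * ‖onCircle (p b)‖ :=
          mul_le_mul (pow_le_one₀ (hr0 k) (hr1 k).le) ((onCircle (p b)).norm_coe_le_norm t)
            (norm_nonneg _) zero_le_one
      _ = _ := one_mul _
  let e : ℕ → (Fin m × Fin m × Fin (n + 1) → ℂ) := fun k s => (Ek k s.1 s.2.1).coeff s.2.2
  -- The uniform bound makes the coefficients of the factors a bounded sequence in a
  -- finite-dimensional space; a convergent subsequence gives `E`.
  obtain ⟨e', -, φ, hφ, he'⟩ := tendsto_subseq_of_bounded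
    (Metric.isBounded_closedBall (x := (0 : Fin m × Fin m × Fin (n + 1) → ℂ)) (r := Real.sqrt K))
    (x := e) (fun k => by
      rw [mem_closedBall_zero_iff, pi_norm_le_iff_of_nonneg (Real.sqrt_nonneg _)]
      exact fun s => hEK k _ _ _)
  set E : Matrix (Fin m) (Fin m) ℂ[X] := fun i j =>
    ∑ x : Fin (n + 1), C (e' (i, j, x)) * X ^ (x : ℕ) with hE
  have hEco : ∀ i j x, (E i j).coeff x =
      if h : x < n + 1 then e' (i, j, ⟨x, h⟩) else 0 := by
    intro i j x
    simp only [hE, finsetSum_coeff, coeff_C_mul, coeff_X_pow, mul_ite, mul_one, mul_zero]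
    split_ifs with h
    · rw [Finset.sum_eq_single ⟨x, h⟩]
      · simp
      · intro a _ ha
        rw [if_neg fun hx => ha (Fin.ext hx.symm)]
      · simp
    · exact Finset.sum_eq_zero fun a _ => if_neg (by omega)
  have hEdeg : ∀ i j, (E i j).natDegree ≤ n := fun i j => by
    rw [natDegree_le_iff_coeff_eq_zero]
    intro x hx
    rw [hEco, dif_neg (by omega)]
  have hEc : ∀ i j x, Tendsto (fun k => (Ek (φ k) i j).coeff x) atTop (𝓝 ((E i j).coeff x)) := by
    intro i j x
    rw [hEco]
    split_ifs with h
    · exact (tendsto_pi_nhds.1 he') (i, j, ⟨x, h⟩)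
    · refine tendsto_const_nhds.congr fun k => ?_
      rw [coeff_eq_zero_of_natDegree_lt ((hEd (φ k) i j).trans_lt (by omega))]
  have hlim := tendsto_diagSum_kernelCoef
    (tendsto_coeff_lowerMat (fun b x => (hpkc b x).comp hφ.tendsto_atTop) hEc)
    (tendsto_coeff_upperMat (fun b x => (hrefl b x).comp hφ.tendsto_atTop) hEc)
  refine ⟨E, hEdeg, fun b c x y hxy => ?_, ?_⟩
  · refine tendsto_nhds_unique (hlim b c x y) (tendsto_const_nhds.congr fun k => ?_)
    exact (hEv (φ k) b c x y hxy).symm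
  · obtain ⟨k₁, k₂, A, B, hli, hAB, ε, hε, hnear⟩ := exists_signature
      (isHermitian_bezoutian n (lowerMat p E) (upperMat (reflectSeq n m p) E))
    have hsum : Tendsto (fun k => ∑ α, ∑ β,
        ‖bezoutian n (lowerMat (pk (φ k)) (Ek (φ k)))
          (upperMat (reflectSeq n m (pk (φ k))) (Ek (φ k))) α β -
          bezoutian n (lowerMat p E) (upperMat (reflectSeq n m p) E) α β‖) atTop (𝓝 0) := by
      have h1 : Tendsto (fun k => ∑ α, ∑ β,
          ‖bezoutian n (lowerMat (pk (φ k)) (Ek (φ k)))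
            (upperMat (reflectSeq n m (pk (φ k))) (Ek (φ k))) α β -
            bezoutian n (lowerMat p E) (upperMat (reflectSeq n m p) E) α β‖) atTop
          (𝓝 (∑ _α : Fin n × Fin (m + 1), ∑ _β : Fin n × Fin (m + 1), 0)) :=
        tendsto_finsetSum _ fun α _ => tendsto_finsetSum _ fun β _ =>
          tendsto_iff_norm_sub_tendsto_zero.1 (hlim α.2 β.2 α.1 β.1)
      simpa using h1
    -- One Bezoutian close enough to the limit suffices to carry its inertia bounds over.
    obtain ⟨k, hk⟩ := (hsum.eventually (gt_mem_nhds hε)).exists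
    obtain ⟨L₂, hL₂⟩ := hE₂ (φ k)
    obtain ⟨L₁, hL₁⟩ := hE₁ (φ k)
    exact ⟨k₁, (hnear _ hk n₁).2 L₁ hL₁, k₂, (hnear _ hk n₂).1 L₂ hL₂, A, B, hli, hAB⟩

end BiPoly

end

/-! ### From coefficients to the polarized sums of squares identity -/

noncomputable section

namespace BiPoly

open Polynomial Matrix

variable {m n : ℕ}

/-- Summing the recursion of `diagSum` against `s ^ x * t ^ y`, the shift of both indices becomes
the factor `s t`, and the boundary terms vanish. -/
lemma sum_eq_mul_sum_diagSum {D : ℕ → ℕ → ℂ}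
    (hS : ∀ x y, n ≤ x ∨ n ≤ y → diagSum D x y = 0) (s t : ℂ) :
    ∑ x ∈ Finset.range (n + 1), ∑ y ∈ Finset.range (n + 1), D x y * (s ^ x * t ^ y) =
      (1 - s * t) *
        ∑ x ∈ Finset.range n, ∑ y ∈ Finset.range n, diagSum D x y * (s ^ x * t ^ y) := by
  set T := ∑ x ∈ Finset.range n, ∑ y ∈ Finset.range n, diagSum D x y * (s ^ x * t ^ y) with hT
  have h1 : ∑ x ∈ Finset.range (n + 1), ∑ y ∈ Finset.range (n + 1),
      diagSum D x y * (s ^ x * t ^ y) = T := by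
    rw [Finset.sum_range_succ, Finset.sum_eq_zero (s := Finset.range (n + 1)) fun y _ => by
      rw [hS n y (Or.inl le_rfl), zero_mul], add_zero]
    refine Finset.sum_congr rfl fun x _ => ?_
    rw [Finset.sum_range_succ, hS x n (Or.inr le_rfl), zero_mul, add_zero]
  have h2 : ∑ x ∈ Finset.range (n + 1), ∑ y ∈ Finset.range (n + 1),
      diagSum D x y * (s ^ x * t ^ y) = s * t * T +
      ∑ x ∈ Finset.range (n + 1), ∑ y ∈ Finset.range (n + 1), D x y * (s ^ x * t ^ y) := by
    simp only [Finset.sum_range_succ', Finset.sum_add_distrib, diagSum_succ, diagSum_zero_left,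
      diagSum_zero_right, add_mul, hT, Finset.mul_sum]
    have h3 : ∀ x y : ℕ, diagSum D x y * (s ^ (x + 1) * t ^ (y + 1)) =
        s * t * (diagSum D x y * (s ^ x * t ^ y)) := fun x y => by ring
    simp only [h3]
    ring
  linear_combination h1 - h2

variable {ρ : Type*} [Fintype ρ]

lemma sum_kernelCoef {P Q : Matrix ρ ρ ℂ[X]} (hP : ∀ b i, (P b i).natDegree ≤ n)
    (hQ : ∀ b i, (Q b i).natDegree ≤ n) (b c : ρ) (z ζ : ℂ) :
    ∑ x ∈ Finset.range (n + 1), ∑ y ∈ Finset.range (n + 1),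
        kernelCoef P Q b c x y * (z ^ x * conj ζ ^ y) =
      ∑ i, (P b i).eval z * conj ((P c i).eval ζ) -
        ∑ i, (Q b i).eval z * conj ((Q c i).eval ζ) := by
  have key : ∀ {P : Matrix ρ ρ ℂ[X]} (_ : ∀ b i, (P b i).natDegree ≤ n),
      ∑ i, (P b i).eval z * conj ((P c i).eval ζ) =
        ∑ x ∈ Finset.range (n + 1), ∑ y ∈ Finset.range (n + 1),
          (∑ i, (P b i).coeff x * conj ((P c i).coeff y)) * (z ^ x * conj ζ ^ y) := by
    intro P hP
    simp only [Finset.sum_mul]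
    rw [Finset.sum_congr rfl fun x _ => Finset.sum_comm, Finset.sum_comm]
    refine Finset.sum_congr rfl fun i _ => ?_
    rw [eval_eq_sum_range' (Nat.lt_succ_of_le (hP b i)),
      eval_eq_sum_range' (Nat.lt_succ_of_le (hP c i)), map_sum, Finset.sum_mul_sum]
    refine Finset.sum_congr rfl fun x _ => Finset.sum_congr rfl fun y _ => ?_
    rw [map_mul, map_pow]
    ring
  rw [key hP, key hQ]
  simp only [kernelCoef, sub_mul, Finset.sum_sub_distrib]

lemma kernel_eval_eq {P Q : Matrix ρ ρ ℂ[X]} (hP : ∀ b i, (P b i).natDegree ≤ n)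
    (hQ : ∀ b i, (Q b i).natDegree ≤ n)
    (hS : ∀ b c x y, n ≤ x ∨ n ≤ y → diagSum (kernelCoef P Q b c) x y = 0)
    {k₁ k₂ : ℕ} {A : Fin k₁ → Fin n × ρ → ℂ} {B : Fin k₂ → Fin n × ρ → ℂ}
    (hAB : ∀ α β, bezoutian n P Q α β =
      ∑ l, A l α * conj (A l β) - ∑ l, B l α * conj (B l β)) (b c : ρ) (z ζ : ℂ) :
    ∑ i, (P b i).eval z * conj ((P c i).eval ζ) -
        ∑ i, (Q b i).eval z * conj ((Q c i).eval ζ) =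
      (1 - z * conj ζ) * (∑ l, (polyVec (A l) b).eval z * conj ((polyVec (A l) c).eval ζ) -
        ∑ l, (polyVec (B l) b).eval z * conj ((polyVec (B l) c).eval ζ)) := by
  have key : ∀ {k : ℕ} (A : Fin k → Fin n × ρ → ℂ),
      ∑ l, (polyVec (A l) b).eval z * conj ((polyVec (A l) c).eval ζ) =
        ∑ x : Fin n, ∑ y : Fin n,
          (∑ l, A l (x, b) * conj (A l (y, c))) * (z ^ (x : ℕ) * conj ζ ^ (y : ℕ)) := by
    intro k A
    simp only [Finset.sum_mul]
    rw [Finset.sum_congr rfl fun x _ => Finset.sum_comm, Finset.sum_comm]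
    refine Finset.sum_congr rfl fun l _ => ?_
    simp only [polyVec, eval_finsetSum, eval_mul, eval_C, eval_pow, eval_X, map_sum, map_mul,
      map_pow, Finset.sum_mul_sum]
    exact Finset.sum_congr rfl fun x _ => Finset.sum_congr rfl fun y _ => by ring
  rw [← sum_kernelCoef hP hQ, sum_eq_mul_sum_diagSum (hS b c), key A, key B,
    ← Finset.sum_sub_distrib, Finset.sum_range]
  congr 1
  refine Finset.sum_congr rfl fun x _ => ?_
  rw [← Finset.sum_sub_distrib, Finset.sum_range]
  refine Finset.sum_congr rfl fun y _ => ?_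
  rw [← sub_mul, ← hAB (x, b) (y, c)]
  rfl

/-- The value at `(z, w)` of the polynomial with `w`-coefficients `q`. -/
def rowEval {k : ℕ} (q : Fin k → ℂ[X]) (z w : ℂ) : ℂ := ∑ b, (q b).eval z * w ^ (b : ℕ)

lemma sum_mul_pow_eq {k l : ℕ} (q : Fin l → Fin k → ℂ[X]) (z w ζ ω : ℂ) :
    ∑ b : Fin k, ∑ c : Fin k, (∑ i, (q i b).eval z * conj ((q i c).eval ζ)) *
        (w ^ (b : ℕ) * conj ω ^ (c : ℕ)) =
      ∑ i, rowEval (q i) z w * conj (rowEval (q i) ζ ω) := by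
  simp only [Finset.sum_mul]
  rw [Finset.sum_congr rfl fun x _ => Finset.sum_comm, Finset.sum_comm]
  refine Finset.sum_congr rfl fun i _ => ?_
  simp only [rowEval, map_sum, map_mul, map_pow, Finset.sum_mul_sum]
  exact Finset.sum_congr rfl fun x _ => Finset.sum_congr rfl fun y _ => by ring

lemma rowEval_lowerMat_zero (p : ℕ → ℂ[X]) (E : Matrix (Fin m) (Fin m) ℂ[X]) (z w : ℂ) :
    rowEval (fun b => lowerMat p E b 0) z w =
      ∑ b ∈ Finset.range (m + 1), (p b).eval z * w ^ b := by
  simp [rowEval, Finset.sum_range]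

lemma rowEval_upperMat_zero (p : ℕ → ℂ[X]) (E : Matrix (Fin m) (Fin m) ℂ[X]) (z w : ℂ) :
    rowEval (fun b => upperMat p E b 0) z w =
      ∑ b ∈ Finset.range (m + 1), (p b).eval z * w ^ b := by
  simp [rowEval, Finset.sum_range]

/-- Moving `E` down by one row multiplies by `w`; comparing with `upperMat` produces the factor `1 -
w ω^*` of the identity. -/
lemma rowEval_lowerMat_succ (p : ℕ → ℂ[X]) (E : Matrix (Fin m) (Fin m) ℂ[X]) (j : Fin m)
    (z w : ℂ) : rowEval (fun b => lowerMat p E b j.succ) z w =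
      w * rowEval (fun b => E b j) z w := by
  simp only [rowEval, Fin.sum_univ_succ, lowerMat_zero_succ, lowerMat_succ_succ, eval_zero,
    zero_mul, zero_add, Fin.val_succ, Finset.mul_sum]
  exact Finset.sum_congr rfl fun b _ => by ring

lemma rowEval_upperMat_succ (p : ℕ → ℂ[X]) (E : Matrix (Fin m) (Fin m) ℂ[X]) (j : Fin m)
    (z w : ℂ) : rowEval (fun b => upperMat p E b j.succ) z w = rowEval (fun b => E b j) z w := by
  simp [rowEval, Fin.sum_univ_castSucc]

/-- The polarized sums of squares identity. -/
theorem polarized_identity {p q : ℕ → ℂ[X]} {E : Matrix (Fin m) (Fin m) ℂ[X]}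
    (hP : ∀ b i, (lowerMat p E b i).natDegree ≤ n) (hQ : ∀ b i, (upperMat q E b i).natDegree ≤ n)
    (hS : ∀ b c x y, n ≤ x ∨ n ≤ y →
      diagSum (kernelCoef (lowerMat p E) (upperMat q E) b c) x y = 0)
    {k₁ k₂ : ℕ} {A : Fin k₁ → Fin n × Fin (m + 1) → ℂ} {B : Fin k₂ → Fin n × Fin (m + 1) → ℂ}
    (hAB : ∀ α β, bezoutian n (lowerMat p E) (upperMat q E) α β =
      ∑ l, A l α * conj (A l β) - ∑ l, B l α * conj (B l β)) (z w ζ ω : ℂ) :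
    (∑ b ∈ Finset.range (m + 1), (p b).eval z * w ^ b) *
          conj (∑ b ∈ Finset.range (m + 1), (p b).eval ζ * ω ^ b) -
        (∑ b ∈ Finset.range (m + 1), (q b).eval z * w ^ b) *
          conj (∑ b ∈ Finset.range (m + 1), (q b).eval ζ * ω ^ b) =
      (1 - w * conj ω) *
          ∑ j, rowEval (fun b => E b j) z w * conj (rowEval (fun b => E b j) ζ ω) +
        (1 - z * conj ζ) *
          (∑ l, rowEval (polyVec (A l)) z w * conj (rowEval (polyVec (A l)) ζ ω) -
            ∑ l, rowEval (polyVec (B l)) z w * conj (rowEval (polyVec (B l)) ζ ω)) := by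
  have h : ∑ b : Fin (m + 1), ∑ c : Fin (m + 1),
      (∑ i, (lowerMat p E b i).eval z * conj ((lowerMat p E c i).eval ζ) -
        ∑ i, (upperMat q E b i).eval z * conj ((upperMat q E c i).eval ζ)) *
          (w ^ (b : ℕ) * conj ω ^ (c : ℕ)) =
      ∑ b : Fin (m + 1), ∑ c : Fin (m + 1), (1 - z * conj ζ) *
        (∑ l, (polyVec (A l) b).eval z * conj ((polyVec (A l) c).eval ζ) -
          ∑ l, (polyVec (B l) b).eval z * conj ((polyVec (B l) c).eval ζ)) *
            (w ^ (b : ℕ) * conj ω ^ (c : ℕ)) :=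
    Finset.sum_congr rfl fun b _ => Finset.sum_congr rfl fun c _ => by
      rw [kernel_eval_eq hP hQ hS hAB]
  simp only [mul_assoc, ← Finset.mul_sum, sub_mul, Finset.sum_sub_distrib] at h
  rw [sum_mul_pow_eq (fun i b => lowerMat p E b i), sum_mul_pow_eq (fun i b => upperMat q E b i),
    sum_mul_pow_eq (fun l => polyVec (A l)), sum_mul_pow_eq (fun l => polyVec (B l))] at h
  simp only [Fin.sum_univ_succ, rowEval_lowerMat_zero, rowEval_upperMat_zero,
    rowEval_lowerMat_succ, rowEval_upperMat_succ] at h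
  have h2 : ∑ j, w * rowEval (fun b => E b j) z w * conj (w * 0 + ω * rowEval (fun b => E b j) ζ ω)
      = w * conj ω * ∑ j, rowEval (fun b => E b j) z w * conj (rowEval (fun b => E b j) ζ ω) := by
    rw [Finset.mul_sum]
    refine Finset.sum_congr rfl fun j _ => ?_
    rw [mul_zero, zero_add, map_mul]
    ring
  simp only [mul_zero, zero_add] at h2
  rw [h2] at h
  linear_combination h

end BiPoly

end

/-! ### Unitary extension and the determinant of the pencil -/

noncomputable section

namespace BiPoly

open Matrix

section Unitary

variable {S κ : Type*} [Fintype κ] [DecidableEq κ]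

/-- Two families of vectors with the same Gram matrix are related by a unitary matrix. -/
theorem exists_unitary_of_gram_eq (X Y : S → κ → ℂ)
    (h : ∀ s t, ∑ i, X s i * conj (X t i) = ∑ i, Y s i * conj (Y t i)) :
    ∃ V ∈ Matrix.unitaryGroup κ ℂ, ∀ s, V *ᵥ X s = Y s := by
  let lift : (S → κ → ℂ) → ((S →₀ ℂ) →ₗ[ℂ] EuclideanSpace ℂ κ) := fun X =>
    Finsupp.linearCombination ℂ fun s => WithLp.toLp 2 (X s)
  have hinner : ∀ f g, inner ℂ (lift X f) (lift X g) = inner ℂ (lift Y f) (lift Y g) := by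
    intro f g
    have key : ∀ X : S → κ → ℂ, inner ℂ (lift X f) (lift X g) =
        f.sum fun s a => g.sum fun t b => conj a * (b * ∑ i, X t i * conj (X s i)) := by
      intro X
      simp only [lift, Finsupp.linearCombination_apply, Finsupp.sum, sum_inner, inner_sum,
        inner_smul_left, inner_smul_right, Finset.mul_sum (s := f.support)]
      rw [Finset.sum_comm]
      refine Finset.sum_congr rfl fun a _ => Finset.sum_congr rfl fun b _ => ?_
      rw [mul_left_comm]
      rfl
    rw [key, key]
    simp only [h]
  have hnorm : ∀ f, ‖lift X f‖ = ‖lift Y f‖ := fun f => by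
    rw [@norm_eq_sqrt_re_inner ℂ, @norm_eq_sqrt_re_inner ℂ, hinner]
  have hker : LinearMap.ker (lift X) ≤ LinearMap.ker (lift Y) := fun f hf => by
    rw [LinearMap.mem_ker] at hf ⊢
    rw [← norm_eq_zero, ← hnorm, hf, norm_zero]
  -- Equal Gram matrices make the two synthesis maps have equal norms, so `X s ↦ Y s` is a
  -- well-defined isometry on the span, which extends to the whole space by finite dimension.
  let T : LinearMap.range (lift X) →ₗ[ℂ] EuclideanSpace ℂ κ :=
    ((LinearMap.ker (lift X)).liftQ (lift Y) hker) ∘ₗ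
      (lift X).quotKerEquivRange.symm.toLinearMap
  have hT : ∀ f, T ⟨lift X f, f, rfl⟩ = lift Y f := by
    intro f
    have h1 : (lift X).quotKerEquivRange.symm ⟨lift X f, f, rfl⟩ =
        (LinearMap.ker (lift X)).mkQ f := by
      rw [LinearEquiv.symm_apply_eq]
      rfl
    simp only [T, LinearMap.comp_apply, LinearEquiv.coe_coe, h1]
    rfl
  let L : LinearMap.range (lift X) →ₗᵢ[ℂ] EuclideanSpace ℂ κ := ⟨T, by
    rintro ⟨_, f, rfl⟩
    rw [hT, ← hnorm]
    rfl⟩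
  have hL : ∀ s, L.extend (WithLp.toLp 2 (X s)) = WithLp.toLp 2 (Y s) := by
    intro s
    have h1 : ∀ X : S → κ → ℂ, lift X (Finsupp.single s 1) = WithLp.toLp 2 (X s) := fun X => by
      simp [lift]
    rw [← h1, ← h1, ← hT]
    exact L.extend_apply ⟨_, _⟩
  let V : Matrix κ κ ℂ := Matrix.toEuclideanLin.symm L.extend.toLinearMap
  have hV : ∀ x : κ → ℂ, WithLp.toLp 2 (V *ᵥ x) = L.extend (WithLp.toLp 2 x) := by
    intro x
    have h1 : Matrix.toEuclideanLin V = L.extend.toLinearMap := LinearEquiv.apply_symm_apply _ _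
    have h2 := congrArg (fun f => f (WithLp.toLp 2 x)) h1
    exact h2
  refine ⟨V, ?_, fun s => ?_⟩
  · rw [Matrix.mem_unitaryGroup_iff']
    ext i j
    have h1 : inner ℂ (L.extend (WithLp.toLp 2 (Pi.single i 1)))
        (L.extend (WithLp.toLp 2 (Pi.single j 1))) =
        inner ℂ (WithLp.toLp 2 (Pi.single i (1 : ℂ)) : EuclideanSpace ℂ κ)
          (WithLp.toLp 2 (Pi.single j 1)) := L.extend.inner_map_map _ _
    rw [← hV, ← hV] at h1
    simp only [PiLp.inner_apply, RCLike.inner_apply, mulVec_single_one, col_apply] at h1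
    rw [star_eq_conjTranspose, mul_apply]
    simp only [conjTranspose_apply, ← starRingEnd_apply]
    rw [Finset.sum_congr rfl fun k _ => mul_comm _ _, h1, Matrix.one_apply]
    simp [Pi.single_apply, eq_comm]
  · have := (hV (X s)).trans (hL s)
    exact (WithLp.toLp_injective 2) this

end Unitary

/-- Each term of the determinant takes one entry from every column, so column bounds add up. In the
pencil, `z` occurs in `k₁ + k₂` columns and `w` in `m`. -/
lemma degreeOf_det_le {σ ι : Type*} [Fintype ι] [DecidableEq ι]
    {M : Matrix ι ι (MvPolynomial σ ℂ)} {x : σ} {d : ι → ℕ}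
    (h : ∀ i j, (M i j).degreeOf x ≤ d j) : M.det.degreeOf x ≤ ∑ j, d j := by
  rw [Matrix.det_apply]
  refine (MvPolynomial.degreeOf_sum_le _ _ _).trans (Finset.sup_le fun τ _ => ?_)
  have h1 : (∏ i, M (τ i) i).degreeOf x ≤ ∑ j, d j :=
    (MvPolynomial.degreeOf_prod_le _ _ _).trans (Finset.sum_le_sum fun i _ => h _ _)
  rcases Int.units_eq_one_or (Equiv.Perm.sign τ) with hs | hs
  · rwa [hs, one_smul]
  · rwa [hs, Units.neg_smul, one_smul, MvPolynomial.degreeOf_neg]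

/-- The bivariate polynomial matrix whose values are `Gamma z - W * Delta z w`. -/
def pencil (m k₁ k₂ : ℕ) (W : Matrix (Fin m ⊕ Fin k₁ ⊕ Fin k₂) (Fin m ⊕ Fin k₁ ⊕ Fin k₂) ℂ) :
    Matrix (Fin m ⊕ Fin k₁ ⊕ Fin k₂) (Fin m ⊕ Fin k₁ ⊕ Fin k₂) (MvPolynomial (Fin 2) ℂ) :=
  Matrix.diagonal (Sum.elim (fun _ => 1) (Sum.elim (fun _ => 1) (fun _ => MvPolynomial.X 0))) -
    W.map MvPolynomial.C * Matrix.diagonal (Sum.elim (fun _ => MvPolynomial.X 1)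
      (Sum.elim (fun _ => MvPolynomial.X 0) (fun _ => 1)))

variable {m k₁ k₂ : ℕ} (W : Matrix (Fin m ⊕ Fin k₁ ⊕ Fin k₂) (Fin m ⊕ Fin k₁ ⊕ Fin k₂) ℂ)

lemma pencil_map_eval (z w : ℂ) :
    (pencil m k₁ k₂ W).map (MvPolynomial.eval ![z, w]) =
      Gamma m k₁ k₂ z - W * Delta m k₁ k₂ z w := by
  ext i j
  rcases i with i | i | i <;> rcases j with j | j | j <;>
    simp [pencil, Gamma, Delta, Matrix.diagonal_apply, apply_ite]

lemma val_det_pencil (z w : ℂ) :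
    val (pencil m k₁ k₂ W).det z w = (Gamma m k₁ k₂ z - W * Delta m k₁ k₂ z w).det := by
  rw [← pencil_map_eval, val, RingHom.map_det]
  rfl

lemma degreeOf_diagonal_sub_le {ι σ : Type*} [Fintype ι] [DecidableEq ι] {x : σ} (W : Matrix ι ι ℂ)
    {γ δ : ι → MvPolynomial σ ℂ} {d : ι → ℕ} (hγ : ∀ j, (γ j).degreeOf x ≤ d j)
    (hδ : ∀ j, (δ j).degreeOf x ≤ d j) (i j : ι) :
    ((Matrix.diagonal γ - W.map MvPolynomial.C * Matrix.diagonal δ :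
      Matrix ι ι (MvPolynomial σ ℂ)) i j).degreeOf x ≤ d j := by
  rw [Matrix.sub_apply, Matrix.mul_diagonal, Matrix.map_apply, sub_eq_add_neg]
  refine (MvPolynomial.degreeOf_add_le _ _ _).trans (max_le ?_ ?_)
  · rw [Matrix.diagonal_apply]
    split_ifs with h
    · exact h ▸ hγ i
    · simp
  · rw [MvPolynomial.degreeOf_neg]
    exact (MvPolynomial.degreeOf_C_mul_le _ _ _).trans (hδ j)

lemma degreeOf_zero_det_pencil_le : (pencil m k₁ k₂ W).det.degreeOf 0 ≤ k₁ + k₂ := by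
  refine (degreeOf_det_le (d := Sum.elim (fun _ => 0) (Sum.elim (fun _ => 1) (fun _ => 1)))
    (degreeOf_diagonal_sub_le W ?_ ?_)).trans (by simp)
  all_goals
    rintro (j | j | j) <;> simp [MvPolynomial.degreeOf_X_of_ne]

lemma degreeOf_one_det_pencil_le : (pencil m k₁ k₂ W).det.degreeOf 1 ≤ m := by
  refine (degreeOf_det_le (d := Sum.elim (fun _ => 1) (Sum.elim (fun _ => 0) (fun _ => 0)))
    (degreeOf_diagonal_sub_le W ?_ ?_)).trans (by simp)
  all_goals
    rintro (j | j | j) <;> simp [MvPolynomial.degreeOf_X_of_ne]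

lemma eq_of_val_eq {p q : MvPolynomial (Fin 2) ℂ} (h : ∀ z w, val p z w = val q z w) : p = q := by
  refine MvPolynomial.funext fun x => ?_
  have h1 : x = ![x 0, x 1] := by
    ext i
    fin_cases i <;> rfl
  rw [h1]
  exact h _ _

@[simp] lemma val_add (p q : MvPolynomial (Fin 2) ℂ) (z w : ℂ) :
    val (p + q) z w = val p z w + val q z w := map_add _ _ _

@[simp] lemma val_mul (p q : MvPolynomial (Fin 2) ℂ) (z w : ℂ) :
    val (p * q) z w = val p z w * val q z w := map_mul _ _ _

@[simp] lemma val_C (c z w : ℂ) : val (MvPolynomial.C c) z w = c := MvPolynomial.eval_C _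

@[simp] lemma val_sum {ι : Type*} (s : Finset ι) (f : ι → MvPolynomial (Fin 2) ℂ) (z w : ℂ) :
    val (∑ i ∈ s, f i) z w = ∑ i ∈ s, val (f i) z w := map_sum _ _ _

end BiPoly

end

/-! ### The unitary realization and the exact numbers of squares -/

noncomputable section

namespace BiPoly

open Matrix

variable {n m k₁ k₂ : ℕ}

/-- The equation reads `(z - 1) (A · a - B · b) = 0`; the first factor is a nonzero polynomial, and
the second vanishes only trivially by linear independence. -/
lemma eq_zero_of_fixed {A : Fin k₁ → MvPolynomial (Fin 2) ℂ} {B : Fin k₂ → MvPolynomial (Fin 2) ℂ}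
    (hli : LinearIndependent ℂ (Sum.elim A B)) {a : Fin k₁ → ℂ} {b : Fin k₂ → ℂ}
    (h : ∀ z w, z * ∑ l, val (A l) z w * a l + ∑ l, val (B l) z w * b l =
      ∑ l, val (A l) z w * a l + z * ∑ l, val (B l) z w * b l) : a = 0 ∧ b = 0 := by
  have h1 : (MvPolynomial.X 0 - 1) * (∑ l, MvPolynomial.C (a l) * A l +
      ∑ l, MvPolynomial.C (-b l) * B l) = 0 := by
    refine eq_of_val_eq fun z w => ?_
    have hz : val (MvPolynomial.X 0 - 1) z w = z - 1 := by simp [val]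
    have h0 : val 0 z w = 0 := map_zero _
    rw [val_mul, hz, h0, val_add, val_sum, val_sum]
    simp only [val_mul, val_C, neg_mul, Finset.sum_neg_distrib]
    simp only [mul_comm _ (a _), mul_comm _ (b _)] at h
    linear_combination h z w
  have hX : (MvPolynomial.X 0 - 1 : MvPolynomial (Fin 2) ℂ) ≠ 0 := by
    intro h2
    have h3 := congrArg (fun q => val q 0 0) h2
    simp [val] at h3
  have h2 := (mul_eq_zero.1 h1).resolve_left hX
  have h3 := Fintype.linearIndependent_iff.1 hli (Sum.elim a (fun l => -b l)) (by
    simpa [MvPolynomial.smul_eq_C_mul] using h2)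
  exact ⟨funext fun l => h3 (Sum.inl l), funext fun l => neg_eq_zero.1 (h3 (Sum.inr l))⟩

lemma star_mulVec_dotProduct_mulVec {κ : Type*} [Fintype κ] [DecidableEq κ] {V : Matrix κ κ ℂ}
    (hV : V ∈ Matrix.unitaryGroup κ ℂ) (x y : κ → ℂ) :
    star (V *ᵥ x) ⬝ᵥ (V *ᵥ y) = star x ⬝ᵥ y := by
  rw [star_mulVec, dotProduct_mulVec, vecMul_vecMul, ← star_eq_conjTranspose,
    Matrix.mem_unitaryGroup_iff'.1 hV, vecMul_one]

/-- The pencil is nonsingular at `(1, 0)`. -/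
lemma det_pencil_ne_zero {p q : MvPolynomial (Fin 2) ℂ} {E : Fin m → MvPolynomial (Fin 2) ℂ}
    {A : Fin k₁ → MvPolynomial (Fin 2) ℂ} {B : Fin k₂ → MvPolynomial (Fin 2) ℂ}
    (hli : LinearIndependent ℂ (Sum.elim A B))
    {V : Matrix (Fin 1 ⊕ (Fin m ⊕ Fin k₁ ⊕ Fin k₂)) (Fin 1 ⊕ (Fin m ⊕ Fin k₁ ⊕ Fin k₂)) ℂ}
    (hV : V ∈ Matrix.unitaryGroup (Fin 1 ⊕ (Fin m ⊕ Fin k₁ ⊕ Fin k₂)) ℂ)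
    (hVF : ∀ z w, V *ᵥ Sum.elim (fun _ => val p z w) (Sum.elim (fun j => w * val (E j) z w)
        (Sum.elim (fun l => z * val (A l) z w) (fun l => val (B l) z w))) =
      Sum.elim (fun _ => val q z w) (Sum.elim (fun j => val (E j) z w)
        (Sum.elim (fun l => val (A l) z w) (fun l => z * val (B l) z w)))) :
    (pencil m k₁ k₂ V.toBlocks₂₂).det ≠ 0 := by
  intro h
  have h1 : (Gamma m k₁ k₂ 1 - V.toBlocks₂₂ * Delta m k₁ k₂ 1 0).det = 0 := by
    rw [← val_det_pencil, h]
    exact map_zero _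
  obtain ⟨v, hv0, hv⟩ := Matrix.exists_mulVec_eq_zero_iff.2 h1
  have hG : Gamma m k₁ k₂ 1 = 1 := by
    rw [Gamma, ← Matrix.diagonal_one]
    congr 1
    ext (i | i | i) <;> rfl
  rw [hG, sub_mulVec, one_mulVec, sub_eq_zero, ← mulVec_mulVec] at hv
  set u := Delta m k₁ k₂ 1 0 *ᵥ v with hu
  have hu' : u = Sum.elim (fun _ => 0) (Sum.elim (fun l => v (Sum.inr (Sum.inl l)))
      (fun l => v (Sum.inr (Sum.inr l)))) := by
    ext (i | i | i) <;> simp [hu, Delta, mulVec_diagonal]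
  have hVu : V *ᵥ Sum.elim (0 : Fin 1 → ℂ) u = Sum.elim (V.toBlocks₁₂ *ᵥ u) v := by
    conv_lhs => rw [← fromBlocks_toBlocks V]
    rw [fromBlocks_mulVec]
    simp [← hv]
  -- At `w = 0` the vector `u` is `v` with its first block deleted. Since `V` maps `(0, u)` to `(V₂
  -- u, v)` and preserves norms, both `V₂ u` and that block are zero, so `(0, u)` is fixed by `V`.
  have hnorm := star_mulVec_dotProduct_mulVec hV (Sum.elim (0 : Fin 1 → ℂ) u) (Sum.elim (0 : Fin 1 → ℂ) u)
  have hzero : V.toBlocks₁₂ *ᵥ u = 0 ∧ ∀ j, v (Sum.inl j) = 0 := by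
    rw [hVu] at hnorm
    have h2 : ∀ x : ℂ, star x * x = ((‖x‖ ^ 2 : ℝ) : ℂ) := fun x => by
      rw [← starRingEnd_apply, Complex.conj_mul']
      norm_cast
    simp only [dotProduct, Fintype.sum_sum_type, Sum.elim_inl, Sum.elim_inr, Pi.star_apply, h2,
      hu', Pi.zero_apply, norm_zero, ← Complex.ofReal_sum,
      Complex.ofReal_inj] at hnorm
    have h3 : ∑ i, ‖(V.toBlocks₁₂ *ᵥ u) i‖ ^ 2 + ∑ j, ‖v (Sum.inl j)‖ ^ 2 = 0 := by
      rw [← hu'] at hnorm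
      simp only [ne_eq, OfNat.ofNat_ne_zero, not_false_eq_true, zero_pow, Finset.sum_const_zero,
        zero_add] at hnorm
      linarith
    rw [add_eq_zero_iff_of_nonneg (by positivity) (by positivity),
      Finset.sum_eq_zero_iff_of_nonneg (fun _ _ => by positivity),
      Finset.sum_eq_zero_iff_of_nonneg (fun _ _ => by positivity)] at h3
    exact ⟨funext fun i => by simpa using h3.1 i (Finset.mem_univ _),
      fun j => by simpa using h3.2 j (Finset.mem_univ _)⟩
  have hvu : v = u := by
    rw [hu']
    ext (i | i | i)
    · exact hzero.2 i
    · rfl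
    · rfl
  rw [hzero.1] at hVu
  -- Pairing the fixed vector with the relation that `V` satisfies for all `(z, w)` gives the
  -- relation between the entries of `A` and `B` that linear independence excludes.
  have h4 := eq_zero_of_fixed hli (a := fun l => star (v (Sum.inr (Sum.inl l))))
    (b := fun l => star (v (Sum.inr (Sum.inr l)))) fun z w => by
      have h5 := star_mulVec_dotProduct_mulVec hV (Sum.elim (0 : Fin 1 → ℂ) u)
        (Sum.elim (fun _ => val p z w) (Sum.elim (fun j => w * val (E j) z w)
          (Sum.elim (fun l => z * val (A l) z w) (fun l => val (B l) z w))))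
      rw [hVu, hVF, hvu, hu'] at h5
      simp only [dotProduct, Fintype.sum_sum_type, Sum.elim_inl, Sum.elim_inr, Pi.star_apply,
        Pi.zero_apply, star_zero, zero_mul, Finset.sum_const_zero, zero_add] at h5
      simp only [mul_comm (star (_ : ℂ)) _, mul_assoc] at h5
      simp only [Finset.mul_sum]
      exact h5.symm
  refine hv0 ?_
  ext (i | i | i)
  · exact hzero.2 i
  · exact star_eq_zero.1 (congrFun h4.1 i)
  · exact star_eq_zero.1 (congrFun h4.2 i)

lemma exists_eq_C {c : MvPolynomial (Fin 2) ℂ} (h₀ : c.degreeOf 0 = 0) (h₁ : c.degreeOf 1 = 0) :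
    ∃ a, c = MvPolynomial.C a := by
  refine ⟨_, MvPolynomial.totalDegree_eq_zero_iff_eq_C.1 ?_⟩
  rw [MvPolynomial.totalDegree_eq_zero_iff]
  intro s hs i
  have h := MvPolynomial.monomial_le_degreeOf i hs
  fin_cases i
  · exact Nat.le_zero.1 (h.trans_eq h₀)
  · exact Nat.le_zero.1 (h.trans_eq h₁)

/-- Cramer's rule makes `det M` times each `F i` divisible by `p`, and `q` is a combination of `p`
and the `F i`. -/
lemma dvd_det_mul {R ι : Type*} [CommRing R] [Fintype ι] [DecidableEq ι] (M : Matrix ι ι R)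
    (F b d : ι → R) {p q a : R} (h : M *ᵥ F = p • b) (hq : q = a * p + ∑ i, d i * F i) :
    p ∣ M.det * q := by
  have hg : ∀ i, M.det * F i = p * (M.adjugate *ᵥ b) i := by
    have h2 := congrArg (fun x => M.adjugate *ᵥ x) h
    simp only [mulVec_mulVec, adjugate_mul, mulVec_smul, smul_mulVec, one_mulVec] at h2
    exact fun i => congrFun h2 i
  refine ⟨M.det * a + ∑ i, d i * (M.adjugate *ᵥ b) i, ?_⟩
  rw [hq, mul_add, mul_add, Finset.mul_sum, Finset.mul_sum]
  congr 1
  · ring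
  · refine Finset.sum_congr rfl fun i _ => ?_
    linear_combination d i * hg i

lemma dvd_det_pencil_mul {p q : MvPolynomial (Fin 2) ℂ}
    {F : Fin m ⊕ Fin k₁ ⊕ Fin k₂ → MvPolynomial (Fin 2) ℂ}
    {V : Matrix (Fin 1 ⊕ (Fin m ⊕ Fin k₁ ⊕ Fin k₂)) (Fin 1 ⊕ (Fin m ⊕ Fin k₁ ⊕ Fin k₂)) ℂ}
    (hker : ∀ z w, (Gamma m k₁ k₂ z - V.toBlocks₂₂ * Delta m k₁ k₂ z w) *ᵥ
      (fun i => val (F i) z w) = V.toBlocks₂₁ *ᵥ (fun _ => val p z w))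
    (hq : ∀ z w, V.toBlocks₁₁ *ᵥ (fun _ => val p z w) +
      V.toBlocks₁₂ *ᵥ (Delta m k₁ k₂ z w *ᵥ fun i => val (F i) z w) = fun _ => val q z w) :
    p ∣ (pencil m k₁ k₂ V.toBlocks₂₂).det * q := by
  let δ : Fin m ⊕ Fin k₁ ⊕ Fin k₂ → MvPolynomial (Fin 2) ℂ :=
    Sum.elim (fun _ => MvPolynomial.X 1) (Sum.elim (fun _ => MvPolynomial.X 0) (fun _ => 1))
  refine dvd_det_mul (pencil m k₁ k₂ V.toBlocks₂₂) F
    (fun i => MvPolynomial.C (V.toBlocks₂₁ i 0)) (fun i => MvPolynomial.C (V.toBlocks₁₂ 0 i) * δ i)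
    (a := MvPolynomial.C (V.toBlocks₁₁ 0 0)) ?_ ?_
  · ext1 i
    refine eq_of_val_eq fun z w => ?_
    have h2 := congrFun (hker z w) i
    rw [← pencil_map_eval] at h2
    simp only [mulVec, dotProduct, map_apply, Fin.sum_univ_one] at h2
    simp only [mulVec, dotProduct, val_sum, val_mul, Pi.smul_apply, smul_eq_mul, val_C]
    rw [mul_comm (val p z w), ← h2]
    rfl
  · refine eq_of_val_eq fun z w => ?_
    have h2 := congrFun (hq z w) 0
    rw [← h2]
    have h3 : ∀ i, (Delta m k₁ k₂ z w *ᵥ fun i => val (F i) z w) i = val (δ i) z w * val (F i) z w := by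
      rintro (i | i | i) <;> simp [Delta, mulVec_diagonal, δ, val]
    simp only [val_add, val_mul, val_C, val_sum, mul_assoc, ← h3]
    simp only [Pi.add_apply, mulVec, dotProduct, Fin.sum_univ_one]

/-- The unitary realization obtained from the polarized sums of squares identity. -/
theorem exists_realization {p q : MvPolynomial (Fin 2) ℂ} {E : Fin m → MvPolynomial (Fin 2) ℂ}
    {A : Fin k₁ → MvPolynomial (Fin 2) ℂ} {B : Fin k₂ → MvPolynomial (Fin 2) ℂ}
    (hdeg : HasDegree n m p) (hp0 : p ≠ 0) (hcop : IsRelPrime p q)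
    (hli : LinearIndependent ℂ (Sum.elim A B)) (hk : k₁ + k₂ ≤ n)
    (hid : ∀ z w ζ ω : ℂ, val p z w * conj (val p ζ ω) - val q z w * conj (val q ζ ω) =
      (1 - w * conj ω) * ∑ j, val (E j) z w * conj (val (E j) ζ ω) +
        (1 - z * conj ζ) * (∑ l, val (A l) z w * conj (val (A l) ζ ω) -
          ∑ l, val (B l) z w * conj (val (B l) ζ ω))) :
    k₁ + k₂ = n ∧ ∃ V ∈ Matrix.unitaryGroup (Fin 1 ⊕ (Fin m ⊕ Fin k₁ ⊕ Fin k₂)) ℂ,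
      ∀ z w : ℂ, val p z w ≠ 0 →
        IsUnit (Gamma m k₁ k₂ z - V.toBlocks₂₂ * Delta m k₁ k₂ z w) ∧
        val q z w / val p z w =
          (V.toBlocks₁₁ + V.toBlocks₁₂ * Delta m k₁ k₂ z w *
            (Gamma m k₁ k₂ z - V.toBlocks₂₂ * Delta m k₁ k₂ z w)⁻¹ * V.toBlocks₂₁) 0 0 := by
  -- Moving the negative terms of the identity to the other side makes it an equality of Gram
  -- matrices; in the `B` block the factor `z` therefore stands on the target side.
  obtain ⟨V, hV, hVF'⟩ := exists_unitary_of_gram_eq (S := ℂ × ℂ)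
    (fun s => Sum.elim (fun _ : Fin 1 => val p s.1 s.2)
      (Sum.elim (fun j => s.2 * val (E j) s.1 s.2)
        (Sum.elim (fun l => s.1 * val (A l) s.1 s.2) (fun l => val (B l) s.1 s.2))))
    (fun s => Sum.elim (fun _ => val q s.1 s.2) (Sum.elim (fun j => val (E j) s.1 s.2)
        (Sum.elim (fun l => val (A l) s.1 s.2) (fun l => s.1 * val (B l) s.1 s.2)))) (by
      rintro ⟨z, w⟩ ⟨ζ, ω⟩
      have h := hid z w ζ ω
      have h1 : ∀ {k : ℕ} (F : Fin k → MvPolynomial (Fin 2) ℂ) (x y : ℂ),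
          ∑ j, x * val (F j) z w * conj (y * val (F j) ζ ω) =
            x * conj y * ∑ j, val (F j) z w * conj (val (F j) ζ ω) := by
        intro k F x y
        rw [Finset.mul_sum]
        refine Finset.sum_congr rfl fun j _ => ?_
        rw [map_mul]
        ring
      simp only [Fintype.sum_sum_type, Sum.elim_inl, Sum.elim_inr, Fin.sum_univ_one, h1]
      linear_combination h)
  have hVF : ∀ z w, V *ᵥ Sum.elim (fun _ => val p z w) (Sum.elim (fun j => w * val (E j) z w)
        (Sum.elim (fun l => z * val (A l) z w) (fun l => val (B l) z w))) =
      Sum.elim (fun _ => val q z w) (Sum.elim (fun j => val (E j) z w)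
        (Sum.elim (fun l => val (A l) z w) (fun l => z * val (B l) z w))) :=
    fun z w => hVF' (z, w)
  have hD := det_pencil_ne_zero hli hV hVF
  set D := (pencil m k₁ k₂ V.toBlocks₂₂).det with hDdef
  let F : Fin m ⊕ Fin k₁ ⊕ Fin k₂ → MvPolynomial (Fin 2) ℂ := Sum.elim E (Sum.elim A B)
  let f : ℂ → ℂ → Fin m ⊕ Fin k₁ ⊕ Fin k₂ → ℂ := fun z w i => val (F i) z w
  have hsplit : ∀ z w,
      V.toBlocks₁₁ *ᵥ (fun _ => val p z w) + V.toBlocks₁₂ *ᵥ (Delta m k₁ k₂ z w *ᵥ f z w) =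
        (fun _ => val q z w) ∧
      V.toBlocks₂₁ *ᵥ (fun _ => val p z w) + V.toBlocks₂₂ *ᵥ (Delta m k₁ k₂ z w *ᵥ f z w) =
        Gamma m k₁ k₂ z *ᵥ f z w := by
    intro z w
    have h1 : Delta m k₁ k₂ z w *ᵥ f z w = Sum.elim (fun j => w * val (E j) z w)
        (Sum.elim (fun l => z * val (A l) z w) (fun l => val (B l) z w)) := by
      ext (i | i | i) <;> simp [Delta, mulVec_diagonal, f, F]
    have h2 : Gamma m k₁ k₂ z *ᵥ f z w = Sum.elim (fun j => val (E j) z w)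
        (Sum.elim (fun l => val (A l) z w) (fun l => z * val (B l) z w)) := by
      ext (i | i | i) <;> simp [Gamma, mulVec_diagonal, f, F]
    have h3 := hVF z w
    rw [← h1, ← h2, ← fromBlocks_toBlocks V, fromBlocks_mulVec] at h3
    exact ⟨congrArg (fun g => g ∘ Sum.inl) h3, congrArg (fun g => g ∘ Sum.inr) h3⟩
  have hker : ∀ z w, (Gamma m k₁ k₂ z - V.toBlocks₂₂ * Delta m k₁ k₂ z w) *ᵥ f z w =
      V.toBlocks₂₁ *ᵥ (fun _ => val p z w) := by
    intro z w
    rw [sub_mulVec, ← (hsplit z w).2, ← mulVec_mulVec, add_sub_cancel_right]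
  have hdvd : p ∣ D * q := dvd_det_pencil_mul hker fun z w => (hsplit z w).1
  obtain ⟨c, hc⟩ := hcop.dvd_of_dvd_mul_right hdvd
  have hc0 : c ≠ 0 := by
    rintro rfl
    exact hD (by rw [hc, mul_zero])
  have hd0 := degreeOf_zero_det_pencil_le V.toBlocks₂₂
  have hd1 := degreeOf_one_det_pencil_le V.toBlocks₂₂
  rw [← hDdef, hc, MvPolynomial.degreeOf_mul_eq hp0 hc0, hdeg.1] at hd0
  rw [← hDdef, hc, MvPolynomial.degreeOf_mul_eq hp0 hc0, hdeg.2] at hd1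
  -- As `D = p c` has degree at most `(k₁ + k₂, m)` with `k₁ + k₂ ≤ n`, while `p` has exact degree
  -- `(n, m)`, nothing is left for `c`, and `n ≤ k₁ + k₂`.
  obtain ⟨c₀, rfl⟩ := exists_eq_C (c := c) (by omega) (by omega)
  have hc₀ : c₀ ≠ 0 := by
    rintro rfl
    exact hc0 (map_zero _)
  refine ⟨by omega, V, hV, fun z w hpz => ?_⟩
  have hdet : IsUnit (Gamma m k₁ k₂ z - V.toBlocks₂₂ * Delta m k₁ k₂ z w).det := by
    rw [← val_det_pencil, ← hDdef, hc, val_mul, val_C]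
    exact (mul_ne_zero hpz hc₀).isUnit
  refine ⟨(Matrix.isUnit_iff_isUnit_det _).2 hdet, ?_⟩
  have h1 : f z w = (Gamma m k₁ k₂ z - V.toBlocks₂₂ * Delta m k₁ k₂ z w)⁻¹ *ᵥ
      (V.toBlocks₂₁ *ᵥ fun _ => val p z w) := by
    rw [← hker, mulVec_mulVec, Matrix.nonsing_inv_mul _ hdet, one_mulVec]
  have h2 := (hsplit z w).1
  rw [h1, mulVec_mulVec, mulVec_mulVec, mulVec_mulVec, ← add_mulVec] at h2
  have h3 := congrFun h2 0
  simp only [mulVec, dotProduct, Fin.sum_univ_one] at h3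
  rw [← h3, mul_div_assoc, div_self hpz, mul_one]

end BiPoly

end

/-! ### Bivariate polynomials as coefficient arrays, and the main theorem -/

noncomputable section

namespace BiPoly

open Polynomial Matrix

variable {k l n m : ℕ}

/-- The bivariate polynomial with the coefficients `c`. -/
def ofCoef : (Fin k × Fin l → ℂ) →ₗ[ℂ] MvPolynomial (Fin 2) ℂ where
  toFun c := ∑ α, MvPolynomial.monomial (expo α.1 α.2) (c α)
  map_add' c d := by simp [Finset.sum_add_distrib]
  map_smul' a c := by simp [Finset.smul_sum, MvPolynomial.smul_monomial]

lemma ofCoef_apply (c : Fin k × Fin l → ℂ) :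
    ofCoef c = ∑ α, MvPolynomial.monomial (expo α.1 α.2) (c α) := rfl

@[simp] lemma expo_apply_zero (i j : ℕ) : expo i j 0 = i := by simp [expo]

@[simp] lemma expo_apply_one (i j : ℕ) : expo i j 1 = j := by simp [expo]

lemma expo_eq_iff {i j : ℕ} {s : Fin 2 →₀ ℕ} : expo i j = s ↔ i = s 0 ∧ j = s 1 := by
  constructor
  · rintro rfl
    simp
  · rintro ⟨rfl, rfl⟩
    ext x
    fin_cases x <;> simp

lemma coeff_ofCoef (c : Fin k × Fin l → ℂ) (s : Fin 2 →₀ ℕ) :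
    (ofCoef c).coeff s =
      if h : s 0 < k ∧ s 1 < l then c (⟨s 0, h.1⟩, ⟨s 1, h.2⟩) else 0 := by
  simp only [ofCoef_apply, MvPolynomial.coeff_sum, MvPolynomial.coeff_monomial, expo_eq_iff]
  split_ifs with h
  · rw [Finset.sum_eq_single (⟨s 0, h.1⟩, ⟨s 1, h.2⟩)]
    · simp
    · rintro ⟨a, b⟩ _ hab
      exact if_neg fun hs => hab (Prod.ext (Fin.ext hs.1) (Fin.ext hs.2))
    · simp
  · refine Finset.sum_eq_zero fun α _ => if_neg fun hs => h ?_
    exact ⟨hs.1 ▸ α.1.2, hs.2 ▸ α.2.2⟩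

lemma ofCoef_injective : Function.Injective (ofCoef (k := k) (l := l)) := by
  intro c d h
  ext ⟨a, b⟩
  have h1 := congrArg (MvPolynomial.coeff (expo a b)) h
  simpa [coeff_ofCoef] using h1

lemma degreeOf_expo_monomial_le (i j : ℕ) (a : ℂ) (x : Fin 2) :
    (MvPolynomial.monomial (expo i j) a).degreeOf x ≤ expo i j x := by
  by_cases ha : a = 0
  · simp [ha]
  · exact (MvPolynomial.degreeOf_monomial_eq _ _ ha).le

lemma degreeAtMost_ofCoef (c : Fin k × Fin l → ℂ) : DegreeAtMost (k - 1) (l - 1) (ofCoef c) := by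
  constructor <;> rw [ofCoef_apply] <;>
    refine (MvPolynomial.degreeOf_sum_le _ _ _).trans (Finset.sup_le fun α _ =>
      (degreeOf_expo_monomial_le _ _ _ _).trans ?_)
  · rw [expo_apply_zero]
    omega
  · rw [expo_apply_one]
    omega

lemma val_ofCoef (c : Fin k × Fin l → ℂ) (z w : ℂ) :
    val (ofCoef c) z w = rowEval (polyVec c) z w := by
  simp only [ofCoef_apply, val_sum, rowEval, polyVec, eval_finsetSum, Finset.sum_mul,
    Fintype.sum_prod_type]
  rw [Finset.sum_comm]
  refine Finset.sum_congr rfl fun b _ => Finset.sum_congr rfl fun a _ => ?_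
  simp [val, MvPolynomial.eval_monomial, Finsupp.prod_fintype, mul_assoc]

lemma eq_ofCoef {p : MvPolynomial (Fin 2) ℂ} (hp : DegreeAtMost n m p) :
    p = ofCoef fun α : Fin (n + 1) × Fin (m + 1) => p.coeff (expo α.1 α.2) := by
  ext s
  rw [coeff_ofCoef]
  split_ifs with h
  · rw [expo_eq_iff.2 ⟨rfl, rfl⟩]
  · by_contra hs
    have hs' := MvPolynomial.mem_support_iff.2 hs
    exact h ⟨Nat.lt_succ_of_le ((MvPolynomial.monomial_le_degreeOf 0 hs').trans hp.1),
      Nat.lt_succ_of_le ((MvPolynomial.monomial_le_degreeOf 1 hs').trans hp.2)⟩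

lemma reflect_eq_ofCoef (p : MvPolynomial (Fin 2) ℂ) :
    reflect n m p = ofCoef fun α : Fin (n + 1) × Fin (m + 1) =>
      conj (p.coeff (expo (n - α.1) (m - α.2))) := by
  rw [ofCoef_apply, Fintype.sum_prod_type, reflect, Finset.sum_range]
  exact Finset.sum_congr rfl fun i _ => Finset.sum_range _

/-- The coefficients of `p` with respect to the second variable. -/
def wCoeff (n m : ℕ) (p : MvPolynomial (Fin 2) ℂ) (b : ℕ) : ℂ[X] :=
  if h : b < m + 1 then
    polyVec (fun α : Fin (n + 1) × Fin (m + 1) => p.coeff (expo α.1 α.2)) ⟨b, h⟩ else 0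

lemma coeff_wCoeff (p : MvPolynomial (Fin 2) ℂ) {b x : ℕ} (hb : b ≤ m) (hx : x ≤ n) :
    (wCoeff n m p b).coeff x = p.coeff (expo x b) := by
  rw [wCoeff, dif_pos (Nat.lt_succ_of_le hb), coeff_polyVec, dif_pos (Nat.lt_succ_of_le hx)]

lemma natDegree_wCoeff_le (p : MvPolynomial (Fin 2) ℂ) (b : ℕ) :
    (wCoeff n m p b).natDegree ≤ n := by
  rw [natDegree_le_iff_coeff_eq_zero, wCoeff]
  intro x hx
  split_ifs
  · rw [coeff_polyVec, dif_neg (by omega)]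
  · rfl

lemma wCoeff_eq_zero (p : MvPolynomial (Fin 2) ℂ) (b : ℕ) (hb : m < b) : wCoeff n m p b = 0 :=
  dif_neg (by omega)

lemma sum_wCoeff {p : MvPolynomial (Fin 2) ℂ} (hp : DegreeAtMost n m p) (z w : ℂ) :
    ∑ b ∈ Finset.range (m + 1), (wCoeff n m p b).eval z * w ^ b = val p z w := by
  conv_rhs => rw [eq_ofCoef hp, val_ofCoef]
  rw [Finset.sum_range, rowEval]
  exact Finset.sum_congr rfl fun b _ => by rw [wCoeff, dif_pos b.2]

lemma sum_reflectSeq (p : MvPolynomial (Fin 2) ℂ) (z w : ℂ) :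
    ∑ b ∈ Finset.range (m + 1), (reflectSeq n m (wCoeff n m p) b).eval z * w ^ b =
      val (reflect n m p) z w := by
  rw [reflect_eq_ofCoef, val_ofCoef, Finset.sum_range, rowEval]
  refine Finset.sum_congr rfl fun b _ => ?_
  congr 2
  ext x
  rw [coeff_reflectSeq (natDegree_wCoeff_le p), if_pos (Nat.lt_succ_iff.1 b.2), coeff_polyVec]
  by_cases hx : x ≤ n
  · rw [if_pos hx, dif_pos (Nat.lt_succ_of_le hx), coeff_wCoeff p (by omega) (by omega)]
  · rw [if_neg hx, dif_neg (by omega)]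

lemma eval_atZero (p : MvPolynomial (Fin 2) ℂ) (z : ℂ) : (atZero p).eval z = val p z 0 := by
  rw [atZero, MvPolynomial.aeval_def, ← coe_evalRingHom, MvPolynomial.hom_eval₂, val,
    MvPolynomial.eval_eq', MvPolynomial.eval₂_eq']
  simp [Fin.prod_univ_two]

lemma atZero_eq {p : MvPolynomial (Fin 2) ℂ} (hp : DegreeAtMost n m p) :
    atZero p = wCoeff n m p 0 := by
  refine Polynomial.funext fun z => ?_
  rw [eval_atZero, ← sum_wCoeff hp, Finset.sum_range_succ']
  simp

lemma val_ofCoef_coeff {E : Fin m → ℂ[X]} (hE : ∀ b, (E b).natDegree ≤ n) (z w : ℂ) :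
    val (ofCoef fun α : Fin (n + 1) × Fin m => (E α.2).coeff α.1) z w = rowEval E z w := by
  rw [val_ofCoef]
  congr 1
  ext b x
  rw [coeff_polyVec]
  split_ifs with h
  · rfl
  · exact (coeff_eq_zero_of_natDegree_lt ((hE b).trans_lt (by omega))).symm

end BiPoly

end

theorem mainTheorem9 (n m n₁ n₂ : ℕ) (p : MvPolynomial (Fin 2) ℂ)
    (hdeg : BiPoly.HasDegree n m p)
    (hzero : ∀ z w : ℂ, ‖z‖ = 1 → ‖w‖ < 1 → BiPoly.val p z w ≠ 0)
    (hcop : IsRelPrime p (BiPoly.reflect n m p))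
    (hn₂ : n₂ = BiPoly.zerosInDisk (BiPoly.atZero p))
    (hn₁ : n₁ + n₂ = n) :
    (∃ (E : Fin m → MvPolynomial (Fin 2) ℂ)
       (A : Fin n₁ → MvPolynomial (Fin 2) ℂ)
       (B : Fin n₂ → MvPolynomial (Fin 2) ℂ),
      (∀ z w : ℂ,
        ‖BiPoly.val p z w‖ ^ 2 - ‖BiPoly.val (BiPoly.reflect n m p) z w‖ ^ 2 =
          (1 - ‖w‖ ^ 2) * ∑ j, ‖BiPoly.val (E j) z w‖ ^ 2 +
          (1 - ‖z‖ ^ 2) *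
            (∑ j, ‖BiPoly.val (A j) z w‖ ^ 2 - ∑ j, ‖BiPoly.val (B j) z w‖ ^ 2)) ∧
      (∀ j, BiPoly.DegreeAtMost n (m - 1) (E j)) ∧
      (∀ j, BiPoly.DegreeAtMost (n - 1) m (A j)) ∧
      (∀ j, BiPoly.DegreeAtMost (n - 1) m (B j)) ∧
      LinearIndependent ℂ (Sum.elim A B)) ∧
    (∃ V ∈ Matrix.unitaryGroup (Fin 1 ⊕ (Fin m ⊕ Fin n₁ ⊕ Fin n₂)) ℂ,
      ∀ z w : ℂ, BiPoly.val p z w ≠ 0 →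
        IsUnit (BiPoly.Gamma m n₁ n₂ z - V.toBlocks₂₂ * BiPoly.Delta m n₁ n₂ z w) ∧
        BiPoly.val (BiPoly.reflect n m p) z w / BiPoly.val p z w =
          (V.toBlocks₁₁ + V.toBlocks₁₂ * BiPoly.Delta m n₁ n₂ z w *
            (BiPoly.Gamma m n₁ n₂ z - V.toBlocks₂₂ * BiPoly.Delta m n₁ n₂ z w)⁻¹ *
              V.toBlocks₂₁) 0 0) := by
  have hp : BiPoly.DegreeAtMost n m p := ⟨hdeg.1.le, hdeg.2.le⟩
  have hp0 : p ≠ 0 := by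
    rintro rfl
    exact hzero 1 0 norm_one (by simp) (map_zero _)
  have hd := BiPoly.natDegree_wCoeff_le (n := n) (m := m) p
  obtain ⟨E, hE, hS, k₁, hk₁, k₂, hk₂, A, B, hli, hAB⟩ := BiPoly.exists_factor (n₁ := n₁) hd
    (BiPoly.wCoeff_eq_zero p)
    (fun z w hz hw => by
      rw [BiPoly.sum_wCoeff hp]
      exact hzero z w hz hw)
    (by rw [hn₂, BiPoly.atZero_eq hp]) hn₁
  have hid := BiPoly.polarized_identity (BiPoly.natDegree_lowerMat_le hd hE)
    (BiPoly.natDegree_upperMat_le (BiPoly.natDegree_reflectSeq_le hd) hE) hS hAB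
  simp only [BiPoly.sum_wCoeff hp, BiPoly.sum_reflectSeq, ← BiPoly.val_ofCoef,
    ← BiPoly.val_ofCoef_coeff fun b => hE b _] at hid
  have hli' : LinearIndependent ℂ
      (Sum.elim (fun l => BiPoly.ofCoef (A l)) (fun l => BiPoly.ofCoef (B l))) := by
    have h := hli.map' BiPoly.ofCoef (LinearMap.ker_eq_bot.2 BiPoly.ofCoef_injective)
    rwa [Sum.comp_elim] at h
  -- The realization also returns `k₁ + k₂ = n`; together with `k₁ ≤ n₁`, `k₂ ≤ n₂` and `n₁ + n₂ =
  -- n` this makes both inequalities equalities.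
  obtain ⟨hk, hV⟩ := BiPoly.exists_realization hdeg hp0 hcop hli' (by omega) hid
  obtain rfl : k₁ = n₁ := by omega
  obtain rfl : k₂ = n₂ := by omega
  refine ⟨⟨fun j => BiPoly.ofCoef fun α : Fin (n + 1) × Fin m => (E α.2 j).coeff α.1,
    fun l => BiPoly.ofCoef (A l), fun l => BiPoly.ofCoef (B l), fun z w => ?_,
    fun j => BiPoly.degreeAtMost_ofCoef _, fun l => BiPoly.degreeAtMost_ofCoef _, fun l => BiPoly.degreeAtMost_ofCoef _, hli'⟩, hV⟩
  -- The identity with norms is the polarized one on the diagonal.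
  have h := hid z w z w
  simp only [Complex.mul_conj'] at h
  exact_mod_cast h
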